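/- Let $\mathbb{K}$ be a field of characteristic $0$. A dir-inv $\mathbb{K}$-module is a $\mathbb{K}$-module $M$ with submodules $F_jM$ ($j$ in a nonempty directed poset $J$, $F_jM\subset F_{j'}M$ for $j\le j'$) and, for each $j$, a decreasing sequence $F_jM\supset F^0F_jM\supset F^1F_jM\supset\cdots$ of submodules, such that for $j\le j'$ and every $i$ there is $i'$ with $F^{i'}F_jM\subset F^iF_{j'}M$. A linear map $\phi:M\to N$ is continuous if for every $j$ there is $k$ such that $\phi(F_jM)\subset F_kN$ and for every $i$ there is $i'$ with $\phi(F^{i'}F_jM)\subset F^iF_kN$; these are the morphisms of dir-inv modules. $M$ is complete if it is isomorphic, as a dir-inv module, to one for which $M=\bigcup_jF_jM$ and all the maps $F_jM\to\varprojlim_iF_jM/F^iF_jM$ are bijective. The completion is the module $\widehat M=\varinjlim_j\varprojlim_iF_jM/F^iF_jM$; for complete $M$ one has $\widehat M\cong M$. The tensor product $N\otimes M$ has $F_{(k,j)}(N\otimes M)$ equal to the image of $F_kN\otimes F_jM$, with $F^iF_{(k,j)}(N\otimes M)$ equal to the sum of the images of $F^iF_kN\otimes F_jM$ and $F_kN\otimes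 F^iF_jM$, and $N\widehat\otimes M$ is the completion of $N\otimes M$. Let $\Omega^q(\Delta^l)$ be the module of algebraic differential $q$-forms on $\operatorname{Spec}\mathbb{K}[t_0,\dots,t_l]/(t_0+\cdots+t_l-1)$, regarded as a dir-inv module with a single $F_0=\Omega^q(\Delta^l)$ and all $F^iF_0=0$. An order preserving $\alpha:[k]\to[l]$ induces $\alpha_*:\Omega^q(\Delta^l)\to\Omega^q(\Delta^k)$, the pullback along the linear map of simplices given by $\alpha$ on vertices. Let $\int_{\Delta^l}:\Omega^l(\Delta^l)\to\mathbb{K}$ be integration over the simplex, that is $$\int_{\Delta^l}t_0^{a_0}\cdots t_l^{a_l}\,dt_1\wedge\cdots\wedge dt_l=\frac{a_0!\cdots a_l!}{(l+a_0+\cdots+a_l)!}.$$ Let $M=\{M^q\}_{q\in\mathbb{N}}$ be a cosimplicial dir-inv $\mathbb{K}$-module (all the structure maps $\alpha^*:M^k\to M^l$ being continuous and linear) such that every $M^q$ is complete. Let $\mathrm{N}M$ be the standard normalization of $M$: $\mathrm{N}^qM=\bigcap_{i=0}^{q-1}\operatorname{Ker}(s^i:M^q\to M^{q-1})$, with differential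 $\sum_{i=0}^{q+1}(-1)^i\partial^i$. Let $\widehat{\widetilde{\mathrm N}}M$ be the complete Thom–Sullivan normalization: $\widehat{\widetilde{\mathrm N}}{}^qM$ consists of the sequences $(u_l)_{l\ge0}\in\prod_{l\ge 0}\Omega^q(\Delta^l)\widehat\otimes M^l$ such that $(1\otimes\alpha^*)(u_k)=(\alpha_*\otimes1)(u_l)$ in $\Omega^q(\Delta^k)\widehat\otimes M^l$ for all $k,l$ and all order preserving $\alpha:[k]\to[l]$, with differential induced by the exterior derivative. Then the maps $\int_{\Delta^q}:\Omega^q(\Delta^q)\widehat\otimes M^q\to\mathbb{K}\widehat\otimes M^q\cong M^q$ induce, by $(u_l)_{l\ge0}\mapsto\int_{\Delta^q}u_q$ in degree $q$, a homomorphism of complexes $$\int_\Delta:\widehat{\widetilde{\mathrm N}}M\to\mathrm{N}M,$$ and $\int_\Delta$ is a quasi-isomorphism, in fact a homotopy equivalence of complexes of $\mathbb{K}$-modules. -/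

import Mathlib

open CategoryTheory

universe u

namespace DirInv

noncomputable section

section InvModules

variable {C : Type u} [CommRing C]
variable {M N P : Type u} [AddCommGroup M] [Module C M] [AddCommGroup N] [Module C N]
  [AddCommGroup P] [Module C P]

/-- The inverse limit `lim_i M / F i` attached to an inv module structure
`F 0 ⊇ F 1 ⊇ ...` on `M`. -/
def invLim (F : ℕ → Submodule C M) (hF : Antitone F) : Submodule C (∀ i, M ⧸ F i) where
  carrier := {x | ∀ (i i' : ℕ) (h : i ≤ i'), Submodule.factor (hF h) (x i') = x i}
  add_mem' := by
    intro x y hx hy i i' h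
    simp only [Pi.add_apply, map_add, hx i i' h, hy i i' h]
  zero_mem' := by
    intro i i' h
    simp only [Pi.zero_apply, map_zero]
  smul_mem' := by
    intro c x hx i i' h
    simp only [Pi.smul_apply, map_smul, hx i i' h]

/-- The canonical map `M → lim_i M / F i`. -/
def toInvLim (F : ℕ → Submodule C M) (hF : Antitone F) : M →ₗ[C] invLim F hF :=
  LinearMap.codRestrict _ (LinearMap.pi fun i => (F i).mkQ) (by
    intro m i i' h
    simp [Submodule.factor])

/-- An inv module is complete if `M → lim_i M / F i` is bijective. -/
def InvComplete (F : ℕ → Submodule C M) (hF : Antitone F) : Prop :=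
  Function.Bijective (toInvLim F hF)

/-- Continuity of a linear map between inv modules. -/
def InvContinuous (F : ℕ → Submodule C M) (G : ℕ → Submodule C N) (φ : M →ₗ[C] N) : Prop :=
  ∀ i, ∃ i', F i' ≤ (G i).comap φ

theorem mapQ_eq_of_mem {F : ℕ → Submodule C M} {hF : Antitone F} {G : ℕ → Submodule C N}
    (φ : M →ₗ[C] N) {i a b : ℕ} (ha : F a ≤ (G i).comap φ) (hb : F b ≤ (G i).comap φ)
    (x : invLim F hF) :
    (F a).mapQ (G i) φ ha (x.1 a) = (F b).mapQ (G i) φ hb (x.1 b) := by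
  rw [← x.2 a (max a b) (le_max_left _ _), ← x.2 b (max a b) (le_max_right _ _)]
  obtain ⟨m, hm⟩ := Submodule.mkQ_surjective _ (x.1 (max a b))
  rw [← hm]
  simp [Submodule.factor]

/-- The map induced by a continuous linear map on the inverse limits. Its `i`-th component
is computed through any `i'` with `φ (F i') ⊆ G i`, see `invLimMap_apply`. -/
def invLimMap {F : ℕ → Submodule C M} {hF : Antitone F} {G : ℕ → Submodule C N}
    {hG : Antitone G} (φ : M →ₗ[C] N) (h : InvContinuous F G φ) :
    invLim F hF →ₗ[C] invLim G hG :=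
  LinearMap.codRestrict _
    (LinearMap.pi fun i => ((F (h i).choose).mapQ (G i) φ (h i).choose_spec) ∘ₗ
      LinearMap.proj (h i).choose ∘ₗ (invLim F hF).subtype) (by
    intro x i i' hii
    have h1 : F (h i').choose ≤ (G i).comap φ :=
      (h i').choose_spec.trans (Submodule.comap_mono (hG hii))
    have h2 := mapQ_eq_of_mem φ (h i).choose_spec h1 x
    simp only [LinearMap.pi_apply, LinearMap.comp_apply, LinearMap.proj_apply,
      Submodule.subtype_apply]
    rw [h2]
    obtain ⟨m, hm⟩ := Submodule.mkQ_surjective _ (x.1 (h i').choose)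
    rw [← hm]
    simp [Submodule.factor])

theorem invLimMap_apply {F : ℕ → Submodule C M} {hF : Antitone F} {G : ℕ → Submodule C N}
    {hG : Antitone G} (φ : M →ₗ[C] N) (h : InvContinuous F G φ) (x : invLim F hF) {i i' : ℕ}
    (hi : F i' ≤ (G i).comap φ) :
    (invLimMap (hG := hG) φ h x).1 i = (F i').mapQ (G i) φ hi (x.1 i') :=
  mapQ_eq_of_mem φ (h i).choose_spec hi x

theorem invLimMap_toInvLim {F : ℕ → Submodule C M} {hF : Antitone F} {G : ℕ → Submodule C N}
    {hG : Antitone G} (φ : M →ₗ[C] N) (h : InvContinuous F G φ) (m : M) :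
    invLimMap (hG := hG) φ h (toInvLim F hF m) = toInvLim G hG (φ m) := by
  apply Subtype.ext
  funext i
  rw [invLimMap_apply φ h _ (h i).choose_spec]
  rfl

theorem invLimMap_comp {F : ℕ → Submodule C M} {hF : Antitone F} {G : ℕ → Submodule C N}
    {hG : Antitone G} {H : ℕ → Submodule C P} {hH : Antitone H}
    (φ : M →ₗ[C] N) (h : InvContinuous F G φ) (ψ : N →ₗ[C] P) (h' : InvContinuous G H ψ)
    (χ : M →ₗ[C] P) (h'' : InvContinuous F H χ) (hχ : χ = ψ ∘ₗ φ) (x : invLim F hF) :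
    invLimMap (hG := hH) ψ h' (invLimMap (hG := hG) φ h x) = invLimMap (hG := hH) χ h'' x := by
  subst hχ
  apply Subtype.ext
  funext i
  obtain ⟨a, ha⟩ := h' i
  obtain ⟨b, hb⟩ := h a
  have hc : F b ≤ (H i).comap (ψ ∘ₗ φ) := fun y hy => ha (hb hy)
  rw [invLimMap_apply ψ h' _ ha, invLimMap_apply φ h _ hb, invLimMap_apply _ h'' _ hc]
  obtain ⟨m, hm⟩ := Submodule.mkQ_surjective _ (x.1 b)
  rw [← hm]
  simp

theorem invLimMap_id {F : ℕ → Submodule C M} {hF : Antitone F}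
    (φ : M →ₗ[C] M) (h : InvContinuous F F φ) (hφ : φ = LinearMap.id) (x : invLim F hF) :
    invLimMap (hG := hF) φ h x = x := by
  subst hφ
  apply Subtype.ext
  funext i
  rw [invLimMap_apply _ h x (le_refl (F i))]
  obtain ⟨m, hm⟩ := Submodule.mkQ_surjective _ (x.1 i)
  rw [← hm]
  simp

theorem invLimMap_zero {F : ℕ → Submodule C M} {hF : Antitone F} {G : ℕ → Submodule C N}
    {hG : Antitone G} (φ : M →ₗ[C] N) (h : InvContinuous F G φ) (hφ : φ = 0) (x : invLim F hF) :
    invLimMap (hG := hG) φ h x = 0 := by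
  subst hφ
  apply Subtype.ext
  funext i
  obtain ⟨a, ha⟩ := h i
  rw [invLimMap_apply _ h x ha]
  obtain ⟨m, hm⟩ := Submodule.mkQ_surjective _ (x.1 a)
  rw [← hm]
  simp

end InvModules

/-- A dir-inv `C`-module: a `C`-module `M` with a direct system of submodules `F j`, indexed by
a nonempty directed poset, and on each `F j` an inverse system `fil j 0 ⊇ fil j 1 ⊇ ...` of
submodules of `F j`, such that the inclusions `F j ⊆ F k` are continuous. -/
structure DirInvModule (C : Type u) [CommRing C] where
  carrier : Type u
  [addCommGroup : AddCommGroup carrier]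
  [module : Module C carrier]
  index : Type u
  [partialOrder : PartialOrder index]
  [nonempty : Nonempty index]
  [directed : IsDirectedOrder index]
  F : index → Submodule C carrier
  F_mono : Monotone F
  fil : index → ℕ → Submodule C carrier
  fil_le : ∀ j i, fil j i ≤ F j
  fil_anti : ∀ j, Antitone (fil j)
  fil_cont : ∀ j k, j ≤ k → ∀ i, ∃ i', fil j i' ≤ fil k i

namespace DirInvModule

attribute [instance] addCommGroup module partialOrder nonempty directed

variable {C : Type u} [CommRing C]

instance : CoeSort (DirInvModule C) (Type u) := ⟨carrier⟩

/-- A linear map sends `F j` into `F k` and is continuous between these two inv modules. -/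
structure PieceContinuous (M N : DirInvModule C) (φ : M →ₗ[C] N) (j : M.index) (k : N.index) :
    Prop where
  F_le : M.F j ≤ (N.F k).comap φ
  fil_le : ∀ i, ∃ i', M.fil j i' ≤ (N.fil k i).comap φ

/-- Continuity of a linear map between dir-inv modules. -/
def Continuous (M N : DirInvModule C) (φ : M →ₗ[C] N) : Prop :=
  ∀ j, ∃ k, PieceContinuous M N φ j k

/-- Morphisms of dir-inv modules: the continuous linear maps. -/
@[ext]
structure Hom (M N : DirInvModule C) where
  lin : M →ₗ[C] N
  cont : Continuous M N lin

theorem PieceContinuous.comp {M N P : DirInvModule C} {φ : M →ₗ[C] N} {ψ : N →ₗ[C] P}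
    {j : M.index} {k : N.index} {l : P.index} (h : PieceContinuous M N φ j k)
    (h' : PieceContinuous N P ψ k l) : PieceContinuous M P (ψ ∘ₗ φ) j l where
  F_le := fun _ hx => h'.F_le (h.F_le hx)
  fil_le := fun i => by
    obtain ⟨a, ha⟩ := h'.fil_le i
    obtain ⟨b, hb⟩ := h.fil_le a
    exact ⟨b, fun _ hx => ha (hb hx)⟩

theorem pieceContinuous_id {M : DirInvModule C} {j k : M.index} (h : j ≤ k) :
    PieceContinuous M M LinearMap.id j k where
  F_le := M.F_mono h
  fil_le := M.fil_cont j k h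

instance : Category (DirInvModule C) where
  Hom M N := Hom M N
  id M := ⟨LinearMap.id, fun j => ⟨j, pieceContinuous_id le_rfl⟩⟩
  comp f g := ⟨g.lin ∘ₗ f.lin, fun j => by
    obtain ⟨k, hk⟩ := f.cont j
    obtain ⟨l, hl⟩ := g.cont k
    exact ⟨l, hk.comp hl⟩⟩

@[simp]
theorem id_lin (M : DirInvModule C) : Hom.lin (𝟙 M) = LinearMap.id := rfl

@[simp]
theorem comp_lin {M N P : DirInvModule C} (f : M ⟶ N) (g : N ⟶ P) :
    Hom.lin (f ≫ g) = Hom.lin g ∘ₗ Hom.lin f := rfl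

theorem hom_ext {M N : DirInvModule C} {f g : M ⟶ N} (h : Hom.lin f = Hom.lin g) : f = g :=
  Hom.ext h

/-- The forgetful functor to modules. -/
def forgetToModule (C : Type u) [CommRing C] : DirInvModule C ⥤ ModuleCat.{u} C where
  obj M := ModuleCat.of C M
  map f := ModuleCat.ofHom (Hom.lin f)

/-- The inverse system of submodules of the module `F j`. -/
def filOn (M : DirInvModule C) (j : M.index) (i : ℕ) : Submodule C (M.F j) :=
  (M.fil j i).submoduleOf (M.F j)

theorem filOn_anti (M : DirInvModule C) (j : M.index) : Antitone (M.filOn j) :=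
  fun _ _ h => Submodule.comap_mono (M.fil_anti j h)

/-- The canonical map `colim_j F j → M`. -/
def colimToModule (M : DirInvModule C) [DecidableEq M.index] :
    Module.DirectLimit (fun j => M.F j) (fun _ _ h => Submodule.inclusion (M.F_mono h)) →ₗ[C] M :=
  Module.DirectLimit.lift C M.index _ _ (fun j => (M.F j).subtype) (fun _ _ _ _ => rfl)

open Classical in
/-- A dir-inv module is complete if it is isomorphic, in the category of dir-inv modules, to one
for which all the inv modules `F j` are complete and `colim_j F j → M` is bijective. -/
def IsComplete (M : DirInvModule C) : Prop :=
  ∃ M' : DirInvModule C, Nonempty (M ≅ M') ∧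
    (∀ j, InvComplete (M'.filOn j) (M'.filOn_anti j)) ∧ Function.Bijective M'.colimToModule

/-- The completion of the inv module `F j`. -/
abbrev piece (M : DirInvModule C) (j : M.index) : Submodule C (∀ i, M.F j ⧸ M.filOn j i) :=
  invLim (M.filOn j) (M.filOn_anti j)

theorem PieceContinuous.invContinuous {M N : DirInvModule C} {φ : M →ₗ[C] N} {j : M.index}
    {k : N.index} (h : PieceContinuous M N φ j k) :
    InvContinuous (M.filOn j) (N.filOn k) (φ.restrict h.F_le) := by
  intro i
  obtain ⟨a, ha⟩ := h.fil_le i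
  exact ⟨a, fun _ hx => ha hx⟩

/-- The map on completions of the `F j`'s induced by a continuous linear map. -/
def pieceMap {M N : DirInvModule C} {φ : M →ₗ[C] N} {j : M.index} {k : N.index}
    (h : PieceContinuous M N φ j k) : M.piece j →ₗ[C] N.piece k :=
  invLimMap (φ.restrict h.F_le) h.invContinuous

theorem pieceMap_comp {M N P : DirInvModule C} {φ : M →ₗ[C] N} {ψ : N →ₗ[C] P} {χ : M →ₗ[C] P}
    {j : M.index} {k : N.index} {l : P.index} (h : PieceContinuous M N φ j k)
    (h' : PieceContinuous N P ψ k l) (h'' : PieceContinuous M P χ j l) (hχ : χ = ψ ∘ₗ φ)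
    (x : M.piece j) : pieceMap h' (pieceMap h x) = pieceMap h'' x := by
  subst hχ
  exact invLimMap_comp _ _ _ _ _ _ rfl x

/-- The transition maps of the direct system of the completions of the `F j`'s. -/
def trans (M : DirInvModule C) (j k : M.index) (h : j ≤ k) : M.piece j →ₗ[C] M.piece k :=
  pieceMap (pieceContinuous_id h)

instance (M : DirInvModule C) : DirectedSystem (fun j => M.piece j) (M.trans · · ·) where
  map_self _ _ := invLimMap_id _ _ rfl _
  map_map _ _ _ h h' x := pieceMap_comp (pieceContinuous_id h) (pieceContinuous_id h')
    (pieceContinuous_id (h.trans h')) rfl x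

open Classical in
/-- The completion `colim_j lim_i F j / fil j i` of a dir-inv module, as a module. -/
def Completion (M : DirInvModule C) : Type u :=
  Module.DirectLimit (fun j => M.piece j) M.trans

open Classical in
instance (M : DirInvModule C) : AddCommGroup M.Completion :=
  @Module.DirectLimit.addCommGroup C _ M.index _ _ (fun j => M.piece j)
    (fun j => (M.piece j).addCommGroup) (fun j => (M.piece j).module) M.trans

open Classical in
instance (M : DirInvModule C) : Module C M.Completion :=
  Module.DirectLimit.module (fun j => M.piece j) M.trans

open Classical in
/-- The canonical map from the completion of `F j` to the completion of `M`. -/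
def Completion.of (M : DirInvModule C) (j : M.index) : M.piece j →ₗ[C] M.Completion :=
  Module.DirectLimit.of C M.index (fun j => M.piece j) M.trans j

theorem Completion.of_pieceMap {M N : DirInvModule C} {φ : M →ₗ[C] N} {j : M.index}
    {k k' : N.index} (h : PieceContinuous M N φ j k) (h' : PieceContinuous M N φ j k')
    (x : M.piece j) :
    Completion.of N k (pieceMap h x) = Completion.of N k' (pieceMap h' x) := by
  classical
  obtain ⟨l, hl, hl'⟩ := exists_ge_ge k k'
  have h1 : Completion.of N k (pieceMap h x) = Completion.of N l (N.trans k l hl (pieceMap h x)) :=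
    Module.DirectLimit.of_f.symm
  have h2 : Completion.of N k' (pieceMap h' x) =
      Completion.of N l (N.trans k' l hl' (pieceMap h' x)) :=
    Module.DirectLimit.of_f.symm
  rw [h1, h2, trans, trans,
    pieceMap_comp h (pieceContinuous_id hl) (h.comp (pieceContinuous_id hl)) rfl,
    pieceMap_comp h' (pieceContinuous_id hl') (h.comp (pieceContinuous_id hl)) rfl]

open Classical in
/-- The map induced on completions by a morphism of dir-inv modules. On the completion of
`F j` it is computed through any `k` such that `f : F j → F k` is continuous, see
`completionMap_of`. -/
def completionMap {M N : DirInvModule C} (f : M ⟶ N) : M.Completion →ₗ[C] N.Completion :=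
  Module.DirectLimit.lift C M.index (fun j => M.piece j) M.trans
    (fun j => Completion.of N (f.cont j).choose ∘ₗ pieceMap (f.cont j).choose_spec)
    (by
      intro j j' hjj x
      have h1 : PieceContinuous M N f.lin j (f.cont j').choose :=
        (pieceContinuous_id hjj).comp (f.cont j').choose_spec
      simp only [LinearMap.comp_apply]
      rw [trans, pieceMap_comp (pieceContinuous_id hjj) (f.cont j').choose_spec h1 rfl]
      exact Completion.of_pieceMap _ _ _)

theorem completionMap_of {M N : DirInvModule C} (f : M ⟶ N) {j : M.index} {k : N.index}
    (h : PieceContinuous M N (Hom.lin f) j k) (x : M.piece j) :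
    completionMap f (Completion.of M j x) = Completion.of N k (pieceMap h x) := by
  classical
  have : completionMap f (Completion.of M j x) =
      Completion.of N (f.cont j).choose (pieceMap (f.cont j).choose_spec x) :=
    Module.DirectLimit.lift_of (G := fun j => M.piece j) (f := M.trans) _ _ x
  rw [this]
  exact Completion.of_pieceMap _ _ _

theorem Completion.exists_of (M : DirInvModule C) (z : M.Completion) :
    ∃ j x, Completion.of M j x = z := by
  classical
  exact Module.DirectLimit.exists_of z

theorem completionMap_id (M : DirInvModule C) : completionMap (𝟙 M) = LinearMap.id := by
  ext z
  obtain ⟨j, x, rfl⟩ := Completion.exists_of M z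
  rw [completionMap_of (𝟙 M) (pieceContinuous_id (le_refl j))]
  exact congrArg _ (invLimMap_id _ _ rfl _)

theorem completionMap_comp {M N P : DirInvModule C} (f : M ⟶ N) (g : N ⟶ P) :
    completionMap (f ≫ g) = completionMap g ∘ₗ completionMap f := by
  ext z
  obtain ⟨j, x, rfl⟩ := Completion.exists_of M z
  obtain ⟨k, hk⟩ := f.cont j
  obtain ⟨l, hl⟩ := g.cont k
  rw [LinearMap.comp_apply, completionMap_of f hk, completionMap_of g hl,
    completionMap_of (f ≫ g) (hk.comp hl), pieceMap_comp hk hl (hk.comp hl) rfl]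

theorem completionMap_zero {M N : DirInvModule C} (f : M ⟶ N) (hf : Hom.lin f = 0) :
    completionMap f = 0 := by
  ext z
  obtain ⟨j, x, rfl⟩ := Completion.exists_of M z
  obtain ⟨k, hk⟩ := f.cont j
  have h0 : pieceMap hk x = 0 := invLimMap_zero _ _ (by
    ext y
    simp [hf]) x
  rw [completionMap_of f hk, h0, map_zero, LinearMap.zero_apply]

open Classical in
/-- The canonical map from `colim_j F j` to the completion. -/
def colimToCompletion (M : DirInvModule C) :
    Module.DirectLimit (fun j => M.F j) (fun _ _ h => Submodule.inclusion (M.F_mono h)) →ₗ[C]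
      M.Completion :=
  Module.DirectLimit.lift C M.index _ _
    (fun j => Completion.of M j ∘ₗ toInvLim (M.filOn j) (M.filOn_anti j)) (by
      intro j k h x
      have h1 : toInvLim (M.filOn k) (M.filOn_anti k) (Submodule.inclusion (M.F_mono h) x) =
          M.trans j k h (toInvLim (M.filOn j) (M.filOn_anti j) x) :=
        (invLimMap_toInvLim _ _ x).symm
      simp only [LinearMap.comp_apply]
      rw [h1]
      exact Module.DirectLimit.of_f)

theorem Completion.of_toInvLim (M : DirInvModule C) {j k : M.index} (m : M) (hj : m ∈ M.F j)
    (hk : m ∈ M.F k) :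
    Completion.of M j (toInvLim (M.filOn j) (M.filOn_anti j) ⟨m, hj⟩) =
      Completion.of M k (toInvLim (M.filOn k) (M.filOn_anti k) ⟨m, hk⟩) := by
  classical
  have key : ∀ (a b : M.index) (h : a ≤ b) (ha : m ∈ M.F a),
      Completion.of M a (toInvLim (M.filOn a) (M.filOn_anti a) ⟨m, ha⟩) =
      Completion.of M b (toInvLim (M.filOn b) (M.filOn_anti b) ⟨m, M.F_mono h ha⟩) := by
    intro a b h ha
    have h1 : M.trans a b h (toInvLim (M.filOn a) (M.filOn_anti a) ⟨m, ha⟩) =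
        toInvLim (M.filOn b) (M.filOn_anti b) ⟨m, M.F_mono h ha⟩ :=
      invLimMap_toInvLim _ _ _
    rw [← h1]
    exact Module.DirectLimit.of_f.symm
  obtain ⟨l, hl, hl'⟩ := exists_ge_ge j k
  rw [key j l hl hj, key k l hl' hk]

theorem completionMap_toInvLim {M N : DirInvModule C} (f : M ⟶ N) {j : M.index} {k : N.index}
    (m : M) (hj : m ∈ M.F j) (hk : Hom.lin f m ∈ N.F k) :
    completionMap f (Completion.of M j (toInvLim (M.filOn j) (M.filOn_anti j) ⟨m, hj⟩)) =
      Completion.of N k (toInvLim (N.filOn k) (N.filOn_anti k) ⟨Hom.lin f m, hk⟩) := by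
  obtain ⟨l, hl⟩ := f.cont j
  rw [completionMap_of f hl, pieceMap, invLimMap_toInvLim]
  exact Completion.of_toInvLim _ _ _ _

theorem colimToModule_of (M : DirInvModule C) [DecidableEq M.index] (j : M.index) (x : M.F j) :
    M.colimToModule (Module.DirectLimit.of C M.index _ _ j x) = x :=
  Module.DirectLimit.lift_of _ _ _

theorem IsComplete.colimToModule_bijective {M : DirInvModule C} (h : M.IsComplete)
    [DecidableEq M.index] : Function.Bijective M.colimToModule := by
  classical
  refine ⟨Module.DirectLimit.lift_injective _ _ fun j => (M.F j).injective_subtype, ?_⟩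
  intro m
  obtain ⟨M', ⟨e⟩, -, hM'⟩ := h
  obtain ⟨z, hz⟩ := hM'.2 (Hom.lin e.hom m)
  obtain ⟨k, x, rfl⟩ := Module.DirectLimit.exists_of z
  rw [colimToModule_of] at hz
  obtain ⟨j, hj⟩ := e.inv.cont k
  have h1 : Hom.lin e.inv (Hom.lin e.hom m) = m :=
    LinearMap.congr_fun (congrArg Hom.lin e.hom_inv_id) m
  have h2 : m ∈ M.F j := by
    rw [← h1, ← hz]
    exact hj.F_le x.2
  exact ⟨Module.DirectLimit.of C M.index _ _ j ⟨m, h2⟩, colimToModule_of _ _ _⟩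

theorem IsComplete.colimToCompletion_bijective {M : DirInvModule C} (h : M.IsComplete) :
    Function.Bijective M.colimToCompletion := by
  classical
  obtain ⟨M', ⟨e⟩, hM'c, hM'⟩ := h
  have hinv : ∀ z, completionMap e.inv (completionMap e.hom z) = z := by
    intro z
    rw [← LinearMap.comp_apply, ← completionMap_comp, e.hom_inv_id, completionMap_id]
    rfl
  have hinv' : ∀ m, Hom.lin e.inv (Hom.lin e.hom m) = m := fun m =>
    LinearMap.congr_fun (congrArg Hom.lin e.hom_inv_id) m
  have hinv'' : ∀ m, Hom.lin e.hom (Hom.lin e.inv m) = m := fun m =>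
    LinearMap.congr_fun (congrArg Hom.lin e.inv_hom_id) m
  have hof : ∀ (j : M.index) (x : M.F j), M.colimToCompletion
      (Module.DirectLimit.of C M.index _ _ j x) =
        Completion.of M j (toInvLim (M.filOn j) (M.filOn_anti j) x) :=
    fun j x => Module.DirectLimit.lift_of _ _ _
  constructor
  · rw [injective_iff_map_eq_zero]
    intro z hz
    obtain ⟨j, x, rfl⟩ := Module.DirectLimit.exists_of z
    rw [hof] at hz
    obtain ⟨k, hk⟩ := e.hom.cont j
    have h1 := completionMap_toInvLim e.hom x.1 x.2 (hk.F_le x.2)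
    rw [Subtype.coe_eta, hz, map_zero] at h1
    obtain ⟨l, hl, h2⟩ := Module.DirectLimit.of.zero_exact h1.symm
    have h3 : M'.trans k l hl (toInvLim (M'.filOn k) (M'.filOn_anti k)
        ⟨Hom.lin e.hom x.1, hk.F_le x.2⟩) = toInvLim (M'.filOn l) (M'.filOn_anti l)
        ⟨Hom.lin e.hom x.1, M'.F_mono hl (hk.F_le x.2)⟩ := invLimMap_toInvLim _ _ _
    rw [h3] at h2
    have h4 := (injective_iff_map_eq_zero _).1 (hM'c l).1 _ h2
    have h5 : Hom.lin e.hom x.1 = 0 := congrArg Subtype.val h4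
    have h6 : x = 0 := by
      apply Subtype.ext
      rw [← hinv' x.1, h5, map_zero]
      rfl
    rw [h6, map_zero]
  · intro z
    obtain ⟨k, y, hy⟩ := Completion.exists_of M' (completionMap e.hom z)
    obtain ⟨m, rfl⟩ := (hM'c k).2 y
    obtain ⟨j, hj⟩ := e.inv.cont k
    refine ⟨Module.DirectLimit.of C M.index _ _ j ⟨Hom.lin e.inv m.1, hj.F_le m.2⟩, ?_⟩
    rw [hof, ← hinv z, ← hy, completionMap_toInvLim e.inv m.1 m.2 (hj.F_le m.2)]

open Classical in
/-- For a complete dir-inv module, the canonical isomorphism from its completion to itself: it is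
the composition of the canonical bijections between the completion, `colim_j F j` and `M`. -/
def completionEquiv (M : DirInvModule C) (h : M.IsComplete) : M.Completion ≃ₗ[C] M :=
  (LinearEquiv.ofBijective M.colimToCompletion h.colimToCompletion_bijective).symm.trans
    (LinearEquiv.ofBijective M.colimToModule h.colimToModule_bijective)

/-- The tensor product of two dir-inv modules: `F (j, k)` is the image of `F j ⊗ F k`, and its
`i`-th submodule is the sum of the images of `fil j i ⊗ F k` and `F j ⊗ fil k i`. -/
def tensor (M N : DirInvModule C) : DirInvModule C where
  carrier := TensorProduct C M N
  index := M.index × N.index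
  partialOrder := inferInstance
  directed := ⟨fun a b => by
    obtain ⟨j, h1, h2⟩ := exists_ge_ge a.1 b.1
    obtain ⟨k, h3, h4⟩ := exists_ge_ge a.2 b.2
    exact ⟨(j, k), ⟨h1, h3⟩, ⟨h2, h4⟩⟩⟩
  F jk := Submodule.map₂ (TensorProduct.mk C M N) (M.F jk.1) (N.F jk.2)
  F_mono _ _ h := Submodule.map₂_le_map₂ (M.F_mono h.1) (N.F_mono h.2)
  fil jk i := Submodule.map₂ (TensorProduct.mk C M N) (M.fil jk.1 i) (N.F jk.2) ⊔
    Submodule.map₂ (TensorProduct.mk C M N) (M.F jk.1) (N.fil jk.2 i)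
  fil_le jk i := sup_le (Submodule.map₂_le_map₂ (M.fil_le _ _) le_rfl)
    (Submodule.map₂_le_map₂ le_rfl (N.fil_le _ _))
  fil_anti jk _ _ h := sup_le_sup (Submodule.map₂_le_map₂ (M.fil_anti _ h) le_rfl)
    (Submodule.map₂_le_map₂ le_rfl (N.fil_anti _ h))
  fil_cont jk jk' h i := by
    obtain ⟨a, ha⟩ := M.fil_cont _ _ h.1 i
    obtain ⟨b, hb⟩ := N.fil_cont _ _ h.2 i
    exact ⟨max a b, sup_le_sup
      (Submodule.map₂_le_map₂ ((M.fil_anti _ (le_max_left a b)).trans ha) (N.F_mono h.2))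
      (Submodule.map₂_le_map₂ (M.F_mono h.1) ((N.fil_anti _ (le_max_right a b)).trans hb))⟩

theorem map₂_mk_le_comap {M N M' N' : Type u} [AddCommGroup M] [Module C M] [AddCommGroup N]
    [Module C N] [AddCommGroup M'] [Module C M'] [AddCommGroup N'] [Module C N']
    (f : M →ₗ[C] M') (g : N →ₗ[C] N') {p : Submodule C M} {q : Submodule C N}
    {p' : Submodule C M'} {q' : Submodule C N'} (hp : p ≤ p'.comap f) (hq : q ≤ q'.comap g) :
    Submodule.map₂ (TensorProduct.mk C M N) p q ≤
      (Submodule.map₂ (TensorProduct.mk C M' N') p' q').comap (TensorProduct.map f g) := by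
  rw [Submodule.map₂_le]
  intro m hm n hn
  exact Submodule.apply_mem_map₂ (TensorProduct.mk C M' N') (hp hm) (hq hn)

/-- The tensor product of two morphisms of dir-inv modules. -/
def tensorMap {M N M' N' : DirInvModule C} (f : M ⟶ M') (g : N ⟶ N') :
    tensor M N ⟶ tensor M' N' where
  lin := TensorProduct.map (Hom.lin f) (Hom.lin g)
  cont := by
    rintro ⟨j, k⟩
    obtain ⟨j', hj⟩ := f.cont j
    obtain ⟨k', hk⟩ := g.cont k
    refine ⟨(j', k'), map₂_mk_le_comap _ _ hj.F_le hk.F_le, fun i => ?_⟩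
    obtain ⟨a, ha⟩ := hj.fil_le i
    obtain ⟨b, hb⟩ := hk.fil_le i
    refine ⟨max a b, sup_le ?_ ?_⟩
    · exact (map₂_mk_le_comap _ _ ((M.fil_anti _ (le_max_left a b)).trans ha) hk.F_le).trans
        (Submodule.comap_mono le_sup_left)
    · exact (map₂_mk_le_comap _ _ hj.F_le ((N.fil_anti _ (le_max_right a b)).trans hb)).trans
        (Submodule.comap_mono le_sup_right)

theorem tensorMap_comp {M N M' N' M'' N'' : DirInvModule C} (f : M ⟶ M') (g : N ⟶ N')
    (f' : M' ⟶ M'') (g' : N' ⟶ N'') :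
    tensorMap (f ≫ f') (g ≫ g') = tensorMap f g ≫ tensorMap f' g' :=
  hom_ext (TensorProduct.map_comp _ _ _ _)

/-- A module, viewed as a discrete inv module (with the zero filtration), and hence as a dir-inv
module indexed by a point. -/
def discrete (M : Type u) [AddCommGroup M] [Module C M] : DirInvModule C where
  carrier := M
  index := PUnit
  F _ := ⊤
  F_mono _ _ _ := le_rfl
  fil _ _ := ⊥
  fil_le _ _ := bot_le
  fil_anti _ _ _ _ := le_rfl
  fil_cont _ _ _ _ := ⟨0, le_rfl⟩

/-- A linear map, viewed as a morphism of discrete dir-inv modules. -/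
def discreteMap {M N : Type u} [AddCommGroup M] [Module C M] [AddCommGroup N] [Module C N]
    (f : M →ₗ[C] N) : discrete (C := C) M ⟶ discrete (C := C) N where
  lin := f
  cont _ := ⟨PUnit.unit, fun _ _ => trivial, fun _ => ⟨0, bot_le⟩⟩

/-- The canonical morphism `C ⊗ M → M` of dir-inv modules. -/
def lidHom (M : DirInvModule C) : tensor (discrete (C := C) C) M ⟶ M where
  lin := (TensorProduct.lid C M).toLinearMap
  cont := by
    rintro ⟨_, k⟩
    refine ⟨k, ?_, fun i => ⟨i, sup_le ?_ ?_⟩⟩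
    · refine Submodule.map₂_le.2 fun c _ m hm => ?_
      exact (M.F k).smul_mem c hm
    · refine Submodule.map₂_le.2 fun c hc m hm => ?_
      have hc0 : c = 0 := hc
      subst hc0
      change (0 : C) • m ∈ M.fil k i
      rw [zero_smul]
      exact zero_mem _
    · refine Submodule.map₂_le.2 fun c _ m hm => ?_
      exact (M.fil k i).smul_mem c hm

end DirInvModule

section Forms

variable (K : Type u) [Field K]

/-- The ideal of `K[t_0, ..., t_l]` generated by `t_0 + ... + t_l - 1`. -/
def simplexIdeal (l : ℕ) : Ideal (MvPolynomial (Fin (l + 1)) K) :=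
  Ideal.span {∑ i, MvPolynomial.X i - 1}

/-- The coordinate ring `K[t_0, ..., t_l] / (t_0 + ... + t_l - 1)` of the geometric simplex. -/
abbrev SimplexRing (l : ℕ) : Type u := MvPolynomial (Fin (l + 1)) K ⧸ simplexIdeal K l

/-- The space of translations of the affine space `t_0 + ... + t_l = 1`; it is the tangent space
of the geometric simplex at each of its points. -/
def simplexTangent (l : ℕ) : Submodule K (Fin (l + 1) → K) where
  carrier := {v | ∑ i, v i = 0}
  add_mem' := by
    intro v w hv hw
    simp only [Set.mem_ofPred_eq, Pi.add_apply, Finset.sum_add_distrib] at *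
    rw [hv, hw, add_zero]
  zero_mem' := by simp
  smul_mem' := by
    intro c v hv
    simp only [Set.mem_ofPred_eq, Pi.smul_apply, ← Finset.smul_sum] at *
    rw [hv, smul_zero]

variable {K}

/-- The linear map out of the coordinate ring of the simplex given by a linear map `φ` on
polynomials that vanishes on the multiples of `t_0 + ... + t_l - 1`. -/
def simplexLift {l : ℕ} {W : Type u} [AddCommGroup W] [Module K W]
    (φ : MvPolynomial (Fin (l + 1)) K →ₗ[K] W)
    (h : ∀ p, φ (p * (∑ i, MvPolynomial.X i - 1)) = 0) : SimplexRing K l →ₗ[K] W :=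
  ((simplexIdeal K l).restrictScalars K).liftQ φ (by
    intro x hx
    obtain ⟨p, rfl⟩ := Ideal.mem_span_singleton'.1 hx
    exact h p) ∘ₗ
  (Submodule.Quotient.restrictScalarsEquiv K (simplexIdeal K l)).symm.toLinearMap

theorem simplexLift_mk {l : ℕ} {W : Type u} [AddCommGroup W] [Module K W]
    (φ : MvPolynomial (Fin (l + 1)) K →ₗ[K] W)
    (h : ∀ p, φ (p * (∑ i, MvPolynomial.X i - 1)) = 0) (p : MvPolynomial (Fin (l + 1)) K) :
    simplexLift φ h (Ideal.Quotient.mk (simplexIdeal K l) p) = φ p := rfl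

/-- The derivation `∑ i, v i * ∂ / ∂ t_i` of the polynomial ring. -/
def polyDeriv {l : ℕ} (v : Fin (l + 1) → K) :
    Derivation K (MvPolynomial (Fin (l + 1)) K) (MvPolynomial (Fin (l + 1)) K) :=
  MvPolynomial.mkDerivation K fun i => MvPolynomial.C (v i)

theorem simplexRel_eq_zero (l : ℕ) :
    Ideal.Quotient.mk (simplexIdeal K l) (∑ i, MvPolynomial.X i - 1) = 0 :=
  Ideal.Quotient.eq_zero_iff_mem.2 (Ideal.subset_span rfl)

/-- The directional derivative `∂_v` on the coordinate ring of the simplex, for a tangent vector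
`v`. -/
def dirDeriv {l : ℕ} (v : simplexTangent K l) : SimplexRing K l →ₗ[K] SimplexRing K l :=
  simplexLift ((Ideal.Quotient.mkₐ K (simplexIdeal K l)).toLinearMap ∘ₗ
    (polyDeriv v.1 : MvPolynomial (Fin (l + 1)) K →ₗ[K] MvPolynomial (Fin (l + 1)) K)) (by
    intro p
    have h0 : polyDeriv v.1 (∑ i, MvPolynomial.X i - 1) = 0 := by
      have hv : ∑ i, v.1 i = 0 := v.2
      rw [map_sub, map_sum, Derivation.map_one_eq_zero, sub_zero]
      simp only [polyDeriv, MvPolynomial.mkDerivation_X]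
      rw [← map_sum, hv, map_zero]
    simp only [LinearMap.comp_apply, Derivation.coeFn_coe, AlgHom.toLinearMap_apply,
      Ideal.Quotient.mkₐ_eq_mk]
    rw [Derivation.leibniz, h0, smul_zero, zero_add, smul_eq_mul, map_mul, simplexRel_eq_zero,
      zero_mul])

theorem dirDeriv_mk {l : ℕ} (v : simplexTangent K l) (p : MvPolynomial (Fin (l + 1)) K) :
    dirDeriv v (Ideal.Quotient.mk _ p) = Ideal.Quotient.mk _ (polyDeriv v.1 p) := rfl

theorem polyDeriv_add {l : ℕ} (v w : Fin (l + 1) → K) :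
    polyDeriv (v + w) = polyDeriv v + polyDeriv w := by
  apply MvPolynomial.derivation_ext
  intro j
  simp [polyDeriv]

theorem polyDeriv_smul {l : ℕ} (c : K) (v : Fin (l + 1) → K) :
    polyDeriv (c • v) = c • polyDeriv v := by
  apply MvPolynomial.derivation_ext
  intro j
  simp [polyDeriv, MvPolynomial.smul_eq_C_mul]

/-- The directional derivative, as a linear map in the tangent vector. -/
def dirDerivLin (l : ℕ) :
    simplexTangent K l →ₗ[K] SimplexRing K l →ₗ[K] SimplexRing K l where
  toFun := dirDeriv
  map_add' v w := by
    refine LinearMap.ext fun f => ?_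
    obtain ⟨p, rfl⟩ := Ideal.Quotient.mk_surjective f
    rw [LinearMap.add_apply, dirDeriv_mk, dirDeriv_mk, dirDeriv_mk, Submodule.coe_add,
      polyDeriv_add, Derivation.add_apply, map_add]
  map_smul' c v := by
    refine LinearMap.ext fun f => ?_
    obtain ⟨p, rfl⟩ := Ideal.Quotient.mk_surjective f
    rw [RingHom.id_apply, LinearMap.smul_apply, dirDeriv_mk, dirDeriv_mk, Submodule.coe_smul,
      polyDeriv_smul, Derivation.smul_apply]
    rfl

theorem dirDeriv_comm {l : ℕ} (v w : simplexTangent K l) (f : SimplexRing K l) :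
    dirDeriv v (dirDeriv w f) = dirDeriv w (dirDeriv v f) := by
  obtain ⟨p, rfl⟩ := Ideal.Quotient.mk_surjective f
  rw [dirDeriv_mk, dirDeriv_mk, dirDeriv_mk, dirDeriv_mk]
  refine congrArg _ ?_
  have h : ⁅polyDeriv v.1, polyDeriv w.1⁆ = 0 := by
    apply MvPolynomial.derivation_ext
    intro i
    simp [Derivation.commutator_apply, polyDeriv]
  have h2 := congrArg (fun D => D p) h
  simpa [Derivation.commutator_apply, sub_eq_zero] using h2

variable (K) in
/-- The module of algebraic differential `q`-forms on the geometric simplex of dimension `l`.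
The simplex is an affine space with tangent space `simplexTangent K l`, so a `q`-form is an
alternating `q`-form on this vector space with values in the coordinate ring; for instance
`f * dt_{i_1} ∧ ... ∧ dt_{i_q}` is the form
`(v_1, ..., v_q) ↦ f * det (v_b (i_a))_{a, b}`. -/
abbrev Form (q l : ℕ) : Type u := (simplexTangent K l) [⋀^Fin q]→ₗ[K] (SimplexRing K l)

/-- The covariant differential: `(v, v_1, ..., v_q) ↦ ∂_v (ω (v_1, ..., v_q))`. -/
def formGrad (q l : ℕ) :
    Form K q l →ₗ[K] simplexTangent K l →ₗ[K] Form K q l :=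
  LinearMap.mk₂ K (fun ω v => (dirDerivLin l v).compAlternatingMap ω)
    (fun ω η v => by ext; simp) (fun c ω v => by ext; simp)
    (fun ω v w => by ext; simp) (fun c ω v => by ext; simp)

/-- The exterior derivative:
`dω (v_0, ..., v_q) = ∑ i, (-1) ^ i * ∂_{v_i} (ω (v_0, ..., v_{i-1}, v_{i+1}, ..., v_q))`. -/
def formD (q l : ℕ) : Form K q l →ₗ[K] Form K (q + 1) l :=
  AlternatingMap.alternatizeUncurryFinLM ∘ₗ formGrad q l

theorem formD_apply {q l : ℕ} (ω : Form K q l) (v : Fin (q + 1) → simplexTangent K l) :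
    formD (K := K) q l ω v = ∑ i : Fin (q + 1), (-1 : ℤ) ^ (i : ℕ) • dirDeriv (v i) (ω (i.removeNth v)) := by
  simp [formD, AlternatingMap.alternatizeUncurryFin_apply, formGrad, dirDerivLin]

theorem formD_formD (q l : ℕ) : formD (K := K) (q + 1) l ∘ₗ formD q l = 0 := by
  refine LinearMap.ext fun ω => ?_
  let f : simplexTangent K l →ₗ[K] simplexTangent K l →ₗ[K] Form K q l :=
    (formGrad (K := K) q l ∘ₗ formGrad (K := K) q l ω).flip
  have hf : ∀ x y, f x y = f y x := by
    intro x y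
    ext v
    exact dirDeriv_comm _ _ _
  have h : formGrad (K := K) (q + 1) l (formD (K := K) q l ω) =
      AlternatingMap.alternatizeUncurryFinLM ∘ₗ f := by
    refine LinearMap.ext fun x => AlternatingMap.ext fun v => ?_
    have h1 : formGrad (K := K) (q + 1) l (formD (K := K) q l ω) x v =
        dirDeriv x (formD (K := K) q l ω v) := rfl
    rw [h1, formD_apply, map_sum, LinearMap.comp_apply,
      AlternatingMap.alternatizeUncurryFinLM_apply, AlternatingMap.alternatizeUncurryFin_apply]
    refine Finset.sum_congr rfl fun i _ => ?_
    rw [map_zsmul]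
    rfl
  have h2 := AlternatingMap.alternatizeUncurryFin_alternatizeUncurryFinLM_comp_of_symmetric hf
  rw [← h] at h2
  exact h2

/-- The affine map of polynomial rings `t_j ↦ ∑_{α i = j} t_i` attached to `α`. -/
def polyPullback {k l : ℕ} (α : Fin (k + 1) → Fin (l + 1)) :
    MvPolynomial (Fin (l + 1)) K →ₐ[K] MvPolynomial (Fin (k + 1)) K :=
  MvPolynomial.aeval fun j => ∑ i with α i = j, MvPolynomial.X i

/-- The homomorphism of coordinate rings `t_j ↦ ∑_{α i = j} t_i`, which corresponds to the linear
morphism of simplices that sends the vertex `i` to the vertex `α i`. -/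
def ringPullback {k l : ℕ} (α : Fin (k + 1) → Fin (l + 1)) :
    SimplexRing K l →ₐ[K] SimplexRing K k :=
  Ideal.quotientMapₐ _ (polyPullback α) (by
    rw [simplexIdeal, Ideal.span_le, Set.singleton_subset_iff]
    have : polyPullback (K := K) α (∑ j, MvPolynomial.X j - 1) = ∑ i, MvPolynomial.X i - 1 := by
      simp only [polyPullback, map_sub, map_sum, MvPolynomial.aeval_X, map_one]
      rw [Finset.sum_fiberwise]
    change polyPullback α _ ∈ simplexIdeal K k
    rw [this]
    exact Ideal.subset_span rfl)

theorem ringPullback_mk {k l : ℕ} (α : Fin (k + 1) → Fin (l + 1))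
    (p : MvPolynomial (Fin (l + 1)) K) :
    ringPullback α (Ideal.Quotient.mk _ p) = Ideal.Quotient.mk _ (polyPullback α p) := rfl

/-- The tangent map `v ↦ (∑_{α i = j} v i)_j` of the linear morphism of simplices. -/
def tangentMap {k l : ℕ} (α : Fin (k + 1) → Fin (l + 1)) :
    simplexTangent K k →ₗ[K] simplexTangent K l where
  toFun v := ⟨fun j => ∑ i with α i = j, v.1 i, by
    have hv : ∑ i, v.1 i = 0 := v.2
    change ∑ j, ∑ i with α i = j, v.1 i = 0
    rw [Finset.sum_fiberwise, hv]⟩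
  map_add' v w := by
    ext j
    simp [Finset.sum_add_distrib]
  map_smul' c v := by
    ext j
    simp [Finset.mul_sum]

/-- The pullback of differential forms along the linear morphism of simplices. -/
def formPullback (q : ℕ) {k l : ℕ} (α : Fin (k + 1) → Fin (l + 1)) :
    Form K q l →ₗ[K] Form K q k where
  toFun ω := ((ringPullback α).toLinearMap.compAlternatingMap ω).compLinearMap (tangentMap α)
  map_add' ω η := by ext; simp
  map_smul' c ω := by ext; simp

theorem dirDeriv_ringPullback {k l : ℕ} (α : Fin (k + 1) → Fin (l + 1))
    (v : simplexTangent K k) (f : SimplexRing K l) :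
    dirDeriv v (ringPullback α f) = ringPullback α (dirDeriv (tangentMap α v) f) := by
  obtain ⟨p, rfl⟩ := Ideal.Quotient.mk_surjective f
  simp only [dirDeriv_mk, ringPullback_mk]
  congr 1
  induction p using MvPolynomial.induction_on with
  | C a => simp [polyPullback, polyDeriv]
  | add p q hp hq => simp only [map_add, hp, hq]
  | mul_X p j hp =>
    simp only [map_mul, Derivation.leibniz, map_add, smul_eq_mul, hp]
    congr 2
    simp [polyPullback, polyDeriv, tangentMap]

theorem formD_formPullback (q : ℕ) {k l : ℕ} (α : Fin (k + 1) → Fin (l + 1)) :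
    formD q k ∘ₗ formPullback (K := K) q α = formPullback (q + 1) α ∘ₗ formD q l := by
  ext ω v
  simp only [LinearMap.comp_apply, formD_apply, formPullback, LinearMap.coe_mk, AddHom.coe_mk,
    AlternatingMap.compLinearMap_apply, LinearMap.compAlternatingMap_apply,
    AlgHom.toLinearMap_apply, dirDeriv_ringPullback, map_sum, map_zsmul]
  rfl

/-- Integration of polynomials over the simplex with respect to `dt_1 ... dt_l`:
`∫ t_0 ^ a_0 ... t_l ^ a_l dt_1 ... dt_l = a_0! ... a_l! / (l + a_0 + ... + a_l)!`. -/
def polyIntegral (l : ℕ) : MvPolynomial (Fin (l + 1)) K →ₗ[K] K :=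
  (MvPolynomial.basisMonomials (Fin (l + 1)) K).constr K fun a =>
    (∏ i, ((a i).factorial : K)) / ((l + ∑ i, a i).factorial : K)

theorem polyIntegral_monomial (l : ℕ) (a : Fin (l + 1) →₀ ℕ) (c : K) :
    polyIntegral l (MvPolynomial.monomial a c) =
      c * ((∏ i, ((a i).factorial : K)) / ((l + ∑ i, a i).factorial : K)) := by
  have h : MvPolynomial.monomial a c =
      c • MvPolynomial.basisMonomials (Fin (l + 1)) K a := by
    rw [MvPolynomial.coe_basisMonomials, MvPolynomial.smul_monomial, smul_eq_mul, mul_one]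
  rw [h, map_smul, polyIntegral, Module.Basis.constr_basis, smul_eq_mul]

theorem polyIntegral_rel [CharZero K] (l : ℕ) (p : MvPolynomial (Fin (l + 1)) K) :
    polyIntegral l (p * (∑ i, MvPolynomial.X i - 1)) = 0 := by
  induction p using MvPolynomial.induction_on' with
  | add p q hp hq => rw [add_mul, map_add, hp, hq, add_zero]
  | monomial a c =>
    have hX : ∀ i : Fin (l + 1), MvPolynomial.monomial a c * MvPolynomial.X i =
        MvPolynomial.monomial (a + Finsupp.single i 1) c := by
      intro i
      rw [MvPolynomial.X, MvPolynomial.monomial_mul, mul_one]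
    have hs : ∀ i : Fin (l + 1), ∑ j, (a + Finsupp.single i 1 : Fin (l + 1) →₀ ℕ) j = ∑ j, a j + 1 := by
      intro i
      simp [Finset.sum_add_distrib, Finsupp.single_apply]
    have hp : ∀ i : Fin (l + 1), ∏ j, (((a + Finsupp.single i 1 : Fin (l + 1) →₀ ℕ) j).factorial : K) =
        (a i + 1) * ∏ j, ((a j).factorial : K) := by
      intro i
      rw [← Finset.mul_prod_erase _ _ (Finset.mem_univ i),
        ← Finset.mul_prod_erase _ (fun j => ((a j).factorial : K)) (Finset.mem_univ i), ← mul_assoc]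
      congr 1
      · simp [Nat.factorial_succ]
      · refine Finset.prod_congr rfl fun j hj => ?_
        have hji : j ≠ i := Finset.ne_of_mem_erase hj
        simp [hji.symm]
    rw [mul_sub, mul_one, Finset.mul_sum, map_sub, map_sum, sub_eq_zero]
    simp only [hX, polyIntegral_monomial, hs, hp]
    rw [← Finset.mul_sum, ← Finset.sum_div, ← Finset.sum_mul, Finset.sum_add_distrib]
    have h1 : (l + (∑ j, a j + 1)).factorial =
        (l + ∑ j, a j + 1) * (l + ∑ j, a j).factorial := by
      rw [← add_assoc, Nat.factorial_succ]
    have h2 : ((l + ∑ j, a j).factorial : K) ≠ 0 := Nat.cast_ne_zero.2 (Nat.factorial_ne_zero _)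
    have h3 : ((l + ∑ j, a j + 1 : ℕ) : K) ≠ 0 := Nat.cast_ne_zero.2 (Nat.succ_ne_zero _)
    rw [h1, Nat.cast_mul]
    have h4 : ∑ i, (a i : K) + ∑ i : Fin (l + 1), (1 : K) = ((l + ∑ j, a j + 1 : ℕ) : K) := by
      simp
      ring
    rw [h4, mul_div_mul_left _ _ h3]

/-- Integration over the simplex of functions, with respect to `dt_1 ... dt_l`. -/
def ringIntegral [CharZero K] (l : ℕ) : SimplexRing K l →ₗ[K] K :=
  simplexLift (polyIntegral l) (polyIntegral_rel l)

/-- The tangent vector from the vertex `0` to the vertex `i + 1`. -/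
def edgeVector {l : ℕ} (i : Fin l) : simplexTangent K l :=
  ⟨Pi.single i.succ (1 : K) - Pi.single (0 : Fin (l + 1)) (1 : K), by
    change ∑ j, ((Pi.single i.succ (1 : K) : Fin (l + 1) → K) j -
      (Pi.single (0 : Fin (l + 1)) (1 : K) : Fin (l + 1) → K) j) = 0
    simp⟩

/-- Integration of top degree forms on the simplex. A form of degree `l` is `f dt_1 ∧ ... ∧ dt_l`,
where `f` is its value on the vectors from the vertex `0` to the vertices `1, ..., l`. -/
def formIntegral [CharZero K] (l : ℕ) : Form K l l →ₗ[K] K where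
  toFun ω := ringIntegral l (ω edgeVector)
  map_add' ω η := by simp
  map_smul' c ω := by simp

end Forms

section Normalization

open Simplicial

variable {K : Type u} [CommRing K]

/-- The submodule `N^q X = ⋂_{i < q} Ker (s^i : X^q → X^{q-1})` of `X^q`. -/
def normSub (X : CosimplicialObject (ModuleCat.{u} K)) (q : ℕ) : Submodule K (X.obj ⦋q⦌) :=
  match q with
  | 0 => ⊤
  | q + 1 => ⨅ i : Fin (q + 1), LinearMap.ker (X.σ i).hom

theorem objD_mem_normSub (X : CosimplicialObject (ModuleCat.{u} K)) (q : ℕ) (m : X.obj ⦋q⦌)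
    (hm : m ∈ normSub X q) :
    (AlgebraicTopology.AlternatingCofaceMapComplex.objD X q).hom m ∈ normSub X (q + 1) := by
  simp only [normSub, Submodule.mem_iInf, LinearMap.mem_ker]
  intro j
  have hsum : (X.σ j).hom ((AlgebraicTopology.AlternatingCofaceMapComplex.objD X q).hom m) =
      ∑ i : Fin (q + 2), (-1 : ℤ) ^ (i : ℕ) • (X.δ i ≫ X.σ j).hom m := by
    simp [AlgebraicTopology.AlternatingCofaceMapComplex.objD, ModuleCat.hom_sum,
      LinearMap.sum_apply]
  rw [hsum, Fintype.sum_eq_add j.castSucc j.succ (Fin.castSucc_lt_succ).ne]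
  · rw [CosimplicialObject.δ_comp_σ_self, CosimplicialObject.δ_comp_σ_succ]
    simp [pow_succ]
  · rintro i ⟨hi1, hi2⟩
    cases q with
    | zero =>
      exfalso
      fin_cases i <;> fin_cases j <;> simp_all
    | succ n =>
      simp only [normSub, Submodule.mem_iInf, LinearMap.mem_ker] at hm
      rcases lt_or_gt_of_ne hi1 with h | h
      · have hi : (i : ℕ) < j := h
        have e2 : j = (⟨j - 1, by omega⟩ : Fin (n + 1)).succ := by
          ext
          simp
          omega
        have e3 : X.δ i ≫ X.σ j = X.σ (⟨j - 1, by omega⟩ : Fin (n + 1)) ≫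
            X.δ (⟨i, by omega⟩ : Fin (n + 2)) := by
          rw [← CosimplicialObject.δ_comp_σ_of_le X (by
            rw [Fin.le_def]
            simp
            omega), ← e2]
          rfl
        rw [e3, ModuleCat.hom_comp, LinearMap.comp_apply, hm, map_zero, smul_zero]
      · have hi : (j : ℕ) < i := h
        have hi' : (i : ℕ) ≠ j + 1 := fun h' => hi2 (Fin.ext h')
        have e1 : i = (⟨i - 1, by omega⟩ : Fin (n + 2)).succ := by
          ext
          simp
          omega
        have e3 : X.δ i ≫ X.σ j = X.σ (⟨j, by omega⟩ : Fin (n + 1)) ≫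
            X.δ (⟨i - 1, by omega⟩ : Fin (n + 2)) := by
          rw [← CosimplicialObject.δ_comp_σ_of_gt X (by
            rw [Fin.lt_def]
            simp
            omega), ← e1]
          rfl
        rw [e3, ModuleCat.hom_comp, LinearMap.comp_apply, hm, map_zero, smul_zero]

/-- The standard normalization of a cosimplicial module: the subcomplex `⋂_i Ker s^i` with the
differential `∑ i, (-1) ^ i ∂^i`. -/
def stdNormalization (X : CosimplicialObject (ModuleCat.{u} K)) :
    CochainComplex (ModuleCat.{u} K) ℕ :=
  CochainComplex.of (fun q => ModuleCat.of K (normSub X q))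
    (fun q => ModuleCat.ofHom
      ((AlgebraicTopology.AlternatingCofaceMapComplex.objD X q).hom.restrict
        (objD_mem_normSub X q)))
    (by
      intro q
      refine ModuleCat.hom_ext (LinearMap.ext fun m => Subtype.ext ?_)
      have := AlgebraicTopology.AlternatingCofaceMapComplex.d_squared X q
      exact congrArg (fun f => f.hom m.1) this)

end Normalization

section ThomSullivan

open Simplicial DirInvModule

variable {K : Type u} [Field K]

/-- The completed tensor product `Ω^q(Δ^k) ⊗̂ M^l`, where `Ω^q(Δ^k)` is discrete. -/
abbrev FormTensor (M : CosimplicialObject (DirInvModule K)) (q k l : ℕ) : Type u :=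
  (tensor (discrete (C := K) (Form K q k)) (M.obj ⦋l⦌)).Completion

/-- The map `1 ⊗̂ α^* : Ω^q(Δ^k) ⊗̂ M^k → Ω^q(Δ^k) ⊗̂ M^l`. -/
def coface (M : CosimplicialObject (DirInvModule K)) (q : ℕ) {k l : ℕ} (α : ⦋k⦌ ⟶ ⦋l⦌) :
    FormTensor M q k k →ₗ[K] FormTensor M q k l :=
  completionMap (tensorMap (𝟙 (discrete (C := K) (Form K q k))) (M.map α))

/-- The map `α_* ⊗̂ 1 : Ω^q(Δ^l) ⊗̂ M^l → Ω^q(Δ^k) ⊗̂ M^l`. -/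
def restrictForm (M : CosimplicialObject (DirInvModule K)) (q : ℕ) {k l : ℕ} (α : ⦋k⦌ ⟶ ⦋l⦌) :
    FormTensor M q l l →ₗ[K] FormTensor M q k l :=
  completionMap (tensorMap (discreteMap (formPullback q α.toOrderHom)) (𝟙 (M.obj ⦋l⦌)))

/-- The map `d ⊗̂ 1 : Ω^q(Δ^k) ⊗̂ M^l → Ω^{q+1}(Δ^k) ⊗̂ M^l`. -/
def completedD (M : CosimplicialObject (DirInvModule K)) (q k l : ℕ) :
    FormTensor M q k l →ₗ[K] FormTensor M (q + 1) k l :=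
  completionMap (tensorMap (discreteMap (formD q k)) (𝟙 (M.obj ⦋l⦌)))

/-- The degree `q` component of the complete Thom-Sullivan normalization: the sequences
`(u_0, u_1, ...)` with `u_l ∈ Ω^q(Δ^l) ⊗̂ M^l` such that `(1 ⊗ α^*)(u_k) = (α_* ⊗ 1)(u_l)` for
all `α : [k] → [l]`. -/
def thomSullivanSub (M : CosimplicialObject (DirInvModule K)) (q : ℕ) :
    Submodule K (∀ l, FormTensor M q l l) where
  carrier := {u | ∀ (k l : ℕ) (α : ⦋k⦌ ⟶ ⦋l⦌), coface M q α (u k) = restrictForm M q α (u l)}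
  add_mem' := by
    intro u v hu hv k l α
    rw [Pi.add_apply, Pi.add_apply, map_add, map_add, hu k l α, hv k l α]
  zero_mem' := by
    intro k l α
    rw [Pi.zero_apply, Pi.zero_apply, map_zero, map_zero]
  smul_mem' := by
    intro c u hu k l α
    rw [Pi.smul_apply, Pi.smul_apply, map_smul, map_smul, hu k l α]

theorem coface_completedD (M : CosimplicialObject (DirInvModule K)) (q : ℕ) {k l : ℕ}
    (α : ⦋k⦌ ⟶ ⦋l⦌) (x : FormTensor M q k k) :
    coface M (q + 1) α (completedD M q k k x) = completedD M q k l (coface M q α x) := by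
  simp only [coface, completedD]
  rw [← LinearMap.comp_apply, ← LinearMap.comp_apply, ← completionMap_comp,
    ← completionMap_comp, ← tensorMap_comp, ← tensorMap_comp, Category.comp_id,
    Category.id_comp, Category.comp_id, Category.id_comp]

theorem restrictForm_completedD (M : CosimplicialObject (DirInvModule K)) (q : ℕ) {k l : ℕ}
    (α : ⦋k⦌ ⟶ ⦋l⦌) (x : FormTensor M q l l) :
    restrictForm M (q + 1) α (completedD M q l l x) =
      completedD M q k l (restrictForm M q α x) := by
  simp only [restrictForm, completedD]
  rw [← LinearMap.comp_apply, ← LinearMap.comp_apply, ← completionMap_comp,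
    ← completionMap_comp, ← tensorMap_comp, ← tensorMap_comp]
  have h : discreteMap (formD (K := K) q l) ≫ discreteMap (formPullback (q + 1) α.toOrderHom) =
      discreteMap (formPullback q α.toOrderHom) ≫ discreteMap (formD q k) :=
    hom_ext (formD_formPullback (K := K) q α.toOrderHom).symm
  rw [h]

theorem completedD_completedD (M : CosimplicialObject (DirInvModule K)) (q k l : ℕ)
    (x : FormTensor M q k l) : completedD M (q + 1) k l (completedD M q k l x) = 0 := by
  simp only [completedD]
  rw [← LinearMap.comp_apply, ← completionMap_comp, ← tensorMap_comp, completionMap_zero]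
  · rfl
  · have h : Hom.lin (discreteMap (formD (K := K) q k) ≫ discreteMap (formD (q + 1) k)) = 0 :=
      formD_formD q k
    change TensorProduct.map _ _ = 0
    rw [h, TensorProduct.map_zero_left]

/-- The coboundary operator of the complete Thom-Sullivan normalization. -/
def thomSullivanD (M : CosimplicialObject (DirInvModule K)) (q : ℕ) :
    thomSullivanSub M q →ₗ[K] thomSullivanSub M (q + 1) :=
  LinearMap.restrict (LinearMap.pi fun l => completedD M q l l ∘ₗ LinearMap.proj l) (by
    intro u hu k l α
    simp only [LinearMap.pi_apply, LinearMap.comp_apply, LinearMap.proj_apply]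
    rw [coface_completedD, restrictForm_completedD, hu k l α])

/-- The complete Thom-Sullivan normalization of a cosimplicial dir-inv module. -/
def thomSullivan (M : CosimplicialObject (DirInvModule K)) :
    CochainComplex (ModuleCat.{u} K) ℕ :=
  CochainComplex.of (fun q => ModuleCat.of K (thomSullivanSub M q))
    (fun q => ModuleCat.ofHom (thomSullivanD M q))
    (by
      intro q
      refine ModuleCat.hom_ext (LinearMap.ext fun u => Subtype.ext (funext fun l => ?_))
      exact completedD_completedD M q l l (u.1 l))

/-- The underlying cosimplicial module of a cosimplicial dir-inv module. -/
def underlying (M : CosimplicialObject (DirInvModule K)) :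
    CosimplicialObject (ModuleCat.{u} K) :=
  M ⋙ forgetToModule K

/-- The integral `Ω^l(Δ^l) ⊗̂ M → K ⊗̂ M ≅ M`, for a complete dir-inv module `M`. -/
def completedIntegral [CharZero K] (l : ℕ) (M : DirInvModule K) (hM : M.IsComplete) :
    (tensor (discrete (C := K) (Form K l l)) M).Completion →ₗ[K] M :=
  (M.completionEquiv hM).toLinearMap ∘ₗ completionMap (lidHom M) ∘ₗ
    completionMap (tensorMap (discreteMap (formIntegral l)) (𝟙 M))

/-- The `l`-th entry `u_l` of an element `u = (u_0, u_1, ...)` of degree `q` of the complete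
Thom-Sullivan normalization. -/
def thomSullivanEntry (M : CosimplicialObject (DirInvModule K)) (q l : ℕ) :
    (thomSullivan M).X q →ₗ[K] FormTensor M q l l :=
  LinearMap.proj (φ := fun l => FormTensor M q l l) l ∘ₗ (thomSullivanSub M q).subtype

/-- The inclusion of the degree `q` component of the standard normalization into `M^q`. -/
def stdInclusion (M : CosimplicialObject (DirInvModule K)) (q : ℕ) :
    (stdNormalization (underlying M)).X q →ₗ[K] M.obj ⦋q⦌ :=
  (normSub (underlying M) q).subtype

end ThomSullivan

end

end DirInv

/-! The proof uses Dupont's explicit homotopy on the forms of a simplex. Let d be the exterior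
derivative, t_i and ε_i = dt_i ∧ the two multiplications, p_i the evaluation at the vertex i, and
h_i the Poincaré homotopy of the contraction to that vertex, so that d h_i + h_i d = 1 - p_i. For I
= (i_0 < ... < i_k) let W_I be the Whitney expression ∑ j, (-1)^j t_{i_j} ∏_{m ≠ j} dt_{i_m}, and
put s = ∑ k, (-1)^k k! ∑_I W_I h_{i_k} ⋯ h_{i_0}. Since ∑ t_i = 1 and ∑ dt_i = 0, the commutator ds
+ sd telescopes to 1 - P, where P collects the terms containing some p_i; this is pure algebra
(`d_mul_contraction`).

A chain of cones followed by an evaluation is, up to sign, integration over the corresponding face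
(`coneEval_ofFn`, by Stokes' formula `formIntegral_formD`). Hence P ω = ∑_I q! (∫_I ω) W_I for a
q-form ω, the projection onto the span of the Whitney forms (`contraction_relation`).

The operator s commutes with pullback along monotone maps of simplices (`whitneySum_totalPullback`):
pullback expands W_I over the tuples lying above I, it intertwines the cones, and h_i h_i = 0 kills
the tuples that become degenerate. Therefore s acts on compatible sequences, also after completed
tensoring with M, because g ↦ g ⊗̂ 1 is additive and functorial (`completedTensor`).

Integration takes values in N M because q-forms vanish on a simplex of dimension q - 1, and it is a
morphism of complexes by Stokes. Its section sends m to the sequence with entries ∑_I q! W_I ⊗ M(I)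
m; the compatibility of this sequence needs m to be normalized, so that degenerate maps of vertices
kill it. Integral after section is 1, section after integral is P ⊗̂ 1, and s ⊗̂ 1 is the homotopy
between the latter and the identity. -/

namespace DirInv

/-! ### The algebra of Dupont's homotopy in an arbitrary ring -/

section DupontAlgebra

variable {R : Type*} [Ring R] {ι : Type*}

/-- The sum of the values of `F` on the sublists of length `k` of `L`. -/
def subSum {A : Type*} [AddCommMonoid A] (F : List ι → A) (k : ℕ) (L : List ι) : A :=
  ((L.sublistsLen k).map F).sum

theorem subSum_zero {A : Type*} [AddCommMonoid A] (F : List ι → A) (L : List ι) :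
    subSum F 0 L = F [] := by
  simp [subSum]

theorem subSum_succ_nil {A : Type*} [AddCommMonoid A] (F : List ι → A) (k : ℕ) :
    subSum F (k + 1) [] = 0 := by
  simp [subSum]

theorem subSum_succ_cons {A : Type*} [AddCommMonoid A] (F : List ι → A) (k : ℕ) (i : ι)
    (L : List ι) :
    subSum F (k + 1) (i :: L) = subSum F (k + 1) L + subSum (fun I => F (i :: I)) k L := by
  simp [subSum, Function.comp_def]

theorem subSum_mul_mul (F : List ι → R) (a b : R) (k : ℕ) (L : List ι) :
    subSum (fun I => a * F I * b) k L = a * subSum F k L * b := by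
  simp [subSum, List.sum_map_mul_left, List.sum_map_mul_right]

theorem subSum_add {A : Type*} [AddCommMonoid A] (F G : List ι → A) (k : ℕ) (L : List ι) :
    subSum (fun I => F I + G I) k L = subSum F k L + subSum G k L := by
  simp [subSum, List.sum_map_add]

theorem subSum_sub {A : Type*} [AddCommGroup A] (F G : List ι → A) (k : ℕ) (L : List ι) :
    subSum (fun I => F I - G I) k L = subSum F k L - subSum G k L := by
  simp only [subSum]
  induction L.sublistsLen k with
  | nil => simp
  | cons I T ih =>
    simp only [List.map_cons, List.sum_cons, ih]
    abel

/-- The operator `∑ j, (-1) ^ j t_{i_j} ε_{i_0} ⋯ ε_{i_{j-1}} ε_{i_{j+1}} ⋯ ε_{i_k}`. -/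
def whitneyOp (t ε : ι → R) : List ι → R
  | [] => 0
  | i :: J => t i * (J.map ε).prod - ε i * whitneyOp t ε J

/-- The product `h_{i_k} ⋯ h_{i_0}`. -/
def coneProd (h : ι → R) : List ι → R
  | [] => 1
  | i :: J => coneProd h J * h i

/-- The alternating sum of the products obtained from `h_{i_k} ⋯ h_{i_0}` by replacing one of the
factors `h_i` by `p_i`. -/
def coneEval (h p : ι → R) : List ι → R
  | [] => 0
  | i :: J => coneProd h J * p i - coneEval h p J * h i

/-- Elements of a ring that satisfy the relations between the operators `d`, `t_i`, `dt_i ∧`, the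
cone homotopies `h_i` and the evaluations `p_i` at the vertices of a simplex. -/
structure DupontRelations (d : R) (t ε h p : ι → R) : Prop where
  d_t : ∀ i, d * t i = t i * d + ε i
  d_ε : ∀ i, d * ε i = -(ε i * d)
  ε_ε : ∀ i j, ε i * ε j = -(ε j * ε i)
  ε_self : ∀ i, ε i * ε i = 0
  t_ε : ∀ i j, t i * ε j = ε j * t i
  d_h : ∀ i, d * h i = 1 - p i - h i * d

namespace DupontRelations

variable {d : R} {t ε h p : ι → R}

theorem sum_ε_mul (H : DupontRelations d t ε h p) (L : List ι) (i : ι) :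
    (L.map ε).sum * ε i = -(ε i * (L.map ε).sum) := by
  induction L with
  | nil => simp
  | cons j L ih => simp [add_mul, mul_add, ih, H.ε_ε j i, add_comm]

theorem sum_ε_mul_t (H : DupontRelations d t ε h p) (L : List ι) (i : ι) :
    (L.map ε).sum * t i = t i * (L.map ε).sum := by
  induction L with
  | nil => simp
  | cons j L ih => simp [add_mul, mul_add, ih, H.t_ε]

theorem sum_t_mul_ε (H : DupontRelations d t ε h p) (L : List ι) (i : ι) :
    (L.map t).sum * ε i = ε i * (L.map t).sum := by
  induction L with
  | nil => simp
  | cons j L ih => simp [add_mul, mul_add, ih, H.t_ε]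

variable (ε h) in
/-- The sum of the operators `ε_{i_1} ⋯ ε_{i_k} h_{i_k} ⋯ h_{i_1}`. -/
def prodSum (k : ℕ) (L : List ι) : R := subSum (fun I => (I.map ε).prod * coneProd h I) k L

variable (t ε h) in
/-- The sum of the operators `W_I h_{i_k} ⋯ h_{i_1}`. -/
def whitneySum (k : ℕ) (L : List ι) : R := subSum (fun I => whitneyOp t ε I * coneProd h I) k L

variable (ε h p) in
/-- The boundary contribution of the evaluations to `prodSum`. -/
def prodEvalSum (k : ℕ) (L : List ι) : R :=
  subSum (fun I => (I.map ε).prod * coneEval h p I) k L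

variable (t ε h p) in
/-- The boundary contribution of the evaluations to `whitneySum`. -/
def whitneyEvalSum (k : ℕ) (L : List ι) : R :=
  subSum (fun I => whitneyOp t ε I * coneEval h p I) k L

theorem prodSum_cons (k : ℕ) (i : ι) (L : List ι) :
    prodSum ε h (k + 1) (i :: L) = prodSum ε h (k + 1) L + ε i * prodSum ε h k L * h i := by
  rw [prodSum, subSum_succ_cons, prodSum, prodSum, ← subSum_mul_mul]
  simp [coneProd, mul_assoc]

theorem whitneySum_cons (k : ℕ) (i : ι) (L : List ι) :
    whitneySum t ε h (k + 1) (i :: L) = whitneySum t ε h (k + 1) L +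
      (t i * prodSum ε h k L * h i - ε i * whitneySum t ε h k L * h i) := by
  rw [whitneySum, subSum_succ_cons, whitneySum, whitneySum, prodSum, ← subSum_mul_mul,
    ← subSum_mul_mul, ← subSum_sub]
  simp [coneProd, whitneyOp, mul_assoc, sub_mul]

theorem prodEvalSum_cons (k : ℕ) (i : ι) (L : List ι) :
    prodEvalSum ε h p (k + 1) (i :: L) = prodEvalSum ε h p (k + 1) L +
      (ε i * prodSum ε h k L * p i - ε i * prodEvalSum ε h p k L * h i) := by
  rw [prodEvalSum, subSum_succ_cons, prodEvalSum, prodEvalSum, prodSum, ← subSum_mul_mul,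
    ← subSum_mul_mul, ← subSum_sub]
  simp [coneEval, mul_assoc, mul_sub]

theorem whitneyEvalSum_cons (k : ℕ) (i : ι) (L : List ι) :
    whitneyEvalSum t ε h p (k + 1) (i :: L) = whitneyEvalSum t ε h p (k + 1) L +
      (t i * prodSum ε h k L * p i - t i * prodEvalSum ε h p k L * h i
        - ε i * whitneySum t ε h k L * p i + ε i * whitneyEvalSum t ε h p k L * h i) := by
  rw [whitneyEvalSum, subSum_succ_cons, whitneyEvalSum, whitneyEvalSum, prodEvalSum, prodSum,
    whitneySum, ← subSum_mul_mul, ← subSum_mul_mul, ← subSum_mul_mul, ← subSum_mul_mul,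
    ← subSum_sub, ← subSum_sub, ← subSum_add]
  congr 2
  funext I
  simp only [whitneyOp, coneEval]
  noncomm_ring

theorem prodSum_zero (L : List ι) : prodSum ε h 0 L = 1 := by
  simp [prodSum, subSum_zero, coneProd]

theorem whitneySum_zero (L : List ι) : whitneySum t ε h 0 L = 0 := by
  simp [whitneySum, subSum_zero, whitneyOp]

theorem prodEvalSum_zero (L : List ι) : prodEvalSum ε h p 0 L = 0 := by
  simp [prodEvalSum, subSum_zero, coneEval]

theorem whitneyEvalSum_zero (L : List ι) : whitneyEvalSum t ε h p 0 L = 0 := by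
  simp [whitneyEvalSum, subSum_zero, whitneyOp]

/-- Moving d through the word, each h_i contributes 1 - p_i. The summands 1 delete one cone but keep
its ε_i; summed over all I they assemble to (∑ ε_i) ε_J h_J, because ε_i ε_J vanishes when i already
occurs in J. The p_i give the evaluation term. -/
theorem d_mul_prodSum (H : DupontRelations d t ε h p) (k : ℕ) (L : List ι) :
    d * prodSum ε h (k + 1) L = prodSum ε h (k + 1) L * d - (L.map ε).sum * prodSum ε h k L
      + prodEvalSum ε h p (k + 1) L := by
  induction L generalizing k with
  | nil => simp [prodSum, prodEvalSum, subSum_succ_nil]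
  | cons i L ih =>
    rw [prodSum_cons, prodEvalSum_cons, List.map_cons, List.sum_cons]
    cases k with
    | zero =>
      have h0 := ih 0
      simp only [prodSum_zero, prodEvalSum_zero] at h0 ⊢
      linear_combination (norm := noncomm_ring) h0 + H.d_ε i * h i - ε i * H.d_h i
    | succ k =>
      rw [prodSum_cons]
      linear_combination (norm := noncomm_ring) ih (k + 1) +
        H.d_ε i * (prodSum ε h (k + 1) L * h i) - ε i * ih k * h i -
        ε i * prodSum ε h (k + 1) L * H.d_h i + H.sum_ε_mul L i * (prodSum ε h k L * h i)
        + H.ε_self i * (prodSum ε h k L * h i)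

/-- The graded commutator of d with W_I is (k + 1) ε_I for |I| = k + 1, which explains the
coefficient. The summands 1 of d h_i + h_i d delete a cone, and the resulting W's add up through ∑_i
W_{iJ} = (∑ t_i) ε_J - (∑ ε_i) W_J. -/
theorem d_mul_whitneySum (H : DupontRelations d t ε h p) (k : ℕ) (L : List ι) :
    d * whitneySum t ε h (k + 1) L + whitneySum t ε h (k + 1) L * d =
      (k + 1) * prodSum ε h (k + 1) L + (L.map t).sum * prodSum ε h k L
        - (L.map ε).sum * whitneySum t ε h k L - whitneyEvalSum t ε h p (k + 1) L := by
  induction L generalizing k with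
  | nil => simp [prodSum, whitneySum, whitneyEvalSum, subSum_succ_nil]
  | cons i L ih =>
    rw [whitneySum_cons, whitneyEvalSum_cons, prodSum_cons, List.map_cons, List.sum_cons,
      List.map_cons, List.sum_cons]
    cases k with
    | zero =>
      have h0 := ih 0
      simp only [prodSum_zero, prodEvalSum_zero, whitneySum_zero, whitneyEvalSum_zero,
        Nat.cast_zero] at h0 ⊢
      linear_combination (norm := noncomm_ring) h0 + H.d_t i * h i + t i * H.d_h i
    | succ k =>
      rw [prodSum_cons, whitneySum_cons]
      -- The integer k + 1 is central in the noncommutative ring, which lets it pass `ε i`.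
      have hk : ∀ x : R, ((k : R) + 1) * x = x * ((k : R) + 1) := fun x =>
        ((Nat.cast_commute k x).add_left (Commute.one_left x)).eq
      have e := ih (k + 1)
      push_cast at e ⊢
      linear_combination (norm := noncomm_ring) e
        + H.d_t i * (prodSum ε h (k + 1) L * h i)
        + t i * H.d_mul_prodSum k L * h i
        + t i * prodSum ε h (k + 1) L * H.d_h i
        - H.d_ε i * (whitneySum t ε h (k + 1) L * h i)
        + ε i * ih k * h i
        - ε i * whitneySum t ε h (k + 1) L * H.d_h i
        + H.sum_ε_mul_t L i * (prodSum ε h k L * h i)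
        - H.sum_ε_mul L i * (whitneySum t ε h k L * h i)
        - H.sum_t_mul_ε L i * (prodSum ε h k L * h i)
        - H.t_ε i i * (prodSum ε h k L * h i)
        - H.ε_self i * (whitneySum t ε h k L * h i)
        - hk (ε i) * (prodSum ε h (k + 1) L * h i)

variable (t ε h) in
/-- The weighted sum `∑ k < N, (-1) ^ k k! ∑_I W_I h_{i_k} ⋯ h_{i_0}`. -/
def contraction (N : ℕ) (L : List ι) : R :=
  ∑ k ∈ Finset.range N, ((-1) ^ k * (k.factorial : ℤ)) • whitneySum t ε h (k + 1) L

theorem subSum_eq_zero_of_length_lt {A : Type*} [AddCommMonoid A] (F : List ι → A) {k : ℕ}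
    {L : List ι} (hk : L.length < k) : subSum F k L = 0 := by
  simp [subSum, List.sublistsLen_of_length_lt hk]

/-- There are no sublists longer than the list, so the cutoff is immaterial. This allows a common
cutoff for simplices of different dimensions. -/
theorem contraction_eq {N : ℕ} {L : List ι} (hN : L.length ≤ N) :
    contraction t ε h N L = contraction t ε h L.length L := by
  symm
  refine Finset.sum_subset (Finset.range_mono hN) fun k _ hk => ?_
  rw [Finset.mem_range, not_lt] at hk
  rw [whitneySum, subSum_eq_zero_of_length_lt _ (Nat.lt_succ_of_le hk), smul_zero]

/-- With ∑ t_i = 1 and ∑ ε_i = 0 the commutator of d with the k-th sum is A_k + (k + 1) A_{k+1}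
minus evaluations, where A is `prodSum`. The weights (-1)^k k! are exactly those that make this
telescope to A_0 = 1. -/
theorem d_mul_contraction (H : DupontRelations d t ε h p) {N : ℕ} {L : List ι}
    (hN : L.length < N) (ht : (L.map t).sum = 1) (hε : (L.map ε).sum = 0) :
    d * contraction t ε h N L + contraction t ε h N L * d =
      1 - ∑ k ∈ Finset.range N,
        ((-1) ^ k * (k.factorial : ℤ)) • whitneyEvalSum t ε h p (k + 1) L := by
  have hterm : ∀ k : ℕ, ((-1) ^ k * (k.factorial : ℤ)) •
      (d * whitneySum t ε h (k + 1) L + whitneySum t ε h (k + 1) L * d) =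
      (((-1) ^ k * (k.factorial : ℤ)) • prodSum ε h k L -
        ((-1) ^ (k + 1) * ((k + 1).factorial : ℤ)) • prodSum ε h (k + 1) L) -
      ((-1) ^ k * (k.factorial : ℤ)) • whitneyEvalSum t ε h p (k + 1) L := by
    intro k
    have e : ((k : R) + 1) * prodSum ε h (k + 1) L = ((k : ℤ) + 1) • prodSum ε h (k + 1) L := by
      simp [zsmul_eq_mul]
    rw [H.d_mul_whitneySum, ht, hε, e, one_mul, zero_mul, sub_zero, Nat.factorial_succ]
    push_cast
    module
  -- The strict bound on N matters here: A_k may still be nonzero when k is the length of L.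
  have hlast : prodSum ε h N L = 0 := subSum_eq_zero_of_length_lt _ hN
  rw [contraction, Finset.mul_sum, Finset.sum_mul, ← Finset.sum_add_distrib]
  simp only [mul_smul_comm, smul_mul_assoc, ← smul_add, hterm]
  rw [Finset.sum_sub_distrib, Finset.sum_range_sub', hlast]
  simp [prodSum_zero]

end DupontRelations

end DupontAlgebra

end DirInv

namespace DirInv

noncomputable section

/-! ### Functions on the simplex: dilations towards a vertex and radial integrals -/

section SimplexRing

variable {K : Type u} [Field K] {l : ℕ}

/-- The barycentric coordinate `t_j`. -/
def coord (j : Fin (l + 1)) : SimplexRing K l :=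
  Ideal.Quotient.mk (simplexIdeal K l) (MvPolynomial.X j)

theorem sum_coord : ∑ j, (coord j : SimplexRing K l) = 1 := by
  have h := simplexRel_eq_zero (K := K) l
  rw [map_sub, map_one, sub_eq_zero, map_sum] at h
  exact h

theorem simplexRing_induction {motive : SimplexRing K l → Prop}
    (const : ∀ c : K, motive (algebraMap K _ c))
    (add : ∀ f g, motive f → motive g → motive (f + g))
    (mul_coord : ∀ f j, motive f → motive (f * coord j)) (f : SimplexRing K l) : motive f := by
  obtain ⟨p, rfl⟩ := Ideal.Quotient.mk_surjective f
  induction p using MvPolynomial.induction_on with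
  | C a => exact const a
  | add p q hp hq => rw [map_add]; exact add _ _ hp hq
  | mul_X p j hp => rw [map_mul]; exact mul_coord _ _ hp

theorem dirDeriv_mul (v : simplexTangent K l) (f g : SimplexRing K l) :
    dirDeriv v (f * g) = f * dirDeriv v g + g * dirDeriv v f := by
  obtain ⟨p, rfl⟩ := Ideal.Quotient.mk_surjective f
  obtain ⟨q, rfl⟩ := Ideal.Quotient.mk_surjective g
  rw [← map_mul, dirDeriv_mk, dirDeriv_mk, dirDeriv_mk, Derivation.leibniz]
  simp

theorem dirDeriv_algebraMap (v : simplexTangent K l) (c : K) :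
    dirDeriv v (algebraMap K (SimplexRing K l) c) = 0 := by
  change dirDeriv v (Ideal.Quotient.mk _ (MvPolynomial.C c)) = 0
  rw [dirDeriv_mk]
  simp [polyDeriv]

theorem dirDeriv_coord (v : simplexTangent K l) (j : Fin (l + 1)) :
    dirDeriv v (coord j) = algebraMap K (SimplexRing K l) (v.1 j) := by
  rw [coord, dirDeriv_mk]
  simp only [polyDeriv, MvPolynomial.mkDerivation_X]
  rfl

/-- The homomorphism out of the coordinate ring given by the images of the coordinates. -/
def simplexEval {B : Type*} [CommRing B] [Algebra K B] (x : Fin (l + 1) → B) (hx : ∑ j, x j = 1) :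
    SimplexRing K l →ₐ[K] B :=
  Ideal.Quotient.liftₐ _ (MvPolynomial.aeval x) (by
    intro p hp
    obtain ⟨q, rfl⟩ := Ideal.mem_span_singleton'.1 hp
    simp [hx])

theorem simplexEval_coord {B : Type*} [CommRing B] [Algebra K B] (x : Fin (l + 1) → B)
    (hx : ∑ j, x j = 1) (j : Fin (l + 1)) : simplexEval (K := K) x hx (coord j) = x j := by
  change MvPolynomial.aeval x (MvPolynomial.X j) = x j
  simp

theorem simplexRing_algHom_ext {B : Type*} [CommRing B] [Algebra K B]
    {φ ψ : SimplexRing K l →ₐ[K] B} (h : ∀ j, φ (coord j) = ψ (coord j)) : φ = ψ := by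
  apply Ideal.Quotient.algHom_ext
  apply MvPolynomial.algHom_ext
  exact h

theorem ringPullback_coord {k : ℕ} (α : Fin (k + 1) → Fin (l + 1)) (j : Fin (l + 1)) :
    ringPullback (K := K) α (coord j) = ∑ i with α i = j, coord i := by
  rw [coord, ringPullback_mk]
  simp [polyPullback, coord]

/-- The value of a function at the vertex `i`. -/
def vertexEval (i : Fin (l + 1)) : SimplexRing K l →ₐ[K] K :=
  simplexEval (Pi.single i 1) (by simp)

open Polynomial in
/-- The homomorphism `f ↦ f (e_i + X (x - e_i))`. -/
def dilation (i : Fin (l + 1)) : SimplexRing K l →ₐ[K] (SimplexRing K l)[X] :=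
  simplexEval (fun j => C (coord j) * X + (Pi.single i (1 - X) : Fin (l + 1) → _) j) (by
    rw [Finset.sum_add_distrib, ← Finset.sum_mul, ← map_sum, sum_coord]
    simp)

open Polynomial in
theorem dilation_coord (i j : Fin (l + 1)) :
    dilation (K := K) i (coord j) = C (coord j) * X + (Pi.single i (1 - X) : Fin (l + 1) → _) j :=
  simplexEval_coord _ _ _

/-- The tangent vector from the vertex `i` to the vertex `j`. -/
def vertexVector (i j : Fin (l + 1)) : simplexTangent K l :=
  ⟨Pi.single j (1 : K) - Pi.single i (1 : K), by
    change ∑ a, ((Pi.single j (1 : K) : Fin (l + 1) → K) a -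
      (Pi.single i (1 : K) : Fin (l + 1) → K) a) = 0
    simp⟩

theorem vertexVector_self (i : Fin (l + 1)) : vertexVector (K := K) i i = 0 :=
  Subtype.ext (sub_self _)

/-- The coefficient of e_i on the left is minus the sum of the other coordinates of v, which is v_i
because the coordinates of a tangent vector sum to zero. -/
theorem sum_smul_vertexVector (v : simplexTangent K l) (i : Fin (l + 1)) :
    ∑ j, v.1 j • vertexVector i j = v := by
  have hv : ∑ j, v.1 j = 0 := v.2
  apply Subtype.ext
  funext a
  simp [vertexVector, Finset.sum_apply, mul_sub, Pi.single_apply, hv]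

theorem tangentMap_vertexVector {k : ℕ} (α : Fin (k + 1) → Fin (l + 1)) (i j : Fin (k + 1)) :
    tangentMap (K := K) α (vertexVector i j) = vertexVector (α i) (α j) := by
  apply Subtype.ext
  funext a
  simp only [tangentMap, vertexVector, LinearMap.coe_mk, AddHom.coe_mk, Pi.sub_apply]
  rw [Finset.sum_sub_distrib]
  simp only [Finset.sum_filter, Pi.single_apply]
  congr 1
  · rw [Finset.sum_eq_single j]
    · simp [eq_comm]
    · intro b _ hb; simp [hb]
    · simp
  · rw [Finset.sum_eq_single i]
    · simp [eq_comm]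
    · intro b _ hb; simp [hb]
    · simp

/-! ### Calculus in an auxiliary polynomial variable -/

section Coefficientwise

open Polynomial

variable {A : Type*} [CommRing A] [Algebra K A]

/-- The linear map on polynomials that applies `D` to the coefficients. -/
def coeffMap (D : A →ₗ[K] A) : A[X] →ₗ[K] A[X] :=
  Polynomial.lsum fun n => (Polynomial.monomial n).restrictScalars K ∘ₗ D

theorem coeffMap_monomial (D : A →ₗ[K] A) (n : ℕ) (a : A) :
    coeffMap D (monomial n a) = monomial n (D a) := by
  simp [coeffMap, Polynomial.lsum, sum_monomial_index]

theorem coeffMap_mul (D : A →ₗ[K] A) (hD : ∀ a b, D (a * b) = a * D b + b * D a) (p q : A[X]) :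
    coeffMap D (p * q) = p * coeffMap D q + q * coeffMap D p := by
  induction p using Polynomial.induction_on' with
  | add p p' hp hp' => simp only [add_mul, map_add, hp, hp', mul_add]; ring
  | monomial n a =>
    induction q using Polynomial.induction_on' with
    | add q q' hq hq' => simp only [mul_add, map_add, hq, hq', add_mul]; ring
    | monomial m b =>
      simp only [monomial_mul_monomial, coeffMap_monomial, hD, map_add]
      rw [add_comm m n]

variable (K) in
/-- Integration of polynomials over the unit interval. -/
def unitIntegral : A[X] →ₗ[A] A :=
  Polynomial.lsum fun n => algebraMap K A ((n + 1 : K)⁻¹) • LinearMap.id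

theorem unitIntegral_monomial (n : ℕ) (a : A) :
    unitIntegral K (monomial n a) = algebraMap K A ((n + 1 : K)⁻¹) * a := by
  simp [unitIntegral, Polynomial.lsum, sum_monomial_index, Algebra.smul_def]

/-- The fundamental theorem of calculus; characteristic zero is needed to divide by n + 1. -/
theorem unitIntegral_derivative [CharZero K] (p : A[X]) :
    unitIntegral K (derivative p) = p.eval 1 - p.eval 0 := by
  induction p using Polynomial.induction_on' with
  | add p q hp hq => simp only [map_add, hp, hq, eval_add]; ring
  | monomial n a =>
    rw [derivative_monomial, unitIntegral_monomial]
    cases n with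
    | zero => simp
    | succ n =>
      have h : (n + 1 : K) ≠ 0 := by exact_mod_cast Nat.succ_ne_zero n
      have h2 : algebraMap K A ((n + 1 : K)⁻¹) * ((n + 1 : ℕ) : A) = 1 := by
        rw [← map_natCast (algebraMap K A), ← map_mul, Nat.cast_succ, inv_mul_cancel₀ h, map_one]
      rw [Nat.add_sub_cancel, mul_left_comm, h2]
      simp

/-- Differentiation under the integral sign: the weights 1 / (n + 1) are scalars of K, and D is
K-linear. -/
theorem unitIntegral_coeffMap (D : A →ₗ[K] A) (p : A[X]) :
    unitIntegral K (coeffMap D p) = D (unitIntegral K p) := by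
  induction p using Polynomial.induction_on' with
  | add p q hp hq => simp only [map_add, hp, hq]
  | monomial n a =>
    rw [coeffMap_monomial, unitIntegral_monomial, unitIntegral_monomial, ← Algebra.smul_def,
      ← Algebra.smul_def, map_smul]

theorem unitIntegral_map {B : Type*} [CommRing B] [Algebra K B] (φ : A →ₐ[K] B) (p : A[X]) :
    unitIntegral K (p.map (φ : A →+* B)) = φ (unitIntegral K p) := by
  induction p using Polynomial.induction_on' with
  | add p q hp hq => simp only [Polynomial.map_add, map_add, hp, hq]
  | monomial n a =>
    rw [Polynomial.map_monomial, unitIntegral_monomial, unitIntegral_monomial, map_mul,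
      AlgHom.commutes]
    rfl

end Coefficientwise

open Polynomial

/-- The chain rule in x for f(e_i + s (x - e_i)): the inner derivative is s. -/
theorem coeffMap_dilation (i : Fin (l + 1)) (v : simplexTangent K l) (f : SimplexRing K l) :
    coeffMap (dirDeriv v) (dilation i f) = X * dilation i (dirDeriv v f) := by
  have hC : ∀ a : SimplexRing K l, coeffMap (dirDeriv v) (C a) = C (dirDeriv v a) :=
    fun a => coeffMap_monomial _ 0 a
  have h1 : dirDeriv v (1 : SimplexRing K l) = 0 := by
    simpa using dirDeriv_algebraMap v 1
  have hX : coeffMap (dirDeriv v) (X : (SimplexRing K l)[X]) = 0 := by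
    rw [← monomial_one_one_eq_X, coeffMap_monomial, h1, map_zero]
  have h1 : coeffMap (dirDeriv v) (1 : (SimplexRing K l)[X]) = 0 := by
    rw [← C_1, hC, h1, map_zero]
  induction f using simplexRing_induction with
  | const c =>
    rw [AlgHom.commutes, dirDeriv_algebraMap, map_zero, mul_zero, Polynomial.algebraMap_apply, hC,
      dirDeriv_algebraMap, map_zero]
  | add f g hf hg => simp only [map_add, hf, hg, mul_add]
  | mul_coord f j hf =>
    have hj : coeffMap (dirDeriv v) (dilation i (coord j)) = X * algebraMap K _ (v.1 j) := by
      rw [dilation_coord, map_add, coeffMap_mul _ (dirDeriv_mul v), hX, hC, dirDeriv_coord,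
        Pi.single_apply]
      split_ifs
      · rw [map_sub, hX, h1]
        simp [Polynomial.algebraMap_apply]
      · simp [Polynomial.algebraMap_apply]
    rw [map_mul, coeffMap_mul _ (dirDeriv_mul v), hj, hf, dirDeriv_mul, dirDeriv_coord, map_add,
      map_mul, map_mul, AlgHom.commutes]
    ring

/-- The chain rule in s, with velocity x - e_i = ∑ t_j (e_j - e_i). -/
theorem derivative_dilation (i : Fin (l + 1)) (f : SimplexRing K l) :
    derivative (dilation i f) =
      ∑ j, C (coord j) * dilation i (dirDeriv (vertexVector i j) f) := by
  induction f using simplexRing_induction with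
  | const c =>
    simp [dirDeriv_algebraMap, Polynomial.algebraMap_apply]
  | add f g hf hg => simp only [map_add, hf, hg, mul_add, Finset.sum_add_distrib]
  | mul_coord f m hf =>
    have hm : derivative (dilation (K := K) i (coord m)) =
        ∑ j, C (coord j) * dilation i (dirDeriv (vertexVector i j) (coord m)) := by
      simp only [dirDeriv_coord, AlgHom.commutes]
      have h2 : ∀ j, C (coord j : SimplexRing K l) * algebraMap K (SimplexRing K l)[X]
          ((vertexVector (K := K) i j).1 m) =
          (if m = j then C (coord j) else 0) - C (coord j) * (if m = i then 1 else 0) := by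
        intro j
        simp only [vertexVector, Pi.sub_apply, Pi.single_apply, map_sub, mul_sub]
        split_ifs <;> simp
      rw [Finset.sum_congr rfl fun j _ => h2 j, Finset.sum_sub_distrib, ← Finset.sum_mul,
        ← map_sum, sum_coord, dilation_coord, Pi.single_apply]
      split_ifs <;> simp [sub_eq_add_neg]
    rw [map_mul, derivative_mul, hf, hm, Finset.sum_mul, Finset.mul_sum, ← Finset.sum_add_distrib]
    refine Finset.sum_congr rfl fun j _ => ?_
    rw [dirDeriv_mul, map_add, map_mul, map_mul]
    ring

theorem eval_one_dilation (i : Fin (l + 1)) (f : SimplexRing K l) :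
    (dilation i f).eval 1 = f := by
  have h : ((aeval (R := SimplexRing K l) (1 : SimplexRing K l)).restrictScalars K).comp
      (dilation i) = AlgHom.id K _ := by
    apply simplexRing_algHom_ext
    intro j
    simp [dilation_coord, Pi.single_apply]
    split_ifs <;> simp
  have := DFunLike.congr_fun h f
  simpa [aeval_def, eval₂_eq_eval_map] using this

theorem eval_zero_dilation (i : Fin (l + 1)) (f : SimplexRing K l) :
    (dilation i f).eval 0 = algebraMap K _ (vertexEval i f) := by
  have h : ((aeval (R := SimplexRing K l) (0 : SimplexRing K l)).restrictScalars K).comp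
      (dilation i) = (Algebra.ofId K _).comp (vertexEval i) := by
    apply simplexRing_algHom_ext
    intro j
    simp [dilation_coord, Pi.single_apply, vertexEval, simplexEval_coord]
    split_ifs <;> simp
  have := DFunLike.congr_fun h f
  simpa [aeval_def, eval₂_eq_eval_map, Algebra.ofId_apply] using this

/-- An affine map carrying the vertex i to α i carries the segment from i to x to the segment
between their images. -/
theorem dilation_ringPullback {k : ℕ} (α : Fin (k + 1) → Fin (l + 1)) (i : Fin (k + 1))
    (f : SimplexRing K l) :
    dilation i (ringPullback α f) =
      (dilation (α i) f).map (ringPullback (K := K) α : SimplexRing K l →+* SimplexRing K k) := by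
  have h : (dilation i).comp (ringPullback (K := K) α) =
      (Polynomial.mapAlgHom (ringPullback (K := K) α)).comp (dilation (α i)) := by
    refine simplexRing_algHom_ext (B := (SimplexRing K k)[X]) fun j => ?_
    simp only [AlgHom.comp_apply, ringPullback_coord, map_sum, dilation_coord, map_add, map_mul,
      Polynomial.coe_mapAlgHom, Polynomial.map_C,
      Polynomial.map_X, RingHom.coe_coe, Finset.sum_add_distrib, ← Finset.sum_mul]
    congr 1
    rw [Finset.sum_filter]
    simp only [Pi.single_apply]
    rw [Finset.sum_eq_single i]
    · by_cases h : α i = j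
      · simp [h]
      · simp [h, Ne.symm h]
    · intro b _ hb
      simp [hb]
    · simp
  exact DFunLike.congr_fun h f

/-- The operator `f ↦ ∫_0^1 s ^ n f (e_i + s (x - e_i)) ds`. -/
def radialIntegral (i : Fin (l + 1)) (n : ℕ) : SimplexRing K l →ₗ[K] SimplexRing K l :=
  (unitIntegral K).restrictScalars K ∘ₗ
    LinearMap.mulLeft K (X ^ n : (SimplexRing K l)[X]) ∘ₗ (dilation i).toLinearMap

theorem radialIntegral_apply (i : Fin (l + 1)) (n : ℕ) (f : SimplexRing K l) :
    radialIntegral i n f = unitIntegral K (X ^ n * dilation i f) := rfl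

theorem dirDeriv_radialIntegral (v : simplexTangent K l) (i : Fin (l + 1)) (n : ℕ)
    (f : SimplexRing K l) :
    dirDeriv v (radialIntegral i n f) = radialIntegral i (n + 1) (dirDeriv v f) := by
  have hX : ∀ n, coeffMap (dirDeriv v) (X ^ n : (SimplexRing K l)[X]) = 0 := by
    intro n
    have h1 : dirDeriv v (1 : SimplexRing K l) = 0 := by
      simpa using dirDeriv_algebraMap v 1
    rw [← monomial_one_right_eq_X_pow, coeffMap_monomial, h1, map_zero]
  rw [radialIntegral_apply, radialIntegral_apply, ← unitIntegral_coeffMap,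
    coeffMap_mul _ (dirDeriv_mul v), hX, coeffMap_dilation, mul_zero, add_zero, pow_succ, mul_assoc]

/-- Integrate the s-derivative of s^{n+1} f(e_i + s (x - e_i)) from 0 to 1; the factor s^{n+1}
removes the boundary term at the vertex. -/
theorem radialIntegral_euler [CharZero K] (i : Fin (l + 1)) (n : ℕ) (f : SimplexRing K l) :
    (n + 1 : SimplexRing K l) * radialIntegral i n f +
      ∑ j, coord j * radialIntegral i (n + 1) (dirDeriv (vertexVector i j) f) = f := by
  have h := unitIntegral_derivative (K := K) (X ^ (n + 1) * dilation i f)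
  rw [derivative_mul, derivative_X_pow, derivative_dilation, map_add, Finset.mul_sum, map_sum,
    eval_mul, eval_mul, eval_one_dilation] at h
  simp only [eval_pow, eval_X, one_pow, one_mul, ne_eq, Nat.add_eq_zero_iff, one_ne_zero,
    and_false, not_false_eq_true, zero_pow, zero_mul, sub_zero, Nat.add_sub_cancel] at h
  refine Eq.trans ?_ h
  congr 1
  · rw [mul_assoc, ← smul_eq_C_mul, map_smul, radialIntegral_apply]
    simp
  · refine Finset.sum_congr rfl fun j _ => ?_
    rw [mul_left_comm, ← smul_eq_C_mul, map_smul, radialIntegral_apply, smul_eq_mul]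

/-- Without the power of s the boundary term at s = 0 survives. It is the origin of the evaluations
p_i. -/
theorem radialIntegral_euler_zero [CharZero K] (i : Fin (l + 1)) (f : SimplexRing K l) :
    ∑ j, coord j * radialIntegral i 0 (dirDeriv (vertexVector i j) f) =
      f - algebraMap K _ (vertexEval i f) := by
  have h := unitIntegral_derivative (K := K) (dilation i f)
  rw [derivative_dilation, map_sum, eval_one_dilation, eval_zero_dilation] at h
  refine Eq.trans ?_ h
  refine Finset.sum_congr rfl fun j _ => ?_
  rw [← smul_eq_C_mul, map_smul, radialIntegral_apply, smul_eq_mul, pow_zero, one_mul]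

theorem radialIntegral_ringPullback {k : ℕ} (α : Fin (k + 1) → Fin (l + 1)) (i : Fin (k + 1))
    (n : ℕ) (f : SimplexRing K l) :
    radialIntegral i n (ringPullback α f) = ringPullback α (radialIntegral (α i) n f) := by
  rw [radialIntegral_apply, radialIntegral_apply, dilation_ringPullback, ← unitIntegral_map]
  simp

/-- For j ≠ i the coordinate t_j vanishes at e_i, so the dilation multiplies it by s. This fails for
j = i. -/
theorem radialIntegral_coord_mul {i j : Fin (l + 1)} (hij : j ≠ i) (n : ℕ) (f : SimplexRing K l) :
    radialIntegral i n (coord j * f) = coord j * radialIntegral i (n + 1) f := by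
  have h : (X : (SimplexRing K l)[X]) ^ n * (C (coord j) * X * dilation i f) =
      (coord j : SimplexRing K l) • (X ^ (n + 1) * dilation i f) := by
    rw [smul_eq_C_mul]
    ring
  rw [radialIntegral_apply, radialIntegral_apply, map_mul (dilation i), dilation_coord,
    Pi.single_eq_of_ne hij, add_zero, h, map_smul, smul_eq_mul]

end SimplexRing

end

end DirInv

namespace DirInv

noncomputable section

/-! ### Operators on forms: multiplication by t_j, dt_j ∧, and the cone homotopies -/

section FormOperators

variable {K : Type u} [Field K] {q k l : ℕ}

theorem form_sum_apply {ι : Type*} (s : Finset ι) (f : ι → Form K q l)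
    (v : Fin q → simplexTangent K l) : (∑ i ∈ s, f i) v = ∑ i ∈ s, f i v := by
  classical
  induction s using Finset.induction_on with
  | empty => simp
  | insert a s ha ih => rw [Finset.sum_insert ha, Finset.sum_insert ha, AlternatingMap.add_apply, ih]

theorem smul_eq_algebraMap_mul (c : K) (f : SimplexRing K l) :
    c • f = algebraMap K (SimplexRing K l) c * f :=
  Algebra.smul_def c f

theorem eq_zero_of_self_eq_neg (K : Type*) [Field K] [CharZero K] {V : Type*} [AddCommGroup V]
    [Module K V] {x : V} (hx : x = -x) : x = 0 := by
  have h : (2 : K) • x = 0 := by rw [two_smul, ← sub_neg_eq_add, ← hx, sub_self]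
  exact (smul_eq_zero.1 h).resolve_left two_ne_zero

/-- The composition of a form with a linear endomorphism of the coordinate ring. -/
def postComp (q : ℕ) (g : SimplexRing K l →ₗ[K] SimplexRing K l) : Form K q l →ₗ[K] Form K q l where
  toFun ω := g.compAlternatingMap ω
  map_add' ω η := by ext; simp
  map_smul' c ω := by ext; simp

@[simp]
theorem postComp_apply (g : SimplexRing K l →ₗ[K] SimplexRing K l) (ω : Form K q l)
    (v : Fin q → simplexTangent K l) : postComp q g ω v = g (ω v) := rfl

/-- The operator `ω ↦ ((v, v_1, ..., v_q) ↦ T v (ω (v_1, ..., v_q)))`. -/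
def altGrad (q : ℕ) (T : simplexTangent K l →ₗ[K] SimplexRing K l →ₗ[K] SimplexRing K l) :
    Form K q l →ₗ[K] simplexTangent K l →ₗ[K] Form K q l :=
  LinearMap.mk₂ K (fun ω v => (T v).compAlternatingMap ω)
    (fun ω η v => by ext; simp) (fun c ω v => by ext; simp)
    (fun ω v w => by ext; simp) (fun c ω v => by ext; simp)

theorem altGrad_apply (T : simplexTangent K l →ₗ[K] SimplexRing K l →ₗ[K] SimplexRing K l)
    (ω : Form K q l) (v : simplexTangent K l) (w : Fin q → simplexTangent K l) :
    altGrad q T ω v w = T v (ω w) := rfl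

/-- The antisymmetrization of `altGrad`. -/
def altOp (q : ℕ) (T : simplexTangent K l →ₗ[K] SimplexRing K l →ₗ[K] SimplexRing K l) :
    Form K q l →ₗ[K] Form K (q + 1) l :=
  AlternatingMap.alternatizeUncurryFinLM ∘ₗ altGrad q T

theorem altOp_apply (T : simplexTangent K l →ₗ[K] SimplexRing K l →ₗ[K] SimplexRing K l)
    (ω : Form K q l) (v : Fin (q + 1) → simplexTangent K l) :
    altOp q T ω v = ∑ i : Fin (q + 1), (-1 : ℤ) ^ (i : ℕ) • T (v i) (ω (i.removeNth v)) := by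
  simp [altOp, AlternatingMap.alternatizeUncurryFin_apply, altGrad]

theorem formD_eq_altOp (q l : ℕ) : formD (K := K) q l = altOp q (dirDerivLin l) := rfl

/-- Brings a composite into the form of a double alternation, which vanishes on expressions
symmetric in the two new arguments. -/
theorem altOp_comp (T T' : simplexTangent K l →ₗ[K] SimplexRing K l →ₗ[K] SimplexRing K l)
    (ω : Form K q l) :
    altOp (q + 1) T (altOp q T' ω) = AlternatingMap.alternatizeUncurryFin
      (AlternatingMap.alternatizeUncurryFinLM ∘ₗ (altGrad q T ∘ₗ altGrad q T' ω).flip) := by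
  have h : altGrad (q + 1) T (altOp q T' ω) =
      AlternatingMap.alternatizeUncurryFinLM ∘ₗ (altGrad q T ∘ₗ altGrad q T' ω).flip := by
    refine LinearMap.ext fun x => AlternatingMap.ext fun v => ?_
    rw [altGrad_apply, altOp_apply, map_sum, LinearMap.comp_apply,
      AlternatingMap.alternatizeUncurryFinLM_apply, AlternatingMap.alternatizeUncurryFin_apply]
    refine Finset.sum_congr rfl fun i _ => ?_
    rw [map_zsmul]
    rfl
  rw [← h]
  rfl

/-- Alternating an expression that is symmetric in v and w gives zero. This one principle yields
both the relation between d and dt_j ∧ and that between dt_i ∧ and dt_j ∧. -/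
theorem altOp_anticomm {T T' : simplexTangent K l →ₗ[K] SimplexRing K l →ₗ[K] SimplexRing K l}
    (h : ∀ v w f, T v (T' w f) + T' v (T w f) = T w (T' v f) + T' w (T v f)) (ω : Form K q l) :
    altOp (q + 1) T (altOp q T' ω) + altOp (q + 1) T' (altOp q T ω) = 0 := by
  rw [altOp_comp, altOp_comp, ← AlternatingMap.alternatizeUncurryFin_add, ← LinearMap.comp_add]
  refine AlternatingMap.alternatizeUncurryFin_alternatizeUncurryFinLM_comp_of_symmetric ?_
  intro x y
  ext v
  exact h x y (ω v)

/-- An abstract Leibniz rule, applied with g multiplication by a coordinate. -/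
theorem altOp_postComp {T T' T'' : simplexTangent K l →ₗ[K] SimplexRing K l →ₗ[K] SimplexRing K l}
    {g : SimplexRing K l →ₗ[K] SimplexRing K l}
    (h : ∀ v f, T v (g f) = g (T' v f) + T'' v f) (ω : Form K q l) :
    altOp q T (postComp q g ω) = postComp (q + 1) g (altOp q T' ω) + altOp q T'' ω := by
  ext v
  simp only [altOp_apply, postComp_apply, AlternatingMap.add_apply, map_sum, map_zsmul, h, smul_add,
    Finset.sum_add_distrib]

/-- The map `v ↦ v_j`, with values in the scalars. -/
def coordDiff (j : Fin (l + 1)) :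
    simplexTangent K l →ₗ[K] SimplexRing K l →ₗ[K] SimplexRing K l :=
  LinearMap.toSpanSingleton K _ LinearMap.id ∘ₗ LinearMap.proj j ∘ₗ (simplexTangent K l).subtype

@[simp]
theorem coordDiff_apply (j : Fin (l + 1)) (v : simplexTangent K l) (f : SimplexRing K l) :
    coordDiff j v f = v.1 j • f := rfl

variable (K q) in
/-- Exterior multiplication by `dt_j`. -/
def wedgeCoord (j : Fin (l + 1)) : Form K q l →ₗ[K] Form K (q + 1) l := altOp q (coordDiff j)

variable (K q) in
/-- Multiplication by `t_j`. -/
def mulCoord (j : Fin (l + 1)) : Form K q l →ₗ[K] Form K q l :=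
  postComp q (LinearMap.mulLeft K (coord j))

theorem formD_mulCoord (j : Fin (l + 1)) (ω : Form K q l) :
    formD (K := K) q l (mulCoord K q j ω) = mulCoord K (q + 1) j (formD (K := K) q l ω) + wedgeCoord K q j ω := by
  rw [formD_eq_altOp]
  rw [mulCoord, mulCoord, wedgeCoord]
  refine altOp_postComp (fun v f => ?_) ω
  change dirDeriv v (coord j * f) = coord j * dirDeriv v f + v.1 j • f
  rw [dirDeriv_mul, dirDeriv_coord, smul_eq_algebraMap_mul, mul_comm f]

theorem wedgeCoord_mulCoord (i j : Fin (l + 1)) (ω : Form K q l) :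
    wedgeCoord K q j (mulCoord K q i ω) = mulCoord K (q + 1) i (wedgeCoord K q j ω) := by
  have h := altOp_postComp (T := coordDiff j) (T' := coordDiff j) (T'' := 0)
    (g := LinearMap.mulLeft K (coord i)) (fun v f => by simp) ω
  have h0 : altOp q (0 : simplexTangent K l →ₗ[K] SimplexRing K l →ₗ[K] SimplexRing K l) ω = 0 := by
    ext v
    simp [altOp_apply]
  rw [h0, add_zero] at h
  exact h

theorem formD_wedgeCoord (j : Fin (l + 1)) (ω : Form K q l) :
    formD (K := K) (q + 1) l (wedgeCoord K q j ω) = -wedgeCoord K (q + 1) j (formD (K := K) q l ω) := by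
  rw [← add_eq_zero_iff_eq_neg, formD_eq_altOp, formD_eq_altOp]
  refine altOp_anticomm (fun v w f => ?_) ω
  change dirDeriv v (w.1 j • f) + v.1 j • dirDeriv w f =
    dirDeriv w (v.1 j • f) + w.1 j • dirDeriv v f
  rw [map_smul, map_smul, add_comm]

theorem wedgeCoord_wedgeCoord (i j : Fin (l + 1)) (ω : Form K q l) :
    wedgeCoord K (q + 1) i (wedgeCoord K q j ω) =
      -wedgeCoord K (q + 1) j (wedgeCoord K q i ω) := by
  rw [← add_eq_zero_iff_eq_neg]
  refine altOp_anticomm (fun v w f => ?_) ω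
  simp only [coordDiff_apply, smul_smul]
  rw [mul_comm (v.1 i), mul_comm (v.1 j), add_comm]

theorem wedgeCoord_self [CharZero K] (i : Fin (l + 1)) (ω : Form K q l) :
    wedgeCoord K (q + 1) i (wedgeCoord K q i ω) = 0 :=
  eq_zero_of_self_eq_neg K (wedgeCoord_wedgeCoord i i ω)

theorem sum_mulCoord (ω : Form K q l) : ∑ j, mulCoord K q j ω = ω := by
  ext v
  simp [mulCoord, form_sum_apply, ← Finset.sum_mul, sum_coord]

theorem sum_wedgeCoord (ω : Form K q l) : ∑ j, wedgeCoord K q j ω = 0 := by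
  ext v
  rw [form_sum_apply]
  simp only [wedgeCoord, altOp_apply, coordDiff_apply]
  rw [Finset.sum_comm]
  refine Finset.sum_eq_zero fun a _ => ?_
  have hv : ∑ j, (v a).1 j = 0 := (v a).2
  rw [← Finset.smul_sum, ← Finset.sum_smul, hv, zero_smul, smul_zero]

variable (K q) in
/-- The homotopy operator of the contraction of the simplex to the vertex `i`. -/
def coneForm (i : Fin (l + 1)) : Form K (q + 1) l →ₗ[K] Form K q l :=
  ∑ j, postComp q (LinearMap.mulLeft K (coord j) ∘ₗ radialIntegral i q) ∘ₗ
    AlternatingMap.curryLeftLinearMap.flip (vertexVector i j)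

theorem coneForm_apply (i : Fin (l + 1)) (ω : Form K (q + 1) l)
    (v : Fin q → simplexTangent K l) :
    coneForm K q i ω v =
      ∑ j, coord j * radialIntegral i q (ω (Matrix.vecCons (vertexVector i j) v)) := by
  simp [coneForm, form_sum_apply]

theorem removeNth_succ_vecCons {α : Type*} {n : ℕ} (a : Fin (n + 1)) (x : α)
    (v : Fin (n + 1) → α) :
    a.succ.removeNth (Matrix.vecCons x v) = Matrix.vecCons x (a.removeNth v) := by
  funext b
  cases b using Fin.cases with
  | zero => simp [Fin.removeNth_apply]
  | succ b => simp [Fin.removeNth_apply]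

/-- Multilinearity and v = ∑ v_j (e_j - e_i). -/
theorem sum_coord_smul_radialIntegral (i : Fin (l + 1)) (ω : Form K (q + 1) l)
    (v : simplexTangent K l) (w : Fin q → simplexTangent K l) (n : ℕ) :
    ∑ j, v.1 j • radialIntegral i n (ω (Matrix.vecCons (vertexVector i j) w)) =
      radialIntegral i n (ω (Matrix.vecCons v w)) := by
  have h : ω (Matrix.vecCons v w) =
      ∑ j, v.1 j • ω (Matrix.vecCons (vertexVector i j) w) := by
    have h1 : ω.curryLeft v w = ∑ j, v.1 j • ω.curryLeft (vertexVector i j) w := by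
      conv_lhs => rw [← sum_smul_vertexVector v i]
      simp [form_sum_apply]
    exact h1
  rw [h, map_sum]
  simp only [map_smul]

/-- Cartan's formula for the radial flow to e_i. In positive degree the flow pulls forms back to
zero at s = 0, so no evaluation appears; in coordinates the claim reduces to `radialIntegral_euler`
with n = q. -/
theorem formD_coneForm [CharZero K] (i : Fin (l + 1)) (ω : Form K (q + 1) l) :
    formD (K := K) q l (coneForm K q i ω) + coneForm K (q + 1) i (formD (K := K) (q + 1) l ω) = ω := by
  ext v
  rw [AlternatingMap.add_apply, formD_apply, coneForm_apply]
  -- Leibniz on t_j times a radial integral: the derivatives of the t_j recombine to v_a inserted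
  -- into ω, and those of the integrals raise the power of s by one.
  have h1 : ∀ a : Fin (q + 1), dirDeriv (v a) (coneForm K q i ω (a.removeNth v)) =
      radialIntegral i q (ω (Matrix.vecCons (v a) (a.removeNth v))) +
        ∑ j, coord j * radialIntegral i (q + 1)
          (dirDeriv (v a) (ω (Matrix.vecCons (vertexVector i j) (a.removeNth v)))) := by
    intro a
    rw [coneForm_apply, map_sum, ← sum_coord_smul_radialIntegral i ω, ← Finset.sum_add_distrib]
    refine Finset.sum_congr rfl fun j _ => ?_
    rw [dirDeriv_mul, dirDeriv_coord, dirDeriv_radialIntegral, smul_eq_algebraMap_mul]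
    ring
  -- Moving v_a to the first slot costs the sign (-1)^a, so all q + 1 terms are equal; this supplies
  -- the coefficient in Euler's identity.
  have h2 : ∑ a : Fin (q + 1), (-1 : ℤ) ^ (a : ℕ) •
      radialIntegral i q (ω (Matrix.vecCons (v a) (a.removeNth v))) =
        (q + 1 : SimplexRing K l) * radialIntegral i q (ω v) := by
    have h := congrArg (fun η => radialIntegral i q (η v))
      (AlternatingMap.alternatizeUncurryFin_curryLeft ω)
    simp only [AlternatingMap.alternatizeUncurryFin_apply, map_sum, map_zsmul] at h
    refine Eq.trans h ?_
    rw [AlternatingMap.smul_apply, map_nsmul, nsmul_eq_mul, Nat.cast_succ]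
  -- The first term of dω is the radial derivative; the remaining ones cancel against the second
  -- half of `h1`.
  have h3 : ∀ j, formD (K := K) (q + 1) l ω (Matrix.vecCons (vertexVector i j) v) =
      dirDeriv (vertexVector i j) (ω v) - ∑ a : Fin (q + 1), (-1 : ℤ) ^ (a : ℕ) •
        dirDeriv (v a) (ω (Matrix.vecCons (vertexVector i j) (a.removeNth v))) := by
    intro j
    rw [formD_apply, Fin.sum_univ_succ]
    simp only [removeNth_succ_vecCons, Fin.val_zero, pow_zero, one_smul, Matrix.cons_val_zero,
      Matrix.cons_val_succ, Fin.val_succ, pow_succ, mul_neg, mul_one, neg_smul,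
      Finset.sum_neg_distrib, sub_eq_add_neg]
    rfl
  simp only [h1, h3, smul_add, Finset.sum_add_distrib, h2, map_sub, map_sum, map_zsmul, mul_sub,
    Finset.sum_sub_distrib]
  conv_rhs => rw [← radialIntegral_euler i q (ω v)]
  have h4 : ∑ a : Fin (q + 1), (-1 : ℤ) ^ (a : ℕ) • ∑ j, coord j * radialIntegral i (q + 1)
      (dirDeriv (v a) (ω (Matrix.vecCons (vertexVector i j) (a.removeNth v)))) =
      ∑ j, coord j * ∑ a : Fin (q + 1), (-1 : ℤ) ^ (a : ℕ) • radialIntegral i (q + 1)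
      (dirDeriv (v a) (ω (Matrix.vecCons (vertexVector i j) (a.removeNth v)))) := by
    simp only [Finset.smul_sum, Finset.mul_sum, mul_smul_comm]
    exact Finset.sum_comm
  rw [h4]
  ring

/-- The constant form of degree `0`. -/
def constForm (l : ℕ) : K →ₗ[K] Form K 0 l where
  toFun c := AlternatingMap.constOfIsEmpty K _ (Fin 0) (algebraMap K (SimplexRing K l) c)
  map_add' c c' := by ext; simp
  map_smul' c c' := by
    ext
    simp only [smul_eq_mul, map_mul, AlternatingMap.constOfIsEmpty_apply, RingHom.id_apply,
      AlternatingMap.smul_apply]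
    rw [← Algebra.smul_def]
    rfl

theorem constForm_apply (c : K) (v : Fin 0 → simplexTangent K l) :
    constForm (K := K) l c v = algebraMap K (SimplexRing K l) c := rfl

/-- The value at the vertex `i` of a form of degree `0`. -/
def evalForm (i : Fin (l + 1)) : Form K 0 l →ₗ[K] K where
  toFun ω := vertexEval i (ω Fin.elim0)
  map_add' ω η := by simp
  map_smul' c ω := by simp

theorem coneForm_formD_zero [CharZero K] (i : Fin (l + 1)) (ω : Form K 0 l) :
    coneForm K 0 i (formD (K := K) 0 l ω) = ω - constForm (K := K) l (evalForm (K := K) i ω) := by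
  ext v
  have hv : v = Fin.elim0 := Subsingleton.elim _ _
  subst hv
  rw [AlternatingMap.sub_apply, constForm_apply, coneForm_apply]
  refine Eq.trans ?_ (radialIntegral_euler_zero i (ω Fin.elim0))
  refine Finset.sum_congr rfl fun j _ => ?_
  rw [formD_apply]
  simp

/-- Two contractions with the same radial field cancel: the double sum is symmetric in t_j t_m and
antisymmetric in the inserted vectors e_m - e_i and e_j - e_i. -/
theorem coneForm_coneForm [CharZero K] (i : Fin (l + 1)) (ω : Form K (q + 2) l) :
    coneForm K q i (coneForm K (q + 1) i ω) = 0 := by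
  ext v
  have h : ∀ j, coord j * radialIntegral i q (coneForm K (q + 1) i ω
      (Matrix.vecCons (vertexVector i j) v)) = ∑ m, coord j * coord m * radialIntegral i (q + 1)
        (radialIntegral i (q + 1) (ω (Matrix.vecCons (vertexVector i m)
          (Matrix.vecCons (vertexVector i j) v)))) := by
    intro j
    rw [coneForm_apply, map_sum, Finset.mul_sum]
    refine Finset.sum_congr rfl fun m _ => ?_
    -- The coordinate t_i does not scale under the dilation, but for m = i the inserted vector e_i -
    -- e_i is zero.
    by_cases hm : m = i
    · subst hm
      have h0 : ω (Matrix.vecCons (vertexVector m m) (Matrix.vecCons (vertexVector m j) v)) = 0 :=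
        ω.map_coord_zero 0 (by simp [vertexVector_self])
      simp [h0]
    · rw [radialIntegral_coord_mul hm, mul_assoc]
  rw [coneForm_apply, Finset.sum_congr rfl fun j _ => h j, AlternatingMap.zero_apply]
  have hswap : ∀ x y : simplexTangent K l, ω (Matrix.vecCons x (Matrix.vecCons y v)) =
      -ω (Matrix.vecCons y (Matrix.vecCons x v)) := by
    intro x y
    rw [← ω.map_swap _ (show (0 : Fin (q + 2)) ≠ 1 by simp)]
    congr 1
    funext a
    cases a using Fin.cases with
    | zero => simp
    | succ a =>
      cases a using Fin.cases with
      | zero => simp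
      | succ a =>
        have e : Equiv.swap (0 : Fin (q + 2)) 1 a.succ.succ = a.succ.succ :=
          Equiv.swap_apply_of_ne_of_ne (by simp) (by simp [Fin.ext_iff])
        simp [e]
  have key : ∀ a b x : SimplexRing K l, a * b * -x = -(b * a * x) := fun a b x => by ring
  apply eq_zero_of_self_eq_neg K
  conv_lhs => rw [Finset.sum_comm]
  rw [← Finset.sum_neg_distrib]
  refine Finset.sum_congr rfl fun j _ => ?_
  rw [← Finset.sum_neg_distrib]
  refine Finset.sum_congr rfl fun m _ => ?_
  rw [hswap, map_neg, map_neg]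
  exact key _ _ _

end FormOperators

end

end DirInv

namespace DirInv

noncomputable section

/-! ### All degrees together: the endomorphism ring containing the operators, and pullbacks -/

section TotalForms

variable {K : Type u} [Field K] {k l : ℕ}

variable (K) in
/-- The sequences of forms of all the degrees. -/
def TotalForm (l : ℕ) : Type u := ∀ q, Form K q l

namespace TotalForm

instance : AddCommGroup (TotalForm K l) := inferInstanceAs (AddCommGroup (∀ q, Form K q l))

instance : Module K (TotalForm K l) := inferInstanceAs (Module K (∀ q, Form K q l))

@[simp]
theorem zero_apply (q : ℕ) : (0 : TotalForm K l) q = 0 := rfl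

@[simp]
theorem add_apply (ω η : TotalForm K l) (q : ℕ) : (ω + η) q = ω q + η q := rfl

@[simp]
theorem neg_apply (ω : TotalForm K l) (q : ℕ) : (-ω) q = -ω q := rfl

@[simp]
theorem sub_apply (ω η : TotalForm K l) (q : ℕ) : (ω - η) q = ω q - η q := rfl

variable (K l) in
/-- The component of degree `q` of a sequence of forms. -/
def proj (q : ℕ) : TotalForm K l →ₗ[K] Form K q l where
  toFun ω := ω q
  map_add' _ _ := rfl
  map_smul' _ _ := rfl

@[simp]
theorem proj_apply (q : ℕ) (ω : TotalForm K l) : proj K l q ω = ω q := rfl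

@[simp]
theorem sum_apply {ι : Type*} (s : Finset ι) (f : ι → TotalForm K l) (q : ℕ) :
    (∑ i ∈ s, f i) q = ∑ i ∈ s, f i q :=
  map_sum (proj K l q) f s

variable (K l) in
/-- The sequence of forms concentrated in degree `q`. -/
def single (q : ℕ) : Form K q l →ₗ[K] TotalForm K l where
  toFun ω := LinearMap.single K (fun q => Form K q l) q ω
  map_add' ω η := (LinearMap.single K (fun q => Form K q l) q).map_add ω η
  map_smul' c ω := (LinearMap.single K (fun q => Form K q l) q).map_smul c ω

@[simp]
theorem single_same (q : ℕ) (ω : Form K q l) : single K l q ω q = ω :=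
  Pi.single_eq_same (M := fun q => Form K q l) q ω

theorem single_of_ne {q p : ℕ} (h : p ≠ q) (ω : Form K q l) : single K l q ω p = 0 :=
  Pi.single_eq_of_ne (M := fun q => Form K q l) h ω

@[simp]
theorem single_zero_succ (q : ℕ) (ω : Form K 0 l) : single K l 0 ω (q + 1) = 0 :=
  single_of_ne (Nat.succ_ne_zero q) ω

end TotalForm

/-- The operator of degree `1` with the given components. -/
def upOp (g : ∀ q, Form K q l →ₗ[K] Form K (q + 1) l) : Module.End K (TotalForm K l) where
  toFun ω
    | 0 => 0
    | q + 1 => g q (ω q)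
  map_add' ω η := by
    funext q
    cases q with
    | zero => exact (add_zero _).symm
    | succ q => exact map_add (g q) _ _
  map_smul' c ω := by
    funext q
    cases q with
    | zero => exact (smul_zero (A := Form K 0 l) c).symm
    | succ q => exact map_smul (g q) _ _

@[simp]
theorem upOp_zero (g : ∀ q, Form K q l →ₗ[K] Form K (q + 1) l) (ω : TotalForm K l) :
    upOp g ω 0 = 0 := rfl

@[simp]
theorem upOp_succ (g : ∀ q, Form K q l →ₗ[K] Form K (q + 1) l) (ω : TotalForm K l) (q : ℕ) :
    upOp g ω (q + 1) = g q (ω q) := rfl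

/-- The exterior derivative on sequences of forms. -/
def totalD : Module.End K (TotalForm K l) := upOp fun q => formD q l

/-- Exterior multiplication by `dt_j` on sequences of forms. -/
def totalWedge (j : Fin (l + 1)) : Module.End K (TotalForm K l) := upOp fun q => wedgeCoord K q j

/-- Multiplication by `t_j` on sequences of forms. -/
def totalMul (j : Fin (l + 1)) : Module.End K (TotalForm K l) :=
  { toFun := fun ω q => mulCoord K q j (ω q)
    map_add' := fun _ _ => funext fun _ => map_add _ _ _
    map_smul' := fun c ω => funext fun q => map_smul (mulCoord K q j) c (ω q) }

/-- The cone homotopy on sequences of forms. -/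
def totalCone (i : Fin (l + 1)) : Module.End K (TotalForm K l) :=
  { toFun := fun ω q => coneForm K q i (ω (q + 1))
    map_add' := fun _ _ => funext fun _ => map_add _ _ _
    map_smul' := fun c ω => funext fun q => map_smul (coneForm K q i) c (ω (q + 1)) }

/-- Evaluation at a vertex on sequences of forms. -/
def totalEval (i : Fin (l + 1)) : Module.End K (TotalForm K l) :=
  TotalForm.single K l 0 ∘ₗ constForm (K := K) l ∘ₗ evalForm (K := K) i ∘ₗ TotalForm.proj K l 0

@[simp]
theorem totalMul_apply (j : Fin (l + 1)) (ω : TotalForm K l) (q : ℕ) :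
    totalMul j ω q = mulCoord K q j (ω q) := rfl

@[simp]
theorem totalCone_apply (i : Fin (l + 1)) (ω : TotalForm K l) (q : ℕ) :
    totalCone i ω q = coneForm K q i (ω (q + 1)) := rfl

@[simp]
theorem totalEval_zero (i : Fin (l + 1)) (ω : TotalForm K l) :
    totalEval i ω 0 = constForm (K := K) l (evalForm (K := K) i (ω 0)) := by
  simp [totalEval]

@[simp]
theorem totalEval_succ (i : Fin (l + 1)) (ω : TotalForm K l) (q : ℕ) :
    totalEval i ω (q + 1) = 0 := by
  simp [totalEval]

/-- The relations hold degree by degree. Operators of degree 1 have zero component in the lowest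
degree, hence the case splits; in the relation for h_i, the evaluation p_i enters in degree 0 only.
-/
theorem dupontRelations [CharZero K] (l : ℕ) :
    DupontRelations (totalD : Module.End K (TotalForm K l)) totalMul totalWedge totalCone
      totalEval where
  d_t i := by
    refine LinearMap.ext fun ω => funext fun q => ?_
    cases q with
    | zero => simp [totalD, totalWedge]
    | succ q => simpa [totalD, totalWedge] using formD_mulCoord i (ω q)
  d_ε i := by
    refine LinearMap.ext fun ω => funext fun q => ?_
    cases q with
    | zero => simp [totalD, totalWedge]
    | succ q =>
      cases q with
      | zero => simp [totalD, totalWedge]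
      | succ q => simpa [totalD, totalWedge] using formD_wedgeCoord i (ω q)
  ε_ε i j := by
    refine LinearMap.ext fun ω => funext fun q => ?_
    cases q with
    | zero => simp [totalWedge]
    | succ q =>
      cases q with
      | zero => simp [totalWedge]
      | succ q => simpa [totalWedge] using wedgeCoord_wedgeCoord i j (ω q)
  ε_self i := by
    refine LinearMap.ext fun ω => funext fun q => ?_
    cases q with
    | zero => simp [totalWedge]
    | succ q =>
      cases q with
      | zero => simp [totalWedge]
      | succ q => simpa [totalWedge] using wedgeCoord_self i (ω q)
  t_ε i j := by
    refine LinearMap.ext fun ω => funext fun q => ?_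
    cases q with
    | zero => simp [totalWedge]
    | succ q => simpa [totalWedge] using (wedgeCoord_mulCoord i j (ω q)).symm
  d_h i := by
    refine LinearMap.ext fun ω => funext fun q => ?_
    cases q with
    | zero => simp [totalD, coneForm_formD_zero]
    | succ q =>
      simpa [totalD] using eq_sub_of_add_eq (formD_coneForm i (ω (q + 1)))

theorem sum_totalMul : ∑ j, (totalMul j : Module.End K (TotalForm K l)) = 1 := by
  refine LinearMap.ext fun ω => funext fun q => ?_
  simp [LinearMap.sum_apply, sum_mulCoord]

theorem sum_totalWedge : ∑ j, (totalWedge j : Module.End K (TotalForm K l)) = 0 := by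
  refine LinearMap.ext fun ω => funext fun q => ?_
  rw [LinearMap.sum_apply, TotalForm.sum_apply]
  cases q with
  | zero => simp [totalWedge]
  | succ q => simp [totalWedge, sum_wedgeCoord]

theorem totalCone_mul_self [CharZero K] (i : Fin (l + 1)) :
    (totalCone i * totalCone i : Module.End K (TotalForm K l)) = 0 := by
  refine LinearMap.ext fun ω => funext fun q => ?_
  simp [coneForm_coneForm]

/-- Evaluations produce forms of degree 0, and cones read only positive degrees. -/
theorem totalCone_mul_totalEval (i j : Fin (l + 1)) :
    (totalCone i * totalEval j : Module.End K (TotalForm K l)) = 0 := by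
  refine LinearMap.ext fun ω => funext fun q => ?_
  simp

/-- The pullback on sequences of forms. -/
def totalPullback (α : Fin (k + 1) → Fin (l + 1)) : TotalForm K l →ₗ[K] TotalForm K k :=
  { toFun := fun ω q => formPullback (K := K) q α (ω q)
    map_add' := fun _ _ => funext fun _ => map_add _ _ _
    map_smul' := fun c ω => funext fun q => map_smul (formPullback (K := K) q α) c (ω q) }

@[simp]
theorem totalPullback_apply (α : Fin (k + 1) → Fin (l + 1)) (ω : TotalForm K l) (q : ℕ) :
    totalPullback α ω q = formPullback (K := K) q α (ω q) := rfl

theorem formPullback_apply {q : ℕ} (α : Fin (k + 1) → Fin (l + 1)) (ω : Form K q l)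
    (v : Fin q → simplexTangent K k) :
    formPullback (K := K) q α ω v = ringPullback α (ω (fun a => tangentMap α (v a))) := rfl

theorem formPullback_mulCoord {q : ℕ} (α : Fin (k + 1) → Fin (l + 1)) (j : Fin (l + 1))
    (ω : Form K q l) :
    formPullback (K := K) q α (mulCoord K q j ω) =
      ∑ i with α i = j, mulCoord K q i (formPullback (K := K) q α ω) := by
  ext v
  rw [form_sum_apply]
  simp only [formPullback_apply, mulCoord, postComp_apply, LinearMap.mulLeft_apply, map_mul,
    ringPullback_coord, Finset.sum_mul]

theorem formPullback_wedgeCoord {q : ℕ} (α : Fin (k + 1) → Fin (l + 1)) (j : Fin (l + 1))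
    (ω : Form K q l) :
    formPullback (K := K) (q + 1) α (wedgeCoord K q j ω) =
      ∑ i with α i = j, wedgeCoord K q i (formPullback (K := K) q α ω) := by
  ext v
  rw [form_sum_apply]
  simp only [formPullback_apply, wedgeCoord, altOp_apply, coordDiff_apply, map_sum, map_zsmul]
  rw [Finset.sum_comm]
  refine Finset.sum_congr rfl fun a _ => ?_
  rw [← Finset.smul_sum, ← Finset.sum_smul, map_smul]
  rfl

/-- Affine maps preserve the radial flow. The cone on the target must be taken at the image vertex α
i. -/
theorem formPullback_coneForm {q : ℕ} (α : Fin (k + 1) → Fin (l + 1)) (i : Fin (k + 1))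
    (ω : Form K (q + 1) l) :
    formPullback (K := K) q α (coneForm K q (α i) ω) = coneForm K q i (formPullback (K := K) (q + 1) α ω) := by
  ext v
  rw [formPullback_apply, coneForm_apply, coneForm_apply, map_sum]
  have h : ∀ m, formPullback (K := K) (q + 1) α ω (Matrix.vecCons (vertexVector i m) v) =
      ringPullback α (ω (Matrix.vecCons (vertexVector (α i) (α m))
        fun a => tangentMap α (v a))) := by
    intro m
    rw [formPullback_apply, ← tangentMap_vertexVector]
    congr 2
    funext a
    cases a using Fin.cases <;> simp
  simp only [h, radialIntegral_ringPullback, map_mul, ringPullback_coord, Finset.sum_mul]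
  -- The pullback of t_j is the sum of the t_m with α m = j, and the inserted vector depends only on
  -- α m.
  rw [← Finset.sum_fiberwise Finset.univ α]
  refine Finset.sum_congr rfl fun j _ => Finset.sum_congr rfl fun m hm => ?_
  rw [(Finset.mem_filter.1 hm).2]

theorem vertexEval_ringPullback (α : Fin (k + 1) → Fin (l + 1)) (i : Fin (k + 1))
    (f : SimplexRing K l) : vertexEval i (ringPullback α f) = vertexEval (α i) f := by
  have h : (vertexEval i).comp (ringPullback (K := K) α) = vertexEval (α i) := by
    apply simplexRing_algHom_ext
    intro j
    rw [AlgHom.comp_apply, ringPullback_coord, map_sum]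
    simp only [vertexEval, simplexEval_coord, Finset.sum_filter, Pi.single_apply]
    rw [Finset.sum_eq_single i]
    · by_cases h : α i = j
      · simp [h]
      · simp [h, Ne.symm h]
    · intro b _ hb
      simp [hb]
    · simp
  exact DFunLike.congr_fun h f

theorem formPullback_constForm (α : Fin (k + 1) → Fin (l + 1)) (c : K) :
    formPullback (K := K) 0 α (constForm (K := K) l c) = constForm (K := K) k c := by
  ext v
  rw [formPullback_apply, constForm_apply, constForm_apply, AlgHom.commutes]

theorem evalForm_formPullback (α : Fin (k + 1) → Fin (l + 1)) (i : Fin (k + 1)) (ω : Form K 0 l) :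
    evalForm (K := K) i (formPullback (K := K) 0 α ω) = evalForm (K := K) (α i) ω := by
  change vertexEval i (formPullback (K := K) 0 α ω Fin.elim0) = vertexEval (α i) (ω Fin.elim0)
  rw [formPullback_apply, vertexEval_ringPullback]
  congr 2
  exact Subsingleton.elim _ _

theorem totalPullback_comp_totalMul (α : Fin (k + 1) → Fin (l + 1)) (j : Fin (l + 1)) :
    (totalPullback α : TotalForm K l →ₗ[K] _) ∘ₗ totalMul j =
      ∑ i with α i = j, totalMul i ∘ₗ totalPullback α := by
  refine LinearMap.ext fun ω => funext fun q => ?_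
  simp [formPullback_mulCoord]

theorem totalPullback_comp_totalWedge (α : Fin (k + 1) → Fin (l + 1)) (j : Fin (l + 1)) :
    (totalPullback α : TotalForm K l →ₗ[K] _) ∘ₗ totalWedge j =
      ∑ i with α i = j, totalWedge i ∘ₗ totalPullback α := by
  refine LinearMap.ext fun ω => funext fun q => ?_
  cases q with
  | zero => simp [totalWedge]
  | succ q => simp [totalWedge, formPullback_wedgeCoord]

theorem totalPullback_comp_totalCone (α : Fin (k + 1) → Fin (l + 1)) (i : Fin (k + 1)) :
    (totalPullback α : TotalForm K l →ₗ[K] _) ∘ₗ totalCone (α i) =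
      totalCone i ∘ₗ totalPullback α := by
  refine LinearMap.ext fun ω => funext fun q => ?_
  simp [formPullback_coneForm]

theorem totalPullback_comp_totalEval (α : Fin (k + 1) → Fin (l + 1)) (i : Fin (k + 1)) :
    (totalPullback α : TotalForm K l →ₗ[K] _) ∘ₗ totalEval (α i) =
      totalEval i ∘ₗ totalPullback α := by
  refine LinearMap.ext fun ω => funext fun q => ?_
  cases q with
  | zero => simp [formPullback_constForm, evalForm_formPullback]
  | succ q => simp

end TotalForms

/-! ### Stokes' formula on the simplex -/

section Stokes

variable {K : Type u} [Field K] {l : ℕ}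

/-- Restriction to the face opposite to j sets t_j = 0; the factor 0 ^ a j is 1 exactly when t_j is
absent. -/
theorem polyPullback_succAbove_monomial (j : Fin (l + 2)) (a : Fin (l + 2) →₀ ℕ) (c : K) :
    polyPullback j.succAbove (MvPolynomial.monomial a c) =
      MvPolynomial.monomial (Finsupp.equivFunOnFinite.symm fun i => a (j.succAbove i))
        (c * 0 ^ a j) := by
  have hX : ∀ i, ∑ m with j.succAbove m = j.succAbove i,
      (MvPolynomial.X m : MvPolynomial (Fin (l + 1)) K) = MvPolynomial.X i := by
    intro i
    simp [Finset.sum_filter]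
  have h0 : ∑ m with j.succAbove m = j, (MvPolynomial.X m : MvPolynomial (Fin (l + 1)) K) = 0 := by
    refine Finset.sum_eq_zero fun m hm => ?_
    exact absurd (Finset.mem_filter.1 hm).2 (Fin.succAbove_ne j m)
  rw [polyPullback, MvPolynomial.aeval_monomial, Finsupp.prod_fintype _ _ (fun i => pow_zero _),
    Fin.prod_univ_succAbove _ j, h0, MvPolynomial.monomial_eq,
    Finsupp.prod_fintype _ _ (fun i => pow_zero _)]
  simp only [hX, Finsupp.equivFunOnFinite_symm_apply_apply, MvPolynomial.algebraMap_eq, map_mul,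
    map_pow, map_zero]
  rw [mul_assoc]

/-- A partial derivative alone does not descend to the simplex. Its integral is isolated here as a
term independent of j minus a face integral, so that the common term cancels in differences. -/
theorem polyIntegral_pderiv [CharZero K] (j : Fin (l + 2)) (a : Fin (l + 2) →₀ ℕ) (c : K) :
    polyIntegral (l + 1) (MvPolynomial.pderiv j (MvPolynomial.monomial a c)) =
      c * ((∏ i, ((a i).factorial : K)) / ((l + ∑ i, a i).factorial : K)) -
        polyIntegral l (polyPullback j.succAbove (MvPolynomial.monomial a c)) := by
  rw [polyPullback_succAbove_monomial, MvPolynomial.pderiv_monomial, polyIntegral_monomial,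
    polyIntegral_monomial, Fin.prod_univ_succAbove _ j, Fin.prod_univ_succAbove _ j,
    Fin.sum_univ_succAbove _ j, Fin.sum_univ_succAbove _ j]
  have h1 : ∀ i, (a - Finsupp.single j 1 : Fin (l + 2) →₀ ℕ) (j.succAbove i) = a (j.succAbove i) := by
    intro i
    simp
  have h2 : (a - Finsupp.single j 1 : Fin (l + 2) →₀ ℕ) j = a j - 1 := by simp
  simp only [h1, h2, Finsupp.equivFunOnFinite_symm_apply_apply]
  rcases Nat.eq_zero_or_pos (a j) with h | h
  · simp [h]
  · obtain ⟨n, hn⟩ := Nat.exists_eq_succ_of_ne_zero h.ne'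
    have e : l + 1 + (n + 1 - 1 + ∑ i, a (j.succAbove i)) =
        l + (n + 1 + ∑ i, a (j.succAbove i)) := by omega
    rw [hn, Nat.succ_eq_add_one, e, Nat.factorial_succ]
    simp
    ring

theorem polyDeriv_vertexVector (i j : Fin (l + 1)) (p : MvPolynomial (Fin (l + 1)) K) :
    polyDeriv (vertexVector (K := K) i j).1 p =
      MvPolynomial.pderiv j p - MvPolynomial.pderiv i p := by
  have h : polyDeriv (vertexVector (K := K) i j).1 =
      MvPolynomial.pderiv j - MvPolynomial.pderiv i := by
    apply MvPolynomial.derivation_ext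
    intro m
    rw [Derivation.sub_apply, MvPolynomial.pderiv_X, MvPolynomial.pderiv_X, polyDeriv,
      MvPolynomial.mkDerivation_X]
    simp only [vertexVector, Pi.sub_apply, map_sub, Pi.single_apply]
    split_ifs <;> simp
  rw [h, Derivation.sub_apply]

/-- The derivative along the edge from i to j is the difference of two partial derivatives, and only
their face terms remain. -/
theorem ringIntegral_dirDeriv [CharZero K] (i j : Fin (l + 2)) (f : SimplexRing K (l + 1)) :
    ringIntegral (l + 1) (dirDeriv (vertexVector i j) f) =
      ringIntegral l (ringPullback i.succAbove f) -
        ringIntegral l (ringPullback j.succAbove f) := by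
  obtain ⟨p, rfl⟩ := Ideal.Quotient.mk_surjective f
  rw [dirDeriv_mk, ringPullback_mk, ringPullback_mk, ringIntegral, ringIntegral, simplexLift_mk,
    simplexLift_mk, simplexLift_mk, polyDeriv_vertexVector, map_sub]
  induction p using MvPolynomial.induction_on' with
  | add p q hp hq =>
    simp only [map_add]
    linear_combination hp + hq
  | monomial a c =>
    rw [polyIntegral_pderiv, polyIntegral_pderiv]
    ring

/-- Subtract w from one argument at a time; each correction has w as an argument and so vanishes. -/
theorem alternating_map_sub {V N : Type*} [AddCommGroup V] [Module K V] [AddCommGroup N]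
    [Module K N] {n : ℕ} (η : V [⋀^Fin n]→ₗ[K] N) (w : V)
    (h : ∀ v : Fin n → V, (∃ i, v i = w) → η v = 0) (v : Fin n → V) :
    η (fun i => v i - w) = η v := by
  classical
  have key : ∀ s : Finset (Fin n), η (fun i => if i ∈ s then v i - w else v i) = η v := by
    intro s
    induction s using Finset.induction_on with
    | empty => simp
    | insert a s ha ih =>
      set g : Fin n → V := fun i => if i ∈ s then v i - w else v i with hg
      have e : (fun i => if i ∈ insert a s then v i - w else v i) =
          Function.update g a (v a - w) := by
        funext i
        by_cases hi : i = a
        · subst hi; simp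
        · simp [hi, hg]
      have e2 : Function.update g a (v a) = g := by
        rw [Function.update_eq_self_iff]
        simp [hg, ha]
      rw [e, AlternatingMap.map_update_sub, e2, ih, h _ ⟨a, Function.update_self _ _ _⟩, sub_zero]
  simpa using key Finset.univ

/-- Used to recognize the edges based at vertex 1, which span the face opposite to 0, in terms of
edges based at 0. -/
theorem alternating_map_sub_zero {V N : Type*} [AddCommGroup V] [Module K V] [AddCommGroup N]
    [Module K N] {n : ℕ} (ω : V [⋀^Fin n]→ₗ[K] N) (w : Fin (n + 1) → V) :
    ω (fun i => w i.succ - w 0) = ∑ a : Fin (n + 1), (-1 : ℤ) ^ (a : ℕ) • ω (a.removeNth w) := by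
  -- Homogenization: the alternation of f is λ ∧ ω on V × K, with λ the last coordinate. On the
  -- vectors (w_a, 1) it gives the alternating sum; after subtracting (w_0, 1) from the later ones,
  -- λ sees only the first vector.
  let f : (V × K) →ₗ[K] (V × K) [⋀^Fin n]→ₗ[K] N :=
    LinearMap.toSpanSingleton K _ (ω.compLinearMap (LinearMap.fst K V K)) ∘ₗ LinearMap.snd K V K
  have hf : ∀ u : Fin (n + 1) → V × K, AlternatingMap.alternatizeUncurryFin f u =
      ∑ a : Fin (n + 1), (-1 : ℤ) ^ (a : ℕ) • (u a).2 • ω (a.removeNth fun b => (u b).1) := by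
    intro u
    rw [AlternatingMap.alternatizeUncurryFin_apply]
    rfl
  have h1 := hf fun a => (w a, 1)
  simp only [one_smul] at h1
  rw [← h1]
  have h2 := alternating_map_sub
    ((AlternatingMap.alternatizeUncurryFin f).curryLeft (w 0, 1)) (w 0, 1) (by
      rintro v ⟨i, hi⟩
      exact (AlternatingMap.alternatizeUncurryFin f).map_eq_zero_of_eq
        (Matrix.vecCons (w 0, 1) v) (i := 0) (j := i.succ) (by simp [hi])
        (Fin.succ_ne_zero i).symm) (fun a => (w a.succ, 1))
  have h3 : Matrix.vecCons ((w 0, 1) : V × K) (fun a => (w a.succ, 1)) = fun a => (w a, 1) := by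
    funext a
    cases a using Fin.cases <;> rfl
  rw [AlternatingMap.curryLeft_apply_apply, AlternatingMap.curryLeft_apply_apply, h3, hf] at h2
  rw [← h2, Fin.sum_univ_succ]
  simp only [Fin.val_zero, pow_zero, one_smul, Matrix.cons_val_zero, Matrix.cons_val_succ,
    Prod.snd_sub, sub_self, zero_smul, smul_zero, Finset.sum_const_zero, add_zero]
  rfl

/-- The directional derivatives in dω run along the edges from vertex 0, so each integrates to face
0 minus another face. The contributions of face 0 combine by `alternating_map_sub_zero`. -/
theorem formIntegral_formD [CharZero K] (q : ℕ) (ω : Form K q (q + 1)) :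
    formIntegral (K := K) (q + 1) (formD (K := K) q (q + 1) ω) = ∑ i : Fin (q + 2), (-1 : ℤ) ^ (i : ℕ) •
      formIntegral (K := K) q (formPullback (K := K) q i.succAbove ω) := by
  have hI : ∀ {l : ℕ} (η : Form K l l), formIntegral (K := K) l η = ringIntegral l (η edgeVector) :=
    fun η => rfl
  have he : ∀ {l : ℕ} (a : Fin l), edgeVector (K := K) a = vertexVector 0 a.succ := fun a => rfl
  rw [hI, formD_apply]
  conv_rhs => rw [Fin.sum_univ_succ]
  simp only [map_sum, map_zsmul, he, ringIntegral_dirDeriv, hI, formPullback_apply,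
    tangentMap_vertexVector]
  have h0 : ω (fun a => vertexVector ((0 : Fin (q + 2)).succAbove 0)
      ((0 : Fin (q + 2)).succAbove a.succ)) =
      ∑ a : Fin (q + 1), (-1 : ℤ) ^ (a : ℕ) • ω (a.removeNth edgeVector) := by
    rw [← alternating_map_sub_zero]
    congr 1
    funext a
    apply Subtype.ext
    simp [vertexVector, edgeVector]
  have h1 : ∀ a : Fin (q + 1), (fun b : Fin q => vertexVector (K := K) (a.succ.succAbove 0)
      (a.succ.succAbove b.succ)) = a.removeNth edgeVector := by
    intro a
    funext b
    simp [he, Fin.removeNth_apply]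
  rw [h0]
  simp only [h1, map_sum, map_zsmul, smul_add, smul_neg, Finset.sum_add_distrib, Fin.val_succ, pow_succ,
    mul_neg, mul_one, neg_smul, Finset.sum_neg_distrib, Fin.val_zero, pow_zero, one_smul,
    sub_eq_add_neg]

end Stokes

end

end DirInv

namespace DirInv

noncomputable section

/-! ### Sublists as strictly increasing tuples -/

section StrictTuples

open Classical in
-- The recursion of the algebraic part uses sublists; functoriality in the simplex is more
-- convenient with tuples. A sublist of a strictly increasing list is strictly increasing, and there
-- are no repetitions to count.
theorem subSum_finRange {A : Type*} [AddCommMonoid A] {n : ℕ} (F : List (Fin n) → A) (m : ℕ) :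
    subSum F m (List.finRange n) = ∑ I : Fin m → Fin n with StrictMono I, F (List.ofFn I) := by
  rw [subSum, ← List.sum_toFinset _ (List.nodup_sublistsLen m (List.nodup_finRange n))]
  symm
  refine Finset.sum_nbij (fun I => List.ofFn I) ?_ ?_ ?_ (fun _ _ => rfl)
  · intro I hI
    have hs : (List.ofFn I).SortedLT := List.sortedLT_ofFn_iff.2 (Finset.mem_filter.1 hI).2
    rw [List.mem_toFinset, List.mem_sublistsLen]
    refine ⟨List.sublist_of_subperm_of_sortedLE (List.subperm_of_subset hs.nodup ?_) hs.sortedLE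
      (List.sortedLT_finRange n).sortedLE, List.length_ofFn⟩
    intro x _
    exact List.mem_finRange x
  · exact fun I _ J _ h => List.ofFn_injective h
  · intro J hJ
    rw [Finset.mem_coe, List.mem_toFinset, List.mem_sublistsLen] at hJ
    obtain ⟨hJ, rfl⟩ := hJ
    refine ⟨J.get, ?_, List.ofFn_get J⟩
    rw [Finset.mem_coe, Finset.mem_filter]
    refine ⟨Finset.mem_univ _, ?_⟩
    rw [← List.sortedLT_ofFn_iff, List.ofFn_get]
    exact ((List.pairwise_lt_finRange n).sublist hJ).sortedLT

theorem isChain_lt_of_le_of_ne {ι : Type*} [PartialOrder ι] {J : List ι}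
    (hle : J.IsChain (· ≤ ·)) (hne : J.IsChain (· ≠ ·)) : J.IsChain (· < ·) := by
  induction J with
  | nil => simp
  | cons i J ih =>
    cases J with
    | nil => simp
    | cons j J =>
      rw [List.isChain_cons_cons] at hle hne ⊢
      exact ⟨lt_of_le_of_ne hle.1 hne.1, ih hle.2 hne.2⟩

end StrictTuples

/-! ### Intertwining words of operators with a pullback -/

section Naturality

variable {K : Type*} [Field K] {V V' : Type*} [AddCommGroup V] [Module K V] [AddCommGroup V']
  [Module K V'] {ι ι' : Type*}

theorem comp_finset_sum {U : Type*} [AddCommGroup U] [Module K U] {T : Type*} (s : Finset T)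
    (f : T → U →ₗ[K] V) (g : V →ₗ[K] V') : g ∘ₗ ∑ i ∈ s, f i = ∑ i ∈ s, g ∘ₗ f i := by
  ext x
  simp

theorem finset_sum_comp {U : Type*} [AddCommGroup U] [Module K U] {T : Type*} (s : Finset T)
    (f : T → V →ₗ[K] V') (g : U →ₗ[K] V) : (∑ i ∈ s, f i) ∘ₗ g = ∑ i ∈ s, f i ∘ₗ g := by
  ext x
  simp

theorem sum_fiber_cons [Fintype ι'] [DecidableEq ι] {A : Type*} [AddCommMonoid A] {n : ℕ} (α : ι' → ι) (I : Fin (n + 1) → ι)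
    (F : (Fin (n + 1) → ι') → A) :
    ∑ J : Fin (n + 1) → ι' with ∀ b, α (J b) = I b, F J =
      ∑ j with α j = I 0, ∑ J : Fin n → ι' with ∀ b, α (J b) = I b.succ, F (Fin.cons j J) := by
  simp only [Finset.sum_filter]
  rw [← Fintype.sum_equiv (Fin.consEquiv fun _ => ι') (fun x => if ∀ b, α (Fin.cons (α := fun _ => ι') x.1 x.2 b) = I b
    then F (Fin.cons x.1 x.2) else 0) _ (fun _ => rfl), Fintype.sum_prod_type]
  refine Finset.sum_congr rfl fun j _ => ?_
  simp only [Fin.forall_fin_succ, Fin.cons_zero, Fin.cons_succ]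
  by_cases h : α j = I 0 <;> simp [h]

variable {α : ι' → ι} {a : V →ₗ[K] V'}

theorem comp_prod [Fintype ι'] [DecidableEq ι] {ε : ι → Module.End K V} {ε' : ι' → Module.End K V'}
    (hε : ∀ i, a ∘ₗ ε i = ∑ j with α j = i, ε' j ∘ₗ a) {n : ℕ} (I : Fin n → ι) :
    a ∘ₗ ((List.ofFn I).map ε).prod =
      ∑ J : Fin n → ι' with ∀ b, α (J b) = I b, ((List.ofFn J).map ε').prod ∘ₗ a := by
  induction n with
  | zero => simp [Module.End.one_eq_id]
  | succ n ih =>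
    rw [sum_fiber_cons]
    simp only [List.ofFn_succ, List.map_cons, List.prod_cons, Fin.cons_zero, Fin.cons_succ]
    rw [Module.End.mul_eq_comp, ← LinearMap.comp_assoc, hε, finset_sum_comp]
    refine Finset.sum_congr rfl fun j _ => ?_
    rw [LinearMap.comp_assoc, ih, comp_finset_sum]
    rfl

/-- Each factor t_i or ε_i pulls back to a sum over the fibre of i; expanding the product gives all
tuples above I, not only increasing ones. -/
theorem comp_whitneyOp [Fintype ι'] [DecidableEq ι] {t ε : ι → Module.End K V} {t' ε' : ι' → Module.End K V'}
    (ht : ∀ i, a ∘ₗ t i = ∑ j with α j = i, t' j ∘ₗ a)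
    (hε : ∀ i, a ∘ₗ ε i = ∑ j with α j = i, ε' j ∘ₗ a) {n : ℕ} (I : Fin n → ι) :
    a ∘ₗ whitneyOp t ε (List.ofFn I) =
      ∑ J : Fin n → ι' with ∀ b, α (J b) = I b, whitneyOp t' ε' (List.ofFn J) ∘ₗ a := by
  induction n with
  | zero => simp [whitneyOp]
  | succ n ih =>
    rw [sum_fiber_cons]
    simp only [List.ofFn_succ, whitneyOp, Fin.cons_zero, Fin.cons_succ]
    rw [LinearMap.comp_sub, Module.End.mul_eq_comp, Module.End.mul_eq_comp, ← LinearMap.comp_assoc,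
      ht, finset_sum_comp, ← LinearMap.comp_assoc, hε, finset_sum_comp,
      ← Finset.sum_sub_distrib]
    refine Finset.sum_congr rfl fun j _ => ?_
    rw [LinearMap.comp_assoc, comp_prod hε, LinearMap.comp_assoc, ih, comp_finset_sum,
      comp_finset_sum, ← Finset.sum_sub_distrib]
    refine Finset.sum_congr rfl fun J _ => ?_
    rw [LinearMap.sub_comp]
    rfl

theorem comp_coneProd {h : ι → Module.End K V} {h' : ι' → Module.End K V'}
    (hh : ∀ j, a ∘ₗ h (α j) = h' j ∘ₗ a) (J : List ι') :
    a ∘ₗ coneProd h (J.map α) = coneProd h' J ∘ₗ a := by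
  induction J with
  | nil => rfl
  | cons j J ih =>
    rw [List.map_cons, coneProd, coneProd, Module.End.mul_eq_comp, ← LinearMap.comp_assoc, ih,
      LinearMap.comp_assoc, hh]
    rfl

theorem comp_coneEval {h p : ι → Module.End K V} {h' p' : ι' → Module.End K V'}
    (hh : ∀ j, a ∘ₗ h (α j) = h' j ∘ₗ a) (hp : ∀ j, a ∘ₗ p (α j) = p' j ∘ₗ a) (J : List ι') :
    a ∘ₗ coneEval h p (J.map α) = coneEval h' p' J ∘ₗ a := by
  induction J with
  | nil => simp [coneEval]
  | cons j J ih =>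
    rw [List.map_cons, coneEval, coneEval, Module.End.mul_eq_comp, Module.End.mul_eq_comp,
      LinearMap.comp_sub, ← LinearMap.comp_assoc, comp_coneProd hh, ← LinearMap.comp_assoc, ih,
      LinearMap.comp_assoc, LinearMap.comp_assoc, hh, hp]
    rfl

end Naturality

/-! ### Repeated cones vanish -/

section ConeVanishing

variable {R : Type*} [Ring R] {ι : Type*}

theorem coneProd_eq_zero_of_not_isChain {h : ι → R} (hh : ∀ i, h i * h i = 0) {J : List ι}
    (hJ : ¬ J.IsChain (· ≠ ·)) : coneProd h J = 0 := by
  induction J with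
  | nil => simp at hJ
  | cons i J ih =>
    cases J with
    | nil => simp at hJ
    | cons j J =>
      rw [List.isChain_cons_cons, not_and_or, not_not] at hJ
      rcases hJ with rfl | hJ
      · rw [coneProd, coneProd, mul_assoc, hh, mul_zero]
      · rw [coneProd, ih hJ, zero_mul]

end ConeVanishing

/-! ### Naturality of the contraction -/

section Contraction

variable {K : Type u} [Field K] {k l : ℕ}

/-- Pullback turns the term of I into the terms of all J with α ∘ J = I, so the left side runs over
the J with α ∘ J strictly increasing. The other increasing J on the right contribute nothing: α ∘ J
then repeats a neighbour, and the product of cones contains h_i h_i = 0. -/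
theorem whitneySum_totalPullback [CharZero K] {α : Fin (k + 1) → Fin (l + 1)} (hα : Monotone α)
    (m : ℕ) :
    (totalPullback α : TotalForm K l →ₗ[K] TotalForm K k) ∘ₗ
        DupontRelations.whitneySum totalMul totalWedge totalCone m (List.finRange (l + 1)) =
      DupontRelations.whitneySum totalMul totalWedge totalCone m (List.finRange (k + 1)) ∘ₗ
        totalPullback α := by
  classical
  rw [DupontRelations.whitneySum, DupontRelations.whitneySum, subSum_finRange, subSum_finRange,
    comp_finset_sum, finset_sum_comp]
  have hterm : ∀ I : Fin m → Fin (l + 1),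
      (totalPullback α : TotalForm K l →ₗ[K] TotalForm K k) ∘ₗ
        (whitneyOp totalMul totalWedge (List.ofFn I) * coneProd totalCone (List.ofFn I)) =
      ∑ J : Fin m → Fin (k + 1) with α ∘ J = I,
        (whitneyOp totalMul totalWedge (List.ofFn J) * coneProd totalCone (List.ofFn J)) ∘ₗ
          totalPullback α := by
    intro I
    rw [Module.End.mul_eq_comp, ← LinearMap.comp_assoc,
      comp_whitneyOp (totalPullback_comp_totalMul α) (totalPullback_comp_totalWedge α),
      finset_sum_comp]
    refine Finset.sum_congr (Finset.filter_congr fun J _ => funext_iff.symm) fun J hJ => ?_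
    rw [← (Finset.mem_filter.1 hJ).2, Module.End.mul_eq_comp, LinearMap.comp_assoc,
      LinearMap.comp_assoc, ← comp_coneProd (totalPullback_comp_totalCone α), List.map_ofFn]
  -- Regroups the double sum over I and the J above it as one sum over the J with α ∘ J strictly
  -- increasing.
  have hfib := Finset.sum_fiberwise_of_maps_to
    (s := Finset.univ.filter fun J : Fin m → Fin (k + 1) => StrictMono (α ∘ J))
    (t := Finset.univ.filter fun I : Fin m → Fin (l + 1) => StrictMono I) (g := fun J => α ∘ J)
    (fun J hJ => Finset.mem_filter.2 ⟨Finset.mem_univ _, (Finset.mem_filter.1 hJ).2⟩)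
    (fun J => (whitneyOp (totalMul (K := K)) totalWedge (List.ofFn J) *
      coneProd totalCone (List.ofFn J)) ∘ₗ totalPullback α)
  rw [Finset.sum_congr rfl fun I _ => hterm I]
  refine Eq.trans (Finset.sum_congr rfl fun I hI => ?_) (hfib.trans ?_)
  · rw [Finset.filter_filter]
    refine Finset.sum_congr (Finset.filter_congr fun J _ => ⟨fun h => ⟨?_, h⟩, fun h => h.2⟩)
      fun _ _ => rfl
    rw [h]
    exact (Finset.mem_filter.1 hI).2
  · refine Finset.sum_subset (fun J hJ => ?_) fun J hJ hJ' => ?_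
    · rw [Finset.mem_filter] at hJ ⊢
      exact ⟨Finset.mem_univ _, fun b c hbc => hα.reflect_lt (hJ.2 hbc)⟩
    · rw [Finset.mem_filter] at hJ hJ'
      have hmono : (List.ofFn (α ∘ J)).IsChain (· ≤ ·) :=
        (List.sortedLE_ofFn_iff.2 (hα.comp hJ.2.monotone)).isChain
      have hne : ¬ (List.ofFn (α ∘ J)).IsChain (· ≠ ·) := by
        intro hne
        refine hJ' ⟨Finset.mem_univ _, List.sortedLT_ofFn_iff.1 ?_⟩
        exact (isChain_lt_of_le_of_ne hmono hne).sortedLT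
      -- The cones along J after pullback equal the pullback of the cones along α ∘ J, which vanish.
      rw [Module.End.mul_eq_comp, LinearMap.comp_assoc,
        ← comp_coneProd (totalPullback_comp_totalCone α), List.map_ofFn,
        coneProd_eq_zero_of_not_isChain totalCone_mul_self hne, LinearMap.comp_zero,
        LinearMap.comp_zero]

end Contraction

end

end DirInv

namespace DirInv

noncomputable section

/-! ### Iterated cones compute integrals over faces -/

section IteratedIntegral

variable {K : Type u} [Field K] {q k l : ℕ}

theorem span_range_edgeVector (l : ℕ) :
    Submodule.span K (Set.range (edgeVector (K := K) (l := l))) = ⊤ := by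
  rw [eq_top_iff]
  intro v _
  rw [← sum_smul_vertexVector v 0, Fin.sum_univ_succ, vertexVector_self, smul_zero, zero_add]
  exact Submodule.sum_mem _ fun i _ => Submodule.smul_mem _ _ (Submodule.subset_span ⟨i, rfl⟩)

/-- The tangent space is spanned by l edges, so any q > l tangent vectors are dependent. -/
theorem form_eq_zero_of_lt (h : l < q) (ω : Form K q l) : ω = 0 := by
  ext v
  refine ω.map_linearDependent v fun hv => ?_
  have h1 := hv.fintype_card_le_finrank
  have h2 : Module.finrank K (simplexTangent K l) ≤ l := by
    have h3 := finrank_range_le_card (R := K) (edgeVector (K := K) (l := l))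
    rw [Set.finrank, span_range_edgeVector, finrank_top] at h3
    simpa using h3
  rw [Fintype.card_fin] at h1
  omega

/-- A top form is closed, hence ω = d(h_0 ω), and Stokes reduces its integral to the faces. -/
theorem formIntegral_eq_formIntegral_coneForm [CharZero K] (ω : Form K (q + 1) (q + 1)) :
    formIntegral (K := K) (q + 1) ω =
      formIntegral (K := K) q (formPullback (K := K) q Fin.succ (coneForm K q 0 ω)) := by
  have h := formD_coneForm 0 ω
  rw [form_eq_zero_of_lt (Nat.lt_succ_self _) (formD (K := K) (q + 1) (q + 1) ω), map_zero,
    add_zero] at h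
  conv_lhs => rw [← h]
  rw [formIntegral_formD, Fin.sum_univ_succ, Finset.sum_eq_zero]
  · simp [Fin.succAbove_zero]
  -- Every other face contains the vertex 0, so the cone can be formed inside it from the
  -- restriction of ω, which is zero for dimension reasons.
  · intro i _
    have h0 : i.succ.succAbove 0 = 0 := Fin.succ_succAbove_zero i
    have h1 : formPullback (K := K) q i.succ.succAbove (coneForm K q 0 ω) = 0 := by
      rw [← h0, formPullback_coneForm,
        form_eq_zero_of_lt (Nat.lt_succ_self q) (formPullback (K := K) (q + 1) _ ω), map_zero]
    rw [h1, map_zero, smul_zero]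

theorem evalForm_constForm (i : Fin (l + 1)) (c : K) :
    evalForm (K := K) i (constForm (K := K) l c) = c := by
  change vertexEval i (algebraMap K _ c) = c
  rw [AlgHom.commutes]
  rfl

theorem constForm_injective (l : ℕ) : Function.Injective (constForm (K := K) l) :=
  Function.LeftInverse.injective (evalForm_constForm 0)

theorem ringIntegral_zero [CharZero K] (f : SimplexRing K 0) :
    ringIntegral 0 f = vertexEval 0 f := by
  obtain ⟨p, rfl⟩ := Ideal.Quotient.mk_surjective f
  change polyIntegral 0 p = MvPolynomial.aeval (Pi.single 0 1) p
  induction p using MvPolynomial.induction_on' with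
  | add p q hp hq => rw [map_add, map_add, hp, hq]
  | monomial a c =>
    have h : ((a 0).factorial : K) ≠ 0 := Nat.cast_ne_zero.2 (Nat.factorial_ne_zero _)
    rw [polyIntegral_monomial, MvPolynomial.aeval_monomial,
      Finsupp.prod_fintype _ _ (fun i => pow_zero _)]
    simp [h]

/-- As h_j p_i = 0, only the term in which the last cone is replaced by an evaluation survives, and
that term is a constant function. -/
theorem coneEval_eq_single (J : List (Fin (l + 1))) (ω : TotalForm K l) :
    ∃ c : K, coneEval totalCone totalEval J ω =
      TotalForm.single K l 0 (constForm (K := K) l c) := by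
  induction J generalizing ω with
  | nil => exact ⟨0, by simp [coneEval]⟩
  | cons i J ih =>
    obtain ⟨c, hc⟩ := ih (totalCone i ω)
    cases J with
    | nil =>
      refine ⟨evalForm (K := K) i (ω 0), ?_⟩
      simp [coneEval, coneProd]
      rfl
    | cons j J =>
      refine ⟨-c, ?_⟩
      rw [coneEval, coneProd, mul_assoc, totalCone_mul_totalEval, mul_zero, zero_sub,
        LinearMap.neg_apply, Module.End.mul_apply, hc, map_neg, map_neg]

theorem totalPullback_single (α : Fin (k + 1) → Fin (l + 1)) (q : ℕ) (ω : Form K q l) :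
    totalPullback α (TotalForm.single K l q ω) =
      TotalForm.single K k q (formPullback (K := K) q α ω) := by
  funext p
  rw [totalPullback_apply]
  by_cases h : p = q
  · subst h
    rw [TotalForm.single_same, TotalForm.single_same]
  · rw [TotalForm.single_of_ne h, TotalForm.single_of_ne h, map_zero]

/-- The value is a constant function, and pullback preserves constants, so the constant may be
computed on the smaller simplex. -/
theorem coneEval_map_of_coneEval {α : Fin (k + 1) → Fin (l + 1)} {J : List (Fin (k + 1))}
    {ω : TotalForm K l} {c : K}
    (h : coneEval totalCone totalEval J (totalPullback α ω) =
      TotalForm.single K k 0 (constForm (K := K) k c)) :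
    coneEval totalCone totalEval (J.map α) ω =
      TotalForm.single K l 0 (constForm (K := K) l c) := by
  obtain ⟨c', hc'⟩ := coneEval_eq_single (J.map α) ω
  have h1 := LinearMap.congr_fun (comp_coneEval (totalPullback_comp_totalCone (K := K) α)
    (totalPullback_comp_totalEval α) J) ω
  rw [LinearMap.comp_apply, LinearMap.comp_apply, h, hc', totalPullback_single,
    formPullback_constForm] at h1
  have h2 := congrArg (fun x : TotalForm K k => x 0) h1
  simp only [TotalForm.single_same] at h2
  rw [hc', constForm_injective k h2]

/-- Peel off the vertex 0: by `formIntegral_eq_formIntegral_coneForm` the cone h_0 trades the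
integral for one over the opposite face, where induction applies. Each vertex peeled off brings one
sign. -/
theorem coneEval_finRange [CharZero K] (q : ℕ) (ω : TotalForm K q) :
    coneEval totalCone totalEval (List.finRange (q + 1)) ω =
      TotalForm.single K q 0 (constForm (K := K) q ((-1) ^ q * formIntegral (K := K) q (ω q))) := by
  induction q with
  | zero =>
    have h : formIntegral (K := K) 0 (ω 0) = evalForm (K := K) 0 (ω 0) := by
      change ringIntegral 0 (ω 0 edgeVector) = vertexEval 0 (ω 0 Fin.elim0)
      rw [ringIntegral_zero]
      congr 2
      exact Subsingleton.elim _ _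
    rw [h]
    simp [List.finRange_succ, coneEval, coneProd]
    rfl
  | succ q ih =>
    have h1 := coneEval_map_of_coneEval (α := Fin.succ) (ih (totalPullback Fin.succ (totalCone 0 ω)))
    rw [totalPullback_apply, totalCone_apply, ← formIntegral_eq_formIntegral_coneForm] at h1
    rw [List.finRange_succ]
    have h2 : coneProd (totalCone (K := K)) ((List.finRange (q + 1)).map Fin.succ) *
        totalEval (0 : Fin (q + 2)) = 0 := by
      rw [List.finRange_succ, List.map_cons, coneProd, mul_assoc, totalCone_mul_totalEval, mul_zero]
    rw [coneEval, h2, zero_sub, LinearMap.neg_apply, Module.End.mul_apply, h1, ← map_neg, ← map_neg]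
    congr 2
    ring

theorem coneEval_ofFn [CharZero K] (σ : Fin (q + 1) → Fin (l + 1)) (ω : TotalForm K l) :
    coneEval totalCone totalEval (List.ofFn σ) ω = TotalForm.single K l 0
      (constForm (K := K) l ((-1) ^ q * formIntegral (K := K) q (formPullback (K := K) q σ (ω q)))) := by
  rw [← List.map_id (List.ofFn σ), List.map_id, ← Function.comp_id σ, ← List.map_ofFn]
  refine coneEval_map_of_coneEval ?_
  have h := coneEval_finRange q (totalPullback σ ω)
  rw [List.finRange] at h
  exact h

end IteratedIntegral

/-! ### The Whitney projection and the contracting homotopy of forms -/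

section CoreHomotopy

variable {K : Type u} [Field K] {q k l : ℕ}

/-- The elementary form `∑ j, (-1) ^ j t_{i_j} dt_{i_0} ∧ ⋯ ∧ dt_{i_{j-1}} ∧ dt_{i_{j+1}} ∧ ⋯`. -/
def whitneyForm (I : Fin (q + 1) → Fin (l + 1)) : Form K q l :=
  whitneyOp totalMul totalWedge (List.ofFn I)
    (TotalForm.single K l 0 (constForm (K := K) l 1)) q

theorem whitneyOp_single_constForm (I : Fin (q + 1) → Fin (l + 1)) (c : K) :
    whitneyOp totalMul totalWedge (List.ofFn I)
      (TotalForm.single K l 0 (constForm (K := K) l c)) q = c • whitneyForm I := by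
  have h : constForm (K := K) l c = c • constForm (K := K) l 1 := by
    rw [← map_smul, smul_eq_mul, mul_one]
  rw [h, map_smul, map_smul]
  rfl

theorem formPullback_whitneyForm (α : Fin (k + 1) → Fin (l + 1)) (I : Fin (q + 1) → Fin (l + 1)) :
    formPullback (K := K) q α (whitneyForm I) =
      ∑ J : Fin (q + 1) → Fin (k + 1) with ∀ b, α (J b) = I b, whitneyForm J := by
  have h := LinearMap.congr_fun (comp_whitneyOp (totalPullback_comp_totalMul (K := K) α)
    (totalPullback_comp_totalWedge α) I) (TotalForm.single K l 0 (constForm (K := K) l 1))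
  have h' := congrArg (fun x : TotalForm K k => x q) h
  simp only [LinearMap.sum_apply, LinearMap.comp_apply, totalPullback_single,
    formPullback_constForm, TotalForm.sum_apply, totalPullback_apply] at h'
  exact h'

/-- The strictly increasing maps of vertices `[q] → [l]`. -/
abbrev Face (q l : ℕ) : Type := {I : Fin (q + 1) → Fin (l + 1) // StrictMono I}

open Classical in
instance (q l : ℕ) : Fintype (Face q l) := Subtype.fintype _

/-- The projection of the forms onto the span of the elementary forms. -/
def whitneyProj [CharZero K] (q l : ℕ) : Form K q l →ₗ[K] Form K q l :=
  ∑ I : Face q l, (LinearMap.toSpanSingleton K (Form K q l)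
    ((q.factorial : K) • whitneyForm I.1) ∘ₗ formIntegral (K := K) q) ∘ₗ
      formPullback (K := K) q I.1

/-- The contracting homotopy in a fixed degree. -/
def formHomotopy (q l : ℕ) : Form K (q + 1) l →ₗ[K] Form K q l :=
  TotalForm.proj K l q ∘ₗ
    DupontRelations.contraction totalMul totalWedge totalCone (l + 2) (List.finRange (l + 1)) ∘ₗ
      TotalForm.single K l (q + 1)

/-- The defining sums for k and l have different cutoffs; both are first replaced by the common
cutoff k + l + 1. -/
theorem formPullback_formHomotopy [CharZero K] {α : Fin (k + 1) → Fin (l + 1)} (hα : Monotone α)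
    (q : ℕ) : formPullback (K := K) q α ∘ₗ formHomotopy (K := K) q l =
      formHomotopy (K := K) q k ∘ₗ formPullback (K := K) (q + 1) α := by
  have hc : ∀ {l N : ℕ}, l + 1 ≤ N →
      DupontRelations.contraction (totalMul (K := K)) totalWedge totalCone (l + 2)
        (List.finRange (l + 1)) =
      DupontRelations.contraction (totalMul (K := K)) totalWedge totalCone N
        (List.finRange (l + 1)) := by
    intro l N h
    rw [DupontRelations.contraction_eq (by simp), DupontRelations.contraction_eq (N := N) (by simpa)]
  have hnat : (totalPullback α : TotalForm K l →ₗ[K] TotalForm K k) ∘ₗ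
      DupontRelations.contraction totalMul totalWedge totalCone (k + l + 1)
        (List.finRange (l + 1)) =
      DupontRelations.contraction totalMul totalWedge totalCone (k + l + 1)
        (List.finRange (k + 1)) ∘ₗ totalPullback α := by
    rw [DupontRelations.contraction, DupontRelations.contraction, comp_finset_sum, finset_sum_comp]
    refine Finset.sum_congr rfl fun m _ => ?_
    refine LinearMap.ext fun ω => ?_
    have h := LinearMap.congr_fun (whitneySum_totalPullback (K := K) hα (m + 1)) ω
    simp only [LinearMap.comp_apply, LinearMap.smul_apply, map_zsmul] at h ⊢
    rw [h]
  refine LinearMap.ext fun ω => ?_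
  have h := LinearMap.congr_fun hnat (TotalForm.single K l (q + 1) ω)
  have h' := congrArg (fun x : TotalForm K k => x q) h
  simp only [LinearMap.comp_apply, totalPullback_single, totalPullback_apply] at h'
  rw [← hc (l := l) (by omega), ← hc (l := k) (by omega)] at h'
  exact h'

theorem whitneyProj_apply [CharZero K] (q l : ℕ) (ω : Form K q l) :
    whitneyProj (K := K) q l ω = ∑ I : Face q l,
      formIntegral (K := K) q (formPullback (K := K) q I.1 ω) •
        ((q.factorial : K) • whitneyForm I.1) := by
  rw [whitneyProj, LinearMap.sum_apply]
  rfl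

theorem whitneyEvalSum_single [CharZero K] (q m l : ℕ) (ω : Form K q l) :
    DupontRelations.whitneyEvalSum totalMul totalWedge totalCone totalEval (m + 1)
      (List.finRange (l + 1)) (TotalForm.single K l q ω) =
    ∑ I : Face m l, whitneyOp totalMul totalWedge (List.ofFn I.1) (TotalForm.single K l 0
      (constForm (K := K) l ((-1) ^ m * formIntegral (K := K) m (formPullback (K := K) m I.1
        (TotalForm.single K l q ω m))))) := by
  classical
  rw [DupontRelations.whitneyEvalSum, subSum_finRange, LinearMap.sum_apply,
    Finset.sum_subtype _ (p := fun I : Fin (m + 1) → Fin (l + 1) => StrictMono I) (by simp)]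
  refine Finset.sum_congr rfl fun I _ => ?_
  rw [Module.End.mul_apply, coneEval_ofFn]

theorem zsmul_apply (n : ℤ) (ω : TotalForm K l) (q : ℕ) : (n • ω) q = n • ω q :=
  map_zsmul (TotalForm.proj K l q) n ω

/-- The abstract error term becomes the Whitney projection: for tuples of length m + 1 it integrates
the degree m component, so only m = q contributes on a form of degree q. -/
theorem contraction_relation [CharZero K] (q l : ℕ) (ω : Form K q l) :
    (totalD (DupontRelations.contraction totalMul totalWedge totalCone (l + 2)
        (List.finRange (l + 1)) (TotalForm.single K l q ω)) +
      DupontRelations.contraction totalMul totalWedge totalCone (l + 2) (List.finRange (l + 1))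
        (totalD (TotalForm.single K l q ω)) : TotalForm K l) q =
          ω - whitneyProj (K := K) q l ω := by
  by_cases hq : q < l + 2
  -- For q beyond the cutoff l + 2 both sides vanish because q exceeds the dimension l.
  swap
  · exact (form_eq_zero_of_lt (by omega) _).trans (form_eq_zero_of_lt (by omega) _).symm
  have h := (dupontRelations (K := K) l).d_mul_contraction (N := l + 2)
    (L := List.finRange (l + 1)) (by simp) ((Fin.sum_univ_def _).symm.trans sum_totalMul)
    ((Fin.sum_univ_def _).symm.trans sum_totalWedge)
  have h' := congrArg (fun x : TotalForm K l => x q)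
    (LinearMap.congr_fun h (TotalForm.single K l q ω))
  refine h'.trans ?_
  simp only [LinearMap.sub_apply, Module.End.one_apply, TotalForm.sub_apply, TotalForm.single_same,
    LinearMap.sum_apply, TotalForm.sum_apply, LinearMap.smul_apply]
  congr 1
  rw [Finset.sum_eq_single q, whitneyEvalSum_single, whitneyProj_apply]
  · refine (zsmul_apply _ _ _).trans ?_
    rw [TotalForm.sum_apply, Finset.smul_sum]
    refine Finset.sum_congr rfl fun I _ => ?_
    rw [whitneyOp_single_constForm, TotalForm.single_same, smul_smul,
      ← Int.cast_smul_eq_zsmul K, smul_smul]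
    congr 1
    push_cast
    -- The sign of the contraction cancels the sign of the iterated cone integral, leaving q!.
    have h1 : ((-1 : K) ^ q) * (-1) ^ q = 1 := by rw [← mul_pow]; simp
    linear_combination ((q.factorial : K) * formIntegral (K := K) q
      (formPullback (K := K) q I.1 ω)) * h1
  · intro m _ hm
    rw [whitneyEvalSum_single]
    simp only [TotalForm.single_of_ne hm, map_zero, mul_zero, Finset.sum_const_zero, smul_zero,
      TotalForm.zero_apply]
  · intro h
    exact absurd (Finset.mem_range.2 hq) h

theorem totalD_single (q : ℕ) (ω : Form K q l) :
    totalD (TotalForm.single K l q ω) = TotalForm.single K l (q + 1) (formD (K := K) q l ω) := by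
  funext p
  cases p with
  | zero => rw [TotalForm.single_of_ne (Nat.succ_ne_zero q).symm]; rfl
  | succ p =>
    rw [totalD, upOp_succ]
    by_cases h : p = q
    · subst h
      rw [TotalForm.single_same, TotalForm.single_same]
    · rw [TotalForm.single_of_ne h, TotalForm.single_of_ne (by omega), map_zero]

theorem formD_formHomotopy [CharZero K] (q l : ℕ) :
    formD (K := K) q l ∘ₗ formHomotopy (K := K) q l +
      formHomotopy (K := K) (q + 1) l ∘ₗ formD (K := K) (q + 1) l =
        LinearMap.id - whitneyProj (K := K) (q + 1) l := by
  refine LinearMap.ext fun ω => ?_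
  have h := contraction_relation (q + 1) l ω
  rw [totalD_single] at h
  exact h

theorem formHomotopy_formD_zero [CharZero K] (l : ℕ) :
    formHomotopy (K := K) 0 l ∘ₗ formD (K := K) 0 l = LinearMap.id - whitneyProj (K := K) 0 l := by
  refine LinearMap.ext fun ω => ?_
  have h := contraction_relation 0 l ω
  rw [totalD_single, TotalForm.add_apply] at h
  refine Eq.trans ?_ h
  exact (zero_add _).symm

/-- The form `dt_1 ∧ ⋯ ∧ dt_q` on the simplex of dimension `q`. -/
def volumeForm (q : ℕ) : Form K q q :=
  (Algebra.linearMap K (SimplexRing K q)).compAlternatingMap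
    ((Matrix.detRowAlternating (n := Fin q) (R := K)).compLinearMap
      (LinearMap.pi fun a => LinearMap.proj a.succ ∘ₗ (simplexTangent K q).subtype))

theorem formIntegral_volumeForm [CharZero K] (q : ℕ) :
    formIntegral (K := K) q (volumeForm q) = (q.factorial : K)⁻¹ := by
  have h : volumeForm (K := K) q edgeVector = 1 := by
    have hM : (fun a : Fin q => (LinearMap.pi fun b : Fin q => LinearMap.proj b.succ ∘ₗ
        (simplexTangent K q).subtype) (edgeVector (K := K) a)) =
        (1 : Matrix (Fin q) (Fin q) K) := by
      funext a b
      simp [edgeVector, Matrix.one_apply, Pi.single_apply, eq_comm]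
    change algebraMap K (SimplexRing K q) (Matrix.det _) = 1
    rw [hM, Matrix.det_one, map_one]
  change ringIntegral q (volumeForm (K := K) q edgeVector) = _
  rw [h]
  change polyIntegral q 1 = _
  refine (polyIntegral_monomial q 0 (1 : K)).trans ?_
  simp

theorem face_eq_id (I : Face q q) : I.1 = id := by
  have h : StrictMono I.1 := I.2
  have hsurj : Function.Surjective I.1 := Finite.surjective_of_injective h.injective
  exact (h.range_inj strictMono_id).1 (by rw [hsurj.range_eq, Set.range_id])

/-- Obtained from the homotopy rather than by expanding the Whitney form. The volume form and its
projection have the same integral, while the projection is q! W_id times the integral of the volume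
form, which is nonzero and can be cancelled. -/
theorem formIntegral_whitneyForm [CharZero K] (q : ℕ) :
    formIntegral (K := K) q ((q.factorial : K) • whitneyForm id) = 1 := by
  have hI : formIntegral (K := K) q (whitneyProj (K := K) q q (volumeForm q)) =
      formIntegral (K := K) q (volumeForm q) := by
    cases q with
    | zero =>
      have h := LinearMap.congr_fun (formHomotopy_formD_zero (K := K) 0) (volumeForm 0)
      rw [LinearMap.comp_apply, form_eq_zero_of_lt Nat.zero_lt_one (formD (K := K) 0 0 _), map_zero,
        LinearMap.sub_apply, eq_comm, sub_eq_zero] at h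
      rw [← h]
      rfl
    | succ q =>
      have h := LinearMap.congr_fun (formD_formHomotopy (K := K) q (q + 1)) (volumeForm (q + 1))
      rw [LinearMap.add_apply, LinearMap.comp_apply, LinearMap.comp_apply,
        form_eq_zero_of_lt (Nat.lt_succ_self _) (formD (K := K) (q + 1) (q + 1) _), map_zero,
        add_zero, LinearMap.sub_apply, LinearMap.id_apply] at h
      have h2 := congrArg (formIntegral (K := K) (q + 1)) h
      rw [formIntegral_formD, map_sub, eq_comm, Finset.sum_eq_zero, sub_eq_zero] at h2
      · exact h2.symm
      -- The difference is d of s(volume), whose boundary integrals vanish: by naturality s is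
      -- applied to the restriction of a top form to a face, which is zero.
      · intro i _
        have h3 := LinearMap.congr_fun (formPullback_formHomotopy (K := K)
          (Fin.strictMono_succAbove i).monotone q) (volumeForm (q + 1))
        rw [LinearMap.comp_apply, LinearMap.comp_apply,
          form_eq_zero_of_lt (Nat.lt_succ_self q) (formPullback (K := K) (q + 1) _ _),
          map_zero] at h3
        rw [h3, map_zero, smul_zero]
  have hid : formPullback (K := K) q (id : Fin (q + 1) → Fin (q + 1)) = LinearMap.id := by
    refine LinearMap.ext fun ω => AlternatingMap.ext fun v => ?_
    have h1 : ringPullback (K := K) (id : Fin (q + 1) → Fin (q + 1)) = AlgHom.id K _ :=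
      simplexRing_algHom_ext fun i => by rw [ringPullback_coord, Finset.sum_filter]; simp
    have h2 : tangentMap (K := K) (id : Fin (q + 1) → Fin (q + 1)) = LinearMap.id := by
      refine LinearMap.ext fun v => Subtype.ext (funext fun j => ?_)
      simp only [tangentMap, LinearMap.coe_mk, AddHom.coe_mk, Finset.sum_filter]
      simp
    rw [formPullback_apply, h1, h2]
    rfl
  rw [whitneyProj_apply, Fintype.sum_eq_single ⟨id, strictMono_id⟩
    (fun I hI => absurd (Subtype.ext (face_eq_id I)) hI), map_smul, hid, LinearMap.id_apply,
    smul_eq_mul, formIntegral_volumeForm] at hI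
  have h0 : (q.factorial : K)⁻¹ ≠ 0 :=
    inv_ne_zero (Nat.cast_ne_zero.2 (Nat.factorial_ne_zero _))
  exact mul_left_cancel₀ h0 (hI.trans (mul_one _).symm)

end CoreHomotopy

end

end DirInv

namespace DirInv

noncomputable section

/-! ### Functoriality and additivity of the completed tensor product -/

section CompletedTensor

open DirInvModule

variable {C : Type u} [CommRing C]

theorem pieceMap_add {M N : DirInvModule C} {φ ψ χ : M →ₗ[C] N} {j : M.index} {k : N.index}
    (hφ : PieceContinuous M N φ j k) (hψ : PieceContinuous M N ψ j k)
    (hχ : PieceContinuous M N χ j k) (h : χ = φ + ψ) (x : M.piece j) :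
    pieceMap hχ x = pieceMap hφ x + pieceMap hψ x := by
  subst h
  refine Subtype.ext (funext fun i => ?_)
  obtain ⟨a, ha⟩ := hφ.invContinuous i
  obtain ⟨b, hb⟩ := hψ.invContinuous i
  have ha' := (M.filOn_anti j (le_max_left a b)).trans ha
  have hb' := (M.filOn_anti j (le_max_right a b)).trans hb
  have hc : M.filOn j (max a b) ≤ (N.filOn k i).comap ((φ + ψ).restrict hχ.F_le) :=
    fun y hy => by
      have h : (φ + ψ).restrict hχ.F_le y = φ.restrict hφ.F_le y + ψ.restrict hψ.F_le y := rfl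
      rw [Submodule.mem_comap, h]
      exact add_mem (ha' hy) (hb' hy)
  change (pieceMap hχ x).1 i = (pieceMap hφ x).1 i + (pieceMap hψ x).1 i
  rw [pieceMap, pieceMap, pieceMap, invLimMap_apply _ _ _ ha', invLimMap_apply _ _ _ hb',
    invLimMap_apply _ _ _ hc]
  obtain ⟨m, hm⟩ := Submodule.mkQ_surjective _ (x.1 (max a b))
  rw [← hm]
  rfl

/-- Each map may use a different target index; all three are moved to a common upper bound, where
additivity is checked levelwise. -/
theorem completionMap_add {M N : DirInvModule C} (f g h : M ⟶ N)
    (hfg : Hom.lin h = Hom.lin f + Hom.lin g) :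
    completionMap h = completionMap f + completionMap g := by
  refine LinearMap.ext fun z => ?_
  obtain ⟨j, x, rfl⟩ := Completion.exists_of M z
  obtain ⟨k₁, h₁⟩ := f.cont j
  obtain ⟨k₂, h₂⟩ := g.cont j
  obtain ⟨k₃, h₃⟩ := h.cont j
  obtain ⟨k₄, h₁₄, h₂₄⟩ := exists_ge_ge k₁ k₂
  obtain ⟨k, h₃k, h₄k⟩ := exists_ge_ge k₃ k₄
  have hf : PieceContinuous M N (Hom.lin f) j k := h₁.comp (pieceContinuous_id (h₁₄.trans h₄k))
  have hg : PieceContinuous M N (Hom.lin g) j k := h₂.comp (pieceContinuous_id (h₂₄.trans h₄k))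
  have hh : PieceContinuous M N (Hom.lin h) j k := h₃.comp (pieceContinuous_id h₃k)
  rw [LinearMap.add_apply, completionMap_of f hf, completionMap_of g hg, completionMap_of h hh,
    pieceMap_add hf hg hh hfg, map_add]

theorem completionEquiv_of_toInvLim {M : DirInvModule C} (hM : M.IsComplete) {j : M.index}
    (m : M.F j) :
    M.completionEquiv hM (Completion.of M j (toInvLim (M.filOn j) (M.filOn_anti j) m)) = m := by
  classical
  rw [← LinearEquiv.eq_symm_apply]
  have hof : M.colimToCompletion (Module.DirectLimit.of C M.index (fun j => M.F j)
      (fun _ _ h => Submodule.inclusion (M.F_mono h)) j m) =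
        Completion.of M j (toInvLim (M.filOn j) (M.filOn_anti j) m) :=
    Module.DirectLimit.lift_of _ _ _
  rw [completionEquiv, LinearEquiv.trans_symm, LinearEquiv.trans_apply, LinearEquiv.symm_symm,
    LinearEquiv.ofBijective_apply, ← hof]
  congr 1
  rw [LinearEquiv.eq_symm_apply, LinearEquiv.ofBijective_apply]
  exact colimToModule_of _ _ _

/-- By completeness every element of the completion comes from some F_j, and there both sides are
computed by f itself. -/
theorem completionEquiv_completionMap {M N : DirInvModule C} (hM : M.IsComplete)
    (hN : N.IsComplete) (f : M ⟶ N) (z : M.Completion) :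
    N.completionEquiv hN (completionMap f z) = Hom.lin f (M.completionEquiv hM z) := by
  classical
  obtain ⟨y, rfl⟩ := hM.colimToCompletion_bijective.2 z
  obtain ⟨j, m, rfl⟩ := Module.DirectLimit.exists_of y
  have hof : M.colimToCompletion (Module.DirectLimit.of C M.index (fun j => M.F j)
      (fun _ _ h => Submodule.inclusion (M.F_mono h)) j m) =
        Completion.of M j (toInvLim (M.filOn j) (M.filOn_anti j) m) :=
    Module.DirectLimit.lift_of _ _ _
  obtain ⟨k, hk⟩ := f.cont j
  rw [hof, completionMap_toInvLim f m.1 m.2 (hk.F_le m.2), completionEquiv_of_toInvLim,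
    completionEquiv_of_toInvLim]

variable {A B D : Type u} [AddCommGroup A] [Module C A] [AddCommGroup B] [Module C B]
  [AddCommGroup D] [Module C D]

/-- The map `g ⊗̂ f` of completed tensor products, as an additive function of the map `g` of
discrete modules. -/
def completedTensor {M N : DirInvModule C} (f : M ⟶ N) : (A →ₗ[C] B) →+
    ((tensor (discrete (C := C) A) M).Completion →ₗ[C]
      (tensor (discrete (C := C) B) N).Completion) where
  toFun g := completionMap (tensorMap (discreteMap g) f)
  map_zero' := completionMap_zero _ (TensorProduct.map_zero_left _)
  map_add' _ _ := completionMap_add _ _ _ (TensorProduct.map_add_left _ _ _)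

theorem completedTensor_comp {M N P : DirInvModule C} (f : M ⟶ N) (f' : N ⟶ P) (g : A →ₗ[C] B)
    (g' : B →ₗ[C] D) (z : (tensor (discrete (C := C) A) M).Completion) :
    completedTensor f' g' (completedTensor f g z) = completedTensor (f ≫ f') (g' ∘ₗ g) z := by
  change completionMap _ (completionMap _ z) = completionMap _ z
  rw [← LinearMap.comp_apply, ← completionMap_comp, ← tensorMap_comp]
  rfl

theorem completedTensor_id (M : DirInvModule C)
    (z : (tensor (discrete (C := C) A) M).Completion) :
    completedTensor (𝟙 M) (LinearMap.id : A →ₗ[C] A) z = z := by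
  have h : tensorMap (discreteMap (LinearMap.id : A →ₗ[C] A)) (𝟙 M) =
      𝟙 (tensor (discrete (C := C) A) M) := hom_ext TensorProduct.map_id
  change completionMap _ z = z
  rw [h, completionMap_id]
  rfl

theorem completedTensor_id_sub (M : DirInvModule C) (g : A →ₗ[C] A)
    (z : (tensor (discrete (C := C) A) M).Completion) :
    completedTensor (𝟙 M) (LinearMap.id - g) z = z - completedTensor (𝟙 M) g z := by
  have h : completedTensor (𝟙 M) (LinearMap.id - g) + completedTensor (𝟙 M) g =
      completedTensor (𝟙 M) (LinearMap.id : A →ₗ[C] A) := by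
    rw [← AddMonoidHom.map_add, sub_add_cancel]
  rw [eq_sub_iff_add_eq, ← LinearMap.add_apply, h, completedTensor_id]

/-- The inverse `m ↦ 1 ⊗ m` of the canonical morphism `C ⊗ M → M`. -/
def lidInv (M : DirInvModule C) : M ⟶ tensor (discrete (C := C) C) M where
  lin := (TensorProduct.lid C M).symm.toLinearMap
  cont j := ⟨(PUnit.unit, j), fun _ hm => Submodule.apply_mem_map₂ (TensorProduct.mk C C M)
    (Submodule.mem_top (x := (1 : C))) hm, fun i => ⟨i, fun _ hm =>
      Submodule.mem_sup_right (Submodule.apply_mem_map₂ (TensorProduct.mk C C M)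
        (Submodule.mem_top (x := (1 : C))) hm)⟩⟩

theorem lidInv_lidHom (M : DirInvModule C) :
    completionMap (lidHom M) ∘ₗ completionMap (lidInv M) = LinearMap.id := by
  have h : lidInv M ≫ lidHom M = 𝟙 M :=
    hom_ext (LinearMap.ext fun m => (TensorProduct.lid C M).apply_symm_apply m)
  rw [← completionMap_comp, h, completionMap_id]

theorem lidHom_lidInv (M : DirInvModule C) :
    completionMap (lidInv M) ∘ₗ completionMap (lidHom M) = LinearMap.id := by
  have h : lidHom M ≫ lidInv M = 𝟙 _ :=
    hom_ext (LinearMap.ext fun m => (TensorProduct.lid C M).symm_apply_apply m)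
  rw [← completionMap_comp, h, completionMap_id]

/-- The canonical isomorphism `C ⊗̂ M ≅ M` for a complete dir-inv module. -/
def completedLid (M : DirInvModule C) (hM : M.IsComplete) :
    (tensor (discrete (C := C) C) M).Completion ≃ₗ[C] M :=
  { (M.completionEquiv hM).toLinearMap ∘ₗ completionMap (lidHom M) with
    invFun := fun m => completionMap (lidInv M) ((M.completionEquiv hM).symm m)
    left_inv := fun z => by
      have h := LinearMap.congr_fun (lidHom_lidInv M) z
      simpa using h
    right_inv := fun m => by
      have h := LinearMap.congr_fun (lidInv_lidHom M) ((M.completionEquiv hM).symm m)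
      exact (congrArg (M.completionEquiv hM) h).trans ((M.completionEquiv hM).apply_symm_apply m) }

theorem completedLid_completedTensor {M N : DirInvModule C} (hM : M.IsComplete)
    (hN : N.IsComplete) (f : M ⟶ N) (z : (tensor (discrete (C := C) C) M).Completion) :
    completedLid N hN (completedTensor f (LinearMap.id : C →ₗ[C] C) z) =
      Hom.lin f (completedLid M hM z) := by
  change N.completionEquiv hN (completionMap (lidHom N) (completionMap _ z)) =
    Hom.lin f (M.completionEquiv hM (completionMap (lidHom M) z))
  rw [← completionEquiv_completionMap hM hN, ← LinearMap.comp_apply, ← LinearMap.comp_apply,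
    ← completionMap_comp, ← completionMap_comp]
  congr 3
  refine hom_ext (TensorProduct.ext' fun c m => ?_)
  exact (map_smul (Hom.lin f) (show C from c) m).symm

/-- Lets f be applied first, so that elements a ⊗ m can be transported in the factor m. -/
theorem completedTensor_completedLid_symm {M N : DirInvModule C} (hM : M.IsComplete)
    (hN : N.IsComplete) (f : M ⟶ N) (g : C →ₗ[C] A) (m : M) :
    completedTensor f g ((completedLid M hM).symm m) =
      completedTensor (𝟙 N) g ((completedLid N hN).symm (Hom.lin f m)) := by
  have h : (completedLid N hN).symm (Hom.lin f m) =
      completedTensor f (LinearMap.id : C →ₗ[C] C) ((completedLid M hM).symm m) := by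
    rw [LinearEquiv.symm_apply_eq, completedLid_completedTensor hM, LinearEquiv.apply_symm_apply]
  rw [h, completedTensor_comp, LinearMap.comp_id, Category.comp_id]

/-- The element `a ⊗ m` of `A ⊗̂ M`, for a discrete module `A` and a complete dir-inv module
`M`. -/
def pureTensor {M : DirInvModule C} (hM : M.IsComplete) (m : M) :
    A →+ (tensor (discrete (C := C) A) M).Completion where
  toFun a := completedTensor (𝟙 M) (LinearMap.toSpanSingleton C A a) ((completedLid M hM).symm m)
  map_zero' := by
    rw [LinearMap.toSpanSingleton_zero, map_zero, LinearMap.zero_apply]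
  map_add' a b := by
    have h : LinearMap.toSpanSingleton C A (a + b) =
        LinearMap.toSpanSingleton C A a + LinearMap.toSpanSingleton C A b := by
      ext
      simp
    rw [h, map_add, LinearMap.add_apply]

theorem pureTensor_zero_right {M : DirInvModule C} (hM : M.IsComplete) (a : A) :
    pureTensor hM 0 a = 0 := by
  change completedTensor (𝟙 M) _ _ = 0
  rw [map_zero, map_zero]

theorem completedTensor_pureTensor {M N : DirInvModule C} (hM : M.IsComplete)
    (hN : N.IsComplete) (f : M ⟶ N) (g : A →ₗ[C] B) (m : M) (a : A) :
    completedTensor f g (pureTensor hM m a) = pureTensor hN (Hom.lin f m) (g a) := by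
  change completedTensor f g (completedTensor (𝟙 M) _ _) = completedTensor (𝟙 N) _ _
  rw [completedTensor_comp, Category.id_comp, completedTensor_completedLid_symm hM hN]
  congr 3
  ext
  simp

theorem completedLid_pureTensor_one {M : DirInvModule C} (hM : M.IsComplete) (m : M) :
    completedLid M hM (pureTensor hM m (1 : C)) = m := by
  have h : LinearMap.toSpanSingleton C C 1 = LinearMap.id := by
    ext
    simp
  change completedLid M hM (completedTensor (𝟙 M) _ _) = m
  rw [h, completedTensor_id, LinearEquiv.apply_symm_apply]

/-- Applying a functional and then tensoring with b is the completed action of the rank one operator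
a ↦ g(a) b. The Whitney projection is a sum of such operators. -/
theorem pureTensor_completedLid {M : DirInvModule C} (hM : M.IsComplete) (g : A →ₗ[C] C) (b : B)
    (z : (tensor (discrete (C := C) A) M).Completion) :
    pureTensor hM (completedLid M hM (completedTensor (𝟙 M) g z)) b =
      completedTensor (𝟙 M) (LinearMap.toSpanSingleton C B b ∘ₗ g) z := by
  change completedTensor (𝟙 M) _ _ = _
  rw [LinearEquiv.symm_apply_apply, completedTensor_comp, Category.id_comp]

theorem lin_completedLid_completedTensor {M N : DirInvModule C} (hM : M.IsComplete)
    (hN : N.IsComplete) (f : M ⟶ N) (g : A →ₗ[C] C)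
    (z : (tensor (discrete (C := C) A) M).Completion) :
    Hom.lin f (completedLid M hM (completedTensor (𝟙 M) g z)) =
      completedLid N hN (completedTensor (𝟙 N) g (completedTensor f LinearMap.id z)) := by
  rw [← completedLid_completedTensor hM hN, completedTensor_comp, completedTensor_comp,
    Category.id_comp, Category.comp_id, LinearMap.id_comp, LinearMap.comp_id]

end CompletedTensor

end

end DirInv

namespace DirInv

noncomputable section

/-! ### Integration, its section and the homotopy on the Thom–Sullivan complex -/

section Comparison

open Simplicial DirInvModule

variable {K : Type u} [Field K]

theorem coface_eq (M : CosimplicialObject (DirInvModule K)) (q : ℕ) {k l : ℕ} (α : ⦋k⦌ ⟶ ⦋l⦌) :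
    coface M q α = completedTensor (M.map α) (LinearMap.id : Form K q k →ₗ[K] Form K q k) := rfl

theorem restrictForm_eq (M : CosimplicialObject (DirInvModule K)) (q : ℕ) {k l : ℕ}
    (α : ⦋k⦌ ⟶ ⦋l⦌) : restrictForm M q α =
      completedTensor (𝟙 (M.obj ⦋l⦌)) (formPullback (K := K) q α.toOrderHom) := rfl

theorem completedD_eq (M : CosimplicialObject (DirInvModule K)) (q k l : ℕ) :
    completedD M q k l = completedTensor (𝟙 (M.obj ⦋l⦌)) (formD (K := K) q k) := rfl

theorem completedIntegral_eq [CharZero K] (l : ℕ) (M : DirInvModule K) (hM : M.IsComplete)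
    (z : (tensor (discrete (C := K) (Form K l l)) M).Completion) :
    completedIntegral l M hM z =
      completedLid M hM (completedTensor (𝟙 M) (formIntegral (K := K) l) z) := rfl

theorem mem_normSub_zero (X : CosimplicialObject (ModuleCat.{u} K)) (m : X.obj ⦋0⦌) :
    m ∈ normSub X 0 :=
  Submodule.mem_top

theorem mem_normSub_succ (X : CosimplicialObject (ModuleCat.{u} K)) (q : ℕ)
    (m : X.obj ⦋q + 1⦌) : m ∈ normSub X (q + 1) ↔ ∀ i, (X.σ i).hom m = 0 := by
  simp only [normSub, Submodule.mem_iInf, LinearMap.mem_ker]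

variable (M : CosimplicialObject (DirInvModule K)) (hM : ∀ q : ℕ, (M.obj ⦋q⦌).IsComplete)

/-- The compatibility of u for α turns the image of the integral of u_q into an integral of u_l
along α. Codegeneracies, cofaces and faces of the l-simplex are all treated through this formula. -/
theorem map_completedIntegral [CharZero K] {q l : ℕ} (α : ⦋q⦌ ⟶ ⦋l⦌) (u : thomSullivanSub M q) :
    Hom.lin (M.map α) (completedIntegral q (M.obj ⦋q⦌) (hM q) (u.1 q)) =
      completedLid (M.obj ⦋l⦌) (hM l) (completedTensor (𝟙 _)
        (formIntegral (K := K) q ∘ₗ formPullback (K := K) q α.toOrderHom) (u.1 l)) := by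
  have h := u.2 q l α
  rw [coface_eq, restrictForm_eq] at h
  rw [completedIntegral_eq, lin_completedLid_completedTensor (hM q) (hM l), h,
    completedTensor_comp, Category.id_comp]

/-- A codegeneracy turns the integral into one of a (q + 1)-form on a simplex of dimension q, which
is zero. -/
theorem completedIntegral_mem_normSub [CharZero K] (q : ℕ) (u : thomSullivanSub M q) :
    (completedIntegral q (M.obj ⦋q⦌) (hM q) (u.1 q) : M.obj ⦋q⦌) ∈
      normSub (underlying M) q := by
  cases q with
  | zero => exact mem_normSub_zero (underlying M) _
  | succ q =>
    refine (mem_normSub_succ (underlying M) q _).2 fun i =>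
      (map_completedIntegral M hM (SimplexCategory.σ i) u).trans ?_
    have h : formPullback (K := K) (q + 1) (SimplexCategory.σ i).toOrderHom = 0 :=
      LinearMap.ext fun ω => by rw [form_eq_zero_of_lt (Nat.lt_succ_self q) ω, map_zero, map_zero]
    rw [h, LinearMap.comp_zero, map_zero, LinearMap.zero_apply, map_zero]
    rfl

/-- The integration map in degree `q`. -/
def integrate [CharZero K] (q : ℕ) : thomSullivanSub M q →ₗ[K] normSub (underlying M) q :=
  LinearMap.codRestrict _ (completedIntegral q (M.obj ⦋q⦌) (hM q) ∘ₗ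
    LinearMap.proj (φ := fun l => FormTensor M q l l) q ∘ₗ (thomSullivanSub M q).subtype)
    (completedIntegral_mem_normSub M hM q)

theorem integrate_thomSullivanD [CharZero K] (q : ℕ) (u : thomSullivanSub M q) :
    (integrate M hM (q + 1) (thomSullivanD M q u)).1 =
      (AlgebraicTopology.AlternatingCofaceMapComplex.objD (underlying M) q).hom
        (integrate M hM q u).1 := by
  have h1 : (AlgebraicTopology.AlternatingCofaceMapComplex.objD (underlying M) q).hom
      (integrate M hM q u).1 = ∑ i : Fin (q + 2), (-1 : ℤ) ^ (i : ℕ) •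
        Hom.lin (M.map (SimplexCategory.δ i))
          (completedIntegral q (M.obj ⦋q⦌) (hM q) (u.1 q)) := by
    rw [AlgebraicTopology.AlternatingCofaceMapComplex.objD, ModuleCat.hom_sum,
      LinearMap.sum_apply]
    rfl
  have h2 : formIntegral (K := K) (q + 1) ∘ₗ formD (K := K) q (q + 1) =
      ∑ i : Fin (q + 2), (-1 : ℤ) ^ (i : ℕ) • (formIntegral (K := K) q ∘ₗ
        formPullback (K := K) q (SimplexCategory.δ i).toOrderHom) := by
    refine LinearMap.ext fun ω => ?_
    rw [LinearMap.comp_apply, formIntegral_formD, LinearMap.sum_apply]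
    rfl
  rw [h1]
  change completedIntegral (q + 1) _ (hM (q + 1)) (completedD M q (q + 1) (q + 1) (u.1 (q + 1))) = _
  rw [completedIntegral_eq, completedD_eq, completedTensor_comp, Category.id_comp, h2, map_sum,
    LinearMap.sum_apply, map_sum]
  refine Finset.sum_congr rfl fun i _ => ?_
  rw [map_completedIntegral, map_zsmul, LinearMap.smul_apply, map_zsmul]

/-- A monotone map that is not strict is not injective, so it factors through a codegeneracy, which
kills normalized elements. -/
theorem map_eq_zero_of_mem_normSub {q l : ℕ} (α : ⦋q⦌ ⟶ ⦋l⦌)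
    (hα : ¬ StrictMono α.toOrderHom) (m : M.obj ⦋q⦌) (hm : m ∈ normSub (underlying M) q) :
    Hom.lin (M.map α) m = 0 := by
  have hinj : ¬ Function.Injective α.toOrderHom := fun h =>
    hα (α.toOrderHom.monotone.strictMono_of_injective h)
  cases q with
  | zero =>
    refine absurd (fun a b _ => ?_) hinj
    exact Subsingleton.elim (α := Fin 1) a b
  | succ q =>
    obtain ⟨i, θ, rfl⟩ := SimplexCategory.eq_σ_comp_of_not_injective α hinj
    have h : Hom.lin (M.map (SimplexCategory.σ i)) m = 0 :=
      (mem_normSub_succ (underlying M) q m).1 hm i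
    rw [M.map_comp, comp_lin, LinearMap.comp_apply, h, map_zero]

open Classical in
/-- The map `M^q → M^l` given by a strictly monotone map of vertices, and zero for all other maps
of vertices. -/
def faceMap {q l : ℕ} (I : Fin (q + 1) → Fin (l + 1)) : M.obj ⦋q⦌ →ₗ[K] M.obj ⦋l⦌ :=
  if h : StrictMono I then
    Hom.lin (M.map (SimplexCategory.mkHom (n := q) (m := l) ⟨I, h.monotone⟩)) else 0

theorem faceMap_of_strictMono {q l : ℕ} {I : Fin (q + 1) → Fin (l + 1)} (h : StrictMono I) :
    faceMap M I = Hom.lin (M.map (SimplexCategory.mkHom (n := q) (m := l) ⟨I, h.monotone⟩)) :=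
  dif_pos h

theorem faceMap_of_not_strictMono {q l : ℕ} {I : Fin (q + 1) → Fin (l + 1)}
    (h : ¬ StrictMono I) : faceMap M I = 0 :=
  dif_neg h

theorem map_faceMap {q k l : ℕ} (α : ⦋k⦌ ⟶ ⦋l⦌) (J : Fin (q + 1) → Fin (k + 1)) (m : M.obj ⦋q⦌)
    (hm : m ∈ normSub (underlying M) q) :
    Hom.lin (M.map α) (faceMap M J m) = faceMap M (α.toOrderHom ∘ J) m := by
  by_cases hJ : StrictMono J
  · have h : Hom.lin (M.map α) (faceMap M J m) = Hom.lin (M.map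
        (SimplexCategory.mkHom (n := q) (m := k) ⟨J, hJ.monotone⟩ ≫ α)) m := by
      rw [faceMap_of_strictMono M hJ, M.map_comp]
      rfl
    rw [h]
    by_cases hα : StrictMono (α.toOrderHom ∘ J)
    · rw [faceMap_of_strictMono M hα]
      rfl
    · rw [faceMap_of_not_strictMono M hα]
      exact map_eq_zero_of_mem_normSub M
        (SimplexCategory.mkHom (n := q) (m := k) ⟨J, hJ.monotone⟩ ≫ α) hα m hm
  · have hα : ¬ StrictMono (α.toOrderHom ∘ J) := fun h => hJ fun a b hab =>
      lt_of_not_ge fun hba => (h hab).not_ge (α.toOrderHom.monotone hba)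
    rw [faceMap_of_not_strictMono M hJ, faceMap_of_not_strictMono M hα, LinearMap.zero_apply,
      LinearMap.zero_apply, map_zero]

/-- The normalized elementary form of a face. -/
def elementaryForm {q l : ℕ} (I : Fin (q + 1) → Fin (l + 1)) : Form K q l :=
  (q.factorial : K) • whitneyForm I

/-- The map sending `m` to the element `∑ I, ω_I ⊗ I^* m` of `Ω^q(Δ^l) ⊗̂ M^l`. -/
def whitneySum (q l : ℕ) : M.obj ⦋q⦌ →ₗ[K] FormTensor M q l l :=
  ∑ I : Fin (q + 1) → Fin (l + 1),
    completedTensor (𝟙 (M.obj ⦋l⦌)) (LinearMap.toSpanSingleton K _ (elementaryForm (K := K) I)) ∘ₗ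
      (completedLid (M.obj ⦋l⦌) (hM l)).symm.toLinearMap ∘ₗ faceMap M I

theorem whitneySum_apply (q l : ℕ) (m : M.obj ⦋q⦌) : whitneySum M hM q l m =
    ∑ I : Fin (q + 1) → Fin (l + 1),
      pureTensor (hM l) (faceMap M I m) (elementaryForm (K := K) I) := by
  rw [whitneySum, LinearMap.sum_apply]
  rfl

/-- The pullback of ω_I is the sum of the ω_J with α ∘ J = I, and M(α) carries the face term of J to
that of α ∘ J. Both sides are thus the sum over all J of ω_J ⊗ M(α ∘ J) m; normalization handles the
J whose image degenerates. -/
theorem coface_whitneySum (q : ℕ) {k l : ℕ} (α : ⦋k⦌ ⟶ ⦋l⦌) (m : M.obj ⦋q⦌)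
    (hm : m ∈ normSub (underlying M) q) :
    coface M q α (whitneySum M hM q k m) = restrictForm M q α (whitneySum M hM q l m) := by
  classical
  rw [coface_eq, restrictForm_eq, whitneySum_apply, whitneySum_apply, map_sum, map_sum]
  simp only [completedTensor_pureTensor (hM _) (hM l), map_faceMap M α _ m hm, id_lin,
    LinearMap.id_apply]
  have h : ∀ I : Fin (q + 1) → Fin (l + 1),
      formPullback (K := K) q α.toOrderHom (elementaryForm (K := K) I) =
        ∑ J : Fin (q + 1) → Fin (k + 1) with α.toOrderHom ∘ J = I, elementaryForm J := by
    intro I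
    rw [elementaryForm, map_smul, formPullback_whitneyForm, Finset.smul_sum]
    refine Finset.sum_congr (Finset.filter_congr fun J _ => ?_) fun _ _ => rfl
    exact funext_iff.symm
  simp only [h, map_sum]
  rw [← Finset.sum_fiberwise (s := Finset.univ)
    (g := fun J : Fin (q + 1) → Fin (k + 1) => α.toOrderHom ∘ J)]
  refine Finset.sum_congr rfl fun I _ => Finset.sum_congr rfl fun J hJ => ?_
  rw [← (Finset.mem_filter.1 hJ).2]

/-- The section `m ↦ (∑ I, ω_I ⊗ I^* m)_l` of the integration map in degree `q`. -/
def whitneySection (q : ℕ) : normSub (underlying M) q →ₗ[K] thomSullivanSub M q :=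
  LinearMap.codRestrict _
    (LinearMap.pi fun l => whitneySum M hM q l ∘ₗ (normSub (underlying M) q).subtype)
    fun m _ _ α => coface_whitneySum M hM q α m.1 m.2

/-- The only strictly increasing map from [q] to [q] is the identity, and its elementary form has
integral 1. -/
theorem completedIntegral_whitneySum [CharZero K] (q : ℕ) (m : M.obj ⦋q⦌) :
    completedIntegral q (M.obj ⦋q⦌) (hM q) (whitneySum M hM q q m) = m := by
  rw [whitneySum_apply, Fintype.sum_eq_single id]
  · have hid : faceMap M (id : Fin (q + 1) → Fin (q + 1)) = LinearMap.id :=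
      (faceMap_of_strictMono M strictMono_id).trans (congrArg Hom.lin (M.map_id ⦋q⦌))
    rw [completedIntegral_eq, completedTensor_pureTensor (hM q) (hM q), elementaryForm,
      formIntegral_whitneyForm, hid]
    exact completedLid_pureTensor_one (hM q) m
  · intro I hI
    rw [faceMap_of_not_strictMono M fun h => hI (face_eq_id ⟨I, h⟩), LinearMap.zero_apply,
      pureTensor_zero_right]

/-- By `map_completedIntegral`, M(I) applied to the integral of u_q is the integral of u_l over the
face I, which is the coefficient of ω_I in the Whitney projection. -/
theorem whitneySum_completedIntegral [CharZero K] (q l : ℕ) (u : thomSullivanSub M q) :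
    whitneySum M hM q l (completedIntegral q (M.obj ⦋q⦌) (hM q) (u.1 q)) =
      completedTensor (𝟙 (M.obj ⦋l⦌)) (whitneyProj (K := K) q l) (u.1 l) := by
  classical
  rw [whitneySum_apply, whitneyProj, map_sum, LinearMap.sum_apply]
  have h : ∀ m : M.obj ⦋q⦌, ∑ I : Fin (q + 1) → Fin (l + 1),
      pureTensor (hM l) (faceMap M I m) (elementaryForm (K := K) I) =
      ∑ I : Fin (q + 1) → Fin (l + 1) with StrictMono I,
        pureTensor (hM l) (faceMap M I m) (elementaryForm (K := K) I) := by
    refine fun m => (Finset.sum_filter_of_ne fun I _ hI => ?_).symm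
    by_contra hI'
    rw [faceMap_of_not_strictMono M hI', LinearMap.zero_apply, pureTensor_zero_right] at hI
    exact hI rfl
  rw [h, Finset.sum_subtype _ (p := fun I : Fin (q + 1) → Fin (l + 1) => StrictMono I) (by simp)]
  refine Finset.sum_congr rfl fun I _ => ?_
  rw [faceMap_of_strictMono M I.2, map_completedIntegral, pureTensor_completedLid]
  rfl

theorem integrate_whitneySection [CharZero K] (q : ℕ) (m : normSub (underlying M) q) :
    integrate M hM q (whitneySection M hM q m) = m :=
  Subtype.ext (completedIntegral_whitneySum M hM q m.1)

theorem whitneySection_integrate [CharZero K] (q l : ℕ) (u : thomSullivanSub M q) :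
    (whitneySection M hM q (integrate M hM q u)).1 l =
      completedTensor (𝟙 (M.obj ⦋l⦌)) (whitneyProj (K := K) q l) (u.1 l) :=
  whitneySum_completedIntegral M hM q l u

theorem completedTensor_formD_formHomotopy [CharZero K] (N : DirInvModule K) (q l : ℕ)
    (z : (tensor (discrete (C := K) (Form K (q + 1) l)) N).Completion) :
    completedTensor (𝟙 N) (formD (K := K) q l)
        (completedTensor (𝟙 N) (formHomotopy (K := K) q l) z) +
      completedTensor (𝟙 N) (formHomotopy (K := K) (q + 1) l)
        (completedTensor (𝟙 N) (formD (K := K) (q + 1) l) z) =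
      z - completedTensor (𝟙 N) (whitneyProj (K := K) (q + 1) l) z := by
  rw [completedTensor_comp, completedTensor_comp, ← LinearMap.add_apply, Category.id_comp,
    ← AddMonoidHom.map_add, formD_formHomotopy, completedTensor_id_sub]

theorem completedTensor_formHomotopy_formD_zero [CharZero K] (N : DirInvModule K) (l : ℕ)
    (z : (tensor (discrete (C := K) (Form K 0 l)) N).Completion) :
    completedTensor (𝟙 N) (formHomotopy (K := K) 0 l)
        (completedTensor (𝟙 N) (formD (K := K) 0 l) z) =
      z - completedTensor (𝟙 N) (whitneyProj (K := K) 0 l) z := by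
  rw [completedTensor_comp, Category.id_comp, formHomotopy_formD_zero,
    completedTensor_id_sub]

/-- The homotopy `s ⊗̂ 1` on the complete Thom-Sullivan normalization. -/
def thomSullivanHomotopy [CharZero K] (q : ℕ) : thomSullivanSub M (q + 1) →ₗ[K] thomSullivanSub M q :=
  LinearMap.restrict (LinearMap.pi fun l => completedTensor (𝟙 (M.obj ⦋l⦌))
    (formHomotopy (K := K) q l) ∘ₗ LinearMap.proj l) (by
    intro u hu k l α
    have h := congrArg (completedTensor (𝟙 (M.obj ⦋l⦌)) (formHomotopy (K := K) q k)) (hu k l α)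
    simp only [LinearMap.pi_apply, LinearMap.comp_apply, LinearMap.proj_apply]
    rw [coface_eq, restrictForm_eq, completedTensor_comp, completedTensor_comp] at h ⊢
    -- Naturality of s is what preserves the compatibility conditions.
    rw [formPullback_formHomotopy α.toOrderHom.monotone]
    exact h)

theorem thomSullivanD_homotopy [CharZero K] (q : ℕ) (u : thomSullivanSub M (q + 1)) :
    thomSullivanD M q (thomSullivanHomotopy M q u) +
      thomSullivanHomotopy M (q + 1) (thomSullivanD M (q + 1) u) =
        u - whitneySection M hM (q + 1) (integrate M hM (q + 1) u) := by
  refine Subtype.ext (funext fun l => ?_)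
  exact (completedTensor_formD_formHomotopy (M.obj ⦋l⦌) q l (u.1 l)).trans
    (congrArg (u.1 l - ·) (whitneySection_integrate M hM (q + 1) l u).symm)

theorem thomSullivanHomotopy_d_zero [CharZero K] (u : thomSullivanSub M 0) :
    thomSullivanHomotopy M 0 (thomSullivanD M 0 u) =
      u - whitneySection M hM 0 (integrate M hM 0 u) := by
  refine Subtype.ext (funext fun l => ?_)
  exact (completedTensor_formHomotopy_formD_zero (M.obj ⦋l⦌) l (u.1 l)).trans
    (congrArg (u.1 l - ·) (whitneySection_integrate M hM 0 l u).symm)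

theorem thomSullivanD_thomSullivanD (q : ℕ) (u : thomSullivanSub M q) :
    thomSullivanD M (q + 1) (thomSullivanD M q u) = 0 :=
  Subtype.ext (funext fun l => completedD_completedD M q l l (u.1 l))

/-- Section after integral is 1 - (ds + sd), and such an operator commutes with d because d d = 0.
-/
theorem whitneySection_integrate_thomSullivanD [CharZero K] (q : ℕ) (u : thomSullivanSub M q) :
    whitneySection M hM (q + 1) (integrate M hM (q + 1) (thomSullivanD M q u)) =
      thomSullivanD M q (whitneySection M hM q (integrate M hM q u)) := by
  have h1 := thomSullivanD_homotopy M hM q (thomSullivanD M q u)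
  rw [thomSullivanD_thomSullivanD, map_zero, add_zero] at h1
  have h2 : thomSullivanD M q (thomSullivanHomotopy M q (thomSullivanD M q u)) =
      thomSullivanD M q u -
        thomSullivanD M q (whitneySection M hM q (integrate M hM q u)) := by
    cases q with
    | zero => rw [thomSullivanHomotopy_d_zero M hM, map_sub]
    | succ q =>
      rw [← map_sub, ← thomSullivanD_homotopy M hM q, map_add, thomSullivanD_thomSullivanD,
        zero_add]
  exact sub_right_injective (h1.symm.trans h2)

/-- The differential of the standard normalization. -/
def normD (q : ℕ) : normSub (underlying M) q →ₗ[K] normSub (underlying M) (q + 1) :=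
  (AlgebraicTopology.AlternatingCofaceMapComplex.objD (underlying M) q).hom.restrict
    (objD_mem_normSub (underlying M) q)

theorem normD_integrate [CharZero K] (q : ℕ) (u : thomSullivanSub M q) :
    normD M q (integrate M hM q u) = integrate M hM (q + 1) (thomSullivanD M q u) :=
  Subtype.ext (integrate_thomSullivanD M hM q u).symm

/-- No exterior derivative of a Whitney form is computed: the projection commutes with d,
integration is a morphism of complexes, and the section is a right inverse of integration. -/
theorem thomSullivanD_whitneySection [CharZero K] (q : ℕ) (m : normSub (underlying M) q) :
    thomSullivanD M q (whitneySection M hM q m) = whitneySection M hM (q + 1) (normD M q m) := by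
  have h := whitneySection_integrate_thomSullivanD M hM q (whitneySection M hM q m)
  rw [← normD_integrate, integrate_whitneySection] at h
  exact h.symm

theorem thomSullivan_d (q : ℕ) :
    (thomSullivan M).d q (q + 1) = ModuleCat.ofHom (thomSullivanD M q) :=
  CochainComplex.of_d (fun q => ModuleCat.of K (thomSullivanSub M q))
    (fun q => ModuleCat.ofHom (thomSullivanD M q)) q

theorem stdNormalization_d (q : ℕ) :
    (stdNormalization (underlying M)).d q (q + 1) = ModuleCat.ofHom (normD M q) :=
  CochainComplex.of_d (fun q => ModuleCat.of K (normSub (underlying M) q))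
    (fun q => ModuleCat.ofHom (normD M q)) q

/-- The integration map, as a morphism of complexes. -/
def integrateHom [CharZero K] : thomSullivan M ⟶ stdNormalization (underlying M) :=
  CochainComplex.ofHom (fun q => ModuleCat.ofHom (integrate M hM q)) fun q => by
    rw [thomSullivan_d, stdNormalization_d]
    exact ModuleCat.hom_ext (LinearMap.ext fun u => normD_integrate M hM q u)

/-- The section of the integration map, as a morphism of complexes. -/
def whitneySectionHom [CharZero K] : stdNormalization (underlying M) ⟶ thomSullivan M :=
  CochainComplex.ofHom (fun q => ModuleCat.ofHom (whitneySection M hM q)) fun q => by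
    rw [thomSullivan_d, stdNormalization_d]
    exact ModuleCat.hom_ext (LinearMap.ext fun m => thomSullivanD_whitneySection M hM q m)

theorem whitneySectionHom_integrateHom [CharZero K] :
    whitneySectionHom M hM ≫ integrateHom M hM = 𝟙 _ :=
  HomologicalComplex.hom_ext _ _ fun q =>
    ModuleCat.hom_ext (LinearMap.ext fun m => integrate_whitneySection M hM q m)

/-- The components of the homotopy between the identity and the composition of the integration
map with its section. -/
def homotopyComponent [CharZero K] (i j : ℕ) (h : (ComplexShape.up ℕ).Rel j i) :
    (thomSullivan M).X i ⟶ (thomSullivan M).X j :=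
  eqToHom (congrArg (thomSullivan M).X (show i = j + 1 from h.symm)) ≫
    ModuleCat.ofHom (thomSullivanHomotopy M j)

theorem homotopyComponent_succ [CharZero K] (j : ℕ) (h : (ComplexShape.up ℕ).Rel j (j + 1)) :
    homotopyComponent M (j + 1) j h = ModuleCat.ofHom (thomSullivanHomotopy M j) :=
  Category.id_comp _

theorem id_sub_integrateHom_whitneySectionHom [CharZero K] :
    𝟙 (thomSullivan M) - integrateHom M hM ≫ whitneySectionHom M hM =
      Homotopy.nullHomotopicMap' (homotopyComponent M) := by
  have hr : ∀ q, (ComplexShape.up ℕ).Rel q (q + 1) := fun _ => rfl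
  refine HomologicalComplex.hom_ext _ _ fun q => ?_
  cases q with
  | zero =>
    rw [Homotopy.nullHomotopicMap'_f_of_not_rel_right (hr 0) (by simp),
      homotopyComponent_succ M 0, thomSullivan_d M 0]
    exact ModuleCat.hom_ext (LinearMap.ext fun u => (thomSullivanHomotopy_d_zero M hM u).symm)
  | succ q =>
    rw [Homotopy.nullHomotopicMap'_f (hr q) (hr (q + 1)),
      homotopyComponent_succ M q, homotopyComponent_succ M (q + 1), thomSullivan_d M q,
      thomSullivan_d M (q + 1)]
    exact ModuleCat.hom_ext (LinearMap.ext fun u =>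
      (thomSullivanD_homotopy M hM q u).symm.trans (add_comm _ _))

/-- The integration map is a homotopy equivalence. -/
def integrateEquiv [CharZero K] :
    HomotopyEquiv (thomSullivan M) (stdNormalization (underlying M)) where
  hom := integrateHom M hM
  inv := whitneySectionHom M hM
  homotopyHomInvId := (Homotopy.equivSubZero.symm
    ((Homotopy.ofEq (id_sub_integrateHom_whitneySectionHom M hM)).trans
      (Homotopy.nullHomotopy' (homotopyComponent M)))).symm
  homotopyInvHomId := Homotopy.ofEq (whitneySectionHom_integrateHom M hM)

end Comparison

end

end DirInv

open CategoryTheory Simplicial DirInv in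
theorem mainTheorem8 {K : Type u} [Field K] [CharZero K]
    (M : CosimplicialObject (DirInvModule K)) (hM : ∀ q : ℕ, (M.obj ⦋q⦌).IsComplete) :
    ∃ f : thomSullivan M ⟶ stdNormalization (underlying M),
      (∀ (q : ℕ) (u : (thomSullivan M).X q),
        stdInclusion M q ((f.f q).hom u) =
          completedIntegral q (M.obj ⦋q⦌) (hM q) (thomSullivanEntry M q q u)) ∧
      QuasiIso f ∧
      ∃ e : HomotopyEquiv (thomSullivan M) (stdNormalization (underlying M)), e.hom = f :=
  ⟨integrateHom M hM, fun _ _ => rfl, (integrateEquiv M hM).quasiIso_hom, integrateEquiv M hM, rfl⟩
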